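/- **Setting.** Let $\mathcal G$ be a directed acyclic graph on a finite set $\mathbf V$ of $n$ observed variables (causal sufficiency), with maximum in-degree $\Delta_{in}$, and let $P$ be a joint distribution of the variables that is Markov and faithful with respect to $\mathcal G$: for distinct $X,Y\in\mathbf V$ and $\mathbf Z\subseteq\mathbf V\setminus\{X,Y\}$, $X\perp\!\!\!\perp Y\mid\mathbf Z$ holds in $P$ if and only if $\mathbf Z$ d-separates $X$ and $Y$ in $\mathcal G$. A CI test on $(\{X,Y\},\mathbf Z)$ reports correctly whether $X\perp\!\!\!\perp Y\mid \mathbf Z$ in $P$. The *skeleton* of $\mathcal G$ is the undirected graph with an edge between $X$ and $Y$ whenever $X\to Y$ or $Y\to X$. **MARVEL.** Start with the empty undirected graph $\hat{\mathcal G}$ on $\mathbf V$, $\mathbf V_1=\mathbf V$, and all flags $\mathrm{skip}(X)$, $\mathrm{skip}_1(X,\{Y,Z\})$, $\mathrm{skip}_2(X,Y,Z)$ false. *ComputeMb*: for each unordered pair, $X$ and $Y$ are put into each other's Markov boundary $\mathrm{Mb}$ iff they test dependent given $\mathbf V\setminus\{X,Y\}$. For $i=1,\dots,n-1$: sort the $X\in\mathbf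 V_i$ with $\mathrm{skip}(X)$ false by $|\mathrm{Mb}(X)|$, and treat them in this order until one is removed, as follows. 1. *FindNeighbors* (first time for $X$ only): for each $Y\in\mathrm{Mb}(X)$ search for a set $\mathbf S_{XY}\subsetneq\mathrm{Mb}(X)\setminus\{Y\}$ given which $X,Y$ test independent; $Y$ is a co-parent, $Y\in CP$, if one is found, and otherwise a neighbor, $Y\in Ne$; add the edges between $X$ and $Ne$ to $\hat{\mathcal G}$. At later times, $Ne$ is the set of neighbors of $X$ in $\hat{\mathcal G}[\mathbf V_i]$ and $CP=\mathrm{Mb}(X)\setminus Ne$. 2. *Condition1*: for each pair $\{Y,Z\}\subseteq Ne$ of distinct variables with $\mathrm{skip}_1(X,\{Y,Z\})$ false, test $Y,Z$ given $\mathbf S\cup\{X\}$ for the $\mathbf S\subseteq \mathrm{Mb}(X)\setminus\{Y,Z\}$; stop with answer false at the first independence; if there is none, set $\mathrm{skip}_1(X,\{Y,Z\})$ to true. If all pairs pass, the answer is true. 3. If Condition1 is true, *FindVS* (first time for $X$ only): $\mathcal V(X)$ consists of the $X\to Z\leftarrow Y$ with $Y\in CP$, $Z\in Ne$, $Z\notin\mathbf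 S_{XY}$, such that no $\mathbf S\subseteq(\mathrm{Mb}(X)\cup\{X\})\setminus\{Y,Z\}$ makes $Y,Z$ test independent (searching until one is found). At later times, only those with $Y,Z\in\mathbf V_i$ are kept. 4. Then *Condition2*: for each $Y\in CP$, $Z\in Ne$ with $\mathrm{skip}_2(X,Y,Z)$ false, let $\Gamma=\{V\ne Z:(X\to V\leftarrow Y)\in\mathcal V(X)\}$ and test $Y,Z$ given $\mathbf S\cup\{X\}$ for the $\mathbf S\subseteq\mathrm{Mb}(X)\setminus\{Y,Z\}$ with $\mathbf S\cap\Gamma\neq\varnothing$; stop with answer false at the first independence; if there is none, set $\mathrm{skip}_2(X,Y,Z)$ to true. If all pass, the answer is true. 5. If one of the two conditions is false, set $\mathrm{skip}(X)$ to true. If both are true, remove $X$: $\mathbf V_{i+1}=\mathbf V_i\setminus\{X\}$, and *UpdateMb*: delete $X$ from all Markov boundaries; then for each unordered pair $Y,Z\in Ne$, with $|\mathrm{Mb}(Y)|\le|\mathrm{Mb}(Z)|$ before the removal, test $Y,Z$ given $\mathrm{Mb}(Y)\setminus\{Y,Z\}$ ($\mathrm{Mb}(Y)$ being the current, already updated one),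 and if they are independent delete them from each other's Markov boundary. Every variable whose Markov boundary changes gets its flag $\mathrm{skip}$ reset to false. Return $\hat{\mathcal G}$. Ties in the sorting and the orders of all loops and searches are arbitrary. Repetitions are counted per routine and per variable: a performed CI test is a *duplicate* if the same routine (ComputeMb, FindNeighbors, Condition1, FindVS, Condition2 or UpdateMb), called for the same variable $X$ (ComputeMb is called once, for no variable), has already performed the same CI test; the other performed tests are the *unique* ones. **Proposition (Completeness and complexity of MARVEL).** MARVEL returns the skeleton of $\mathcal G$. It performs at most $$\binom n2+n\binom{\Delta_{in}}2+\frac n2\,\Delta_{in}\,(1+0.45\,\Delta_{in})\,2^{\Delta_{in}}=O\big(n^2+n\,\Delta_{in}^2\,2^{\Delta_{in}}\big)$$ unique CI tests (in particular, at most that many distinct triples are tested), plus at most $\binom n2 2^{\Delta_{in}-1}$ duplicate CI tests. The constant in $O(\cdot)$ is absolute. -/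

import Mathlib

open MeasureTheory ProbabilityTheory

namespace Marvel

/-! ### Directed acyclic graphs, d-separation -/

/-- A directed acyclic graph on the vertex set `V`; `edge u v` means `u → v`. -/
structure DAG (V : Type*) where
  edge : V → V → Prop
  acyclic : ∀ v, ¬ Relation.TransGen edge v v

namespace DAG

variable {V : Type*} (G : DAG V)

/-- The skeleton: the undirected graph that joins the end points of every edge. -/
def skeleton : SimpleGraph V where
  Adj u v := G.edge u v ∨ G.edge v u
  symm := ⟨fun _ _ h => h.symm⟩
  loopless := ⟨fun v h => G.acyclic v (Relation.TransGen.single (h.elim id id))⟩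

/-- `u` is an ancestor of `v` (every vertex is an ancestor of itself). -/
def IsAncestor (u v : V) : Prop := Relation.ReflTransGen G.edge u v

/-- `b` is a collider between its neighbours `a` and `c` on a path: `a → b ← c`. -/
def IsCollider (a b c : V) : Prop := G.edge a b ∧ G.edge c b

/-- The path `p` from `x` to `y` is blocked by `S`: it has an inner vertex `w` that is a collider on
`p` and not an ancestor of an element of `S ∪ {x, y}`, or that is a non-collider on `p` in `S`. -/
def Blocked {x y : V} (p : G.skeleton.Walk x y) (S : Finset V) : Prop :=
  ∃ i, i + 2 ≤ p.length ∧
    ((G.IsCollider (p.getVert i) (p.getVert (i + 1)) (p.getVert (i + 2)) ∧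
        ∀ t, (t ∈ S ∨ t = x ∨ t = y) → ¬ G.IsAncestor (p.getVert (i + 1)) t) ∨
      (¬ G.IsCollider (p.getVert i) (p.getVert (i + 1)) (p.getVert (i + 2)) ∧
        p.getVert (i + 1) ∈ S))

/-- `S` d-separates `x` and `y`: all paths between `x` and `y` are blocked by `S`. -/
def DSep (x y : V) (S : Finset V) : Prop :=
  ∀ p : G.skeleton.Walk x y, p.IsPath → G.Blocked p S

open Classical in
/-- The maximum in-degree. -/
noncomputable def maxInDegree [Fintype V] : ℕ :=
  Finset.univ.sup fun v => (Finset.univ.filter fun u => G.edge u v).card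

end DAG

/-! ### Conditional independence in a joint distribution -/

section Distribution

variable {V : Type*} {E : V → Type*} [Fintype V]
  [∀ v, MeasurableSpace (E v)] [∀ v, StandardBorelSpace (E v)]

/-- The variables `x` and `y` are conditionally independent given the variables in `S`, in the
joint distribution `P` of all the variables. -/
def CondIndependent (P : Measure (∀ v, E v)) [IsFiniteMeasure P] (x y : V) (S : Finset V) : Prop :=
  CondIndepFun (MeasurableSpace.comap S.restrict inferInstance)
    (Finset.measurable_restrict S).comap_le (fun ω => ω x) (fun ω => ω y) P

/-- `P` satisfies the Markov property with respect to `G`. -/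
def IsMarkov (P : Measure (∀ v, E v)) [IsFiniteMeasure P] (G : DAG V) : Prop :=
  ∀ (x y : V) (S : Finset V), x ≠ y → x ∉ S → y ∉ S → G.DSep x y S → CondIndependent P x y S

/-- `P` is faithful to `G`. -/
def IsFaithful (P : Measure (∀ v, E v)) [IsFiniteMeasure P] (G : DAG V) : Prop :=
  ∀ (x y : V) (S : Finset V), x ≠ y → x ∉ S → y ∉ S → CondIndependent P x y S → G.DSep x y S

end Distribution

/-! ### CI tests and the state of the algorithm -/

/-- A CI test on the triple `(x, y, S)`, written `(s(x, y), S)`. -/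
abbrev CITest (V : Type*) := Sym2 V × Finset V

/-- The purpose for which a CI test is performed: the routine, and the variable which the routine
was called for. -/
inductive Purpose (V : Type*) where
  | computeMb : Purpose V
  | findNeighbors (X : V) : Purpose V
  | condition1 (X : V) : Purpose V
  | findVS (X : V) : Purpose V
  | condition2 (X : V) : Purpose V
  | updateMb (X : V) : Purpose V
  deriving DecidableEq

/-- The variables of the program. -/
structure State (V : Type*) where
  /-- The remaining variables `V_i`. -/
  rem : Finset V
  /-- The current Markov boundaries. -/
  mb : V → Finset V
  /-- The edges of the learned graph. -/
  edges : Finset (Sym2 V)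
  /-- The variables whose `SkipCheck_vec` is true. -/
  skipVec : Finset V
  /-- The `(X, {Y, Z})` whose `SkipCheck_cond1` is true. -/
  skipCond1 : Finset (V × Sym2 V)
  /-- The `(X, Y, Z)` whose `SkipCheck_cond2` is true. -/
  skipCond2 : Finset (V × V × V)
  /-- The variables to which `FindNeighbors` has been applied. -/
  nbrsDone : Finset V
  /-- `sepset X Y` is the separating set of `X` and `Y` found by `FindNeighbors` for `X`. -/
  sepset : V → V → Finset V
  /-- The variables to which `FindVS` has been applied. -/
  vsDone : Finset V
  /-- `(Z, Y) ∈ vs X` means that `X → Z ← Y` is in `VS(X)`. -/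
  vs : V → Finset (V × V)
  /-- All CI tests performed so far, in order, with repetitions. -/
  log : List (Purpose V × CITest V)

/-- A resolution of what the pseudocode leaves open: the order in which each loop and each search
runs through its range, and in which ties are broken. The choices may depend on the whole state,
hence on everything that happened before. -/
structure Schedule (V : Type*) where
  vertices : State V → Finset V → List V
  pairs : State V → Finset (Sym2 V) → List (Sym2 V)
  couples : State V → Finset (V × V) → List (V × V)
  subsets : State V → Finset (Finset V) → List (Finset V)
  orient : State V → Sym2 V → V × V
  vertices_spec : ∀ σ s, (vertices σ s : Multiset V) = s.val
  pairs_spec : ∀ σ s, (pairs σ s : Multiset (Sym2 V)) = s.val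
  couples_spec : ∀ σ s, (couples σ s : Multiset (V × V)) = s.val
  subsets_spec : ∀ σ s, (subsets σ s : Multiset (Finset V)) = s.val
  orient_spec : ∀ σ e, s((orient σ e).1, (orient σ e).2) = e

section Algorithm

variable {V : Type*} [DecidableEq V]

/-- Perform one CI test. `ci t = true` means that the test yields independence. The algorithm
accesses `ci` (the data) in no other way. -/
def performTest (ci : CITest V → Bool) (why : Purpose V) (t : CITest V) (σ : State V) :
    Bool × State V :=
  (ci t, { σ with log := σ.log ++ [(why, t)] })

/-- Test the pair `e` given the sets of a list, one after the other, until a set is found that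
separates the pair; return that set, if any. -/
def findSep (ci : CITest V → Bool) (why : Purpose V) (e : Sym2 V) :
    List (Finset V) → State V → Option (Finset V) × State V
  | [], σ => (none, σ)
  | S :: l, σ =>
    let (b, σ') := performTest ci why (e, S) σ
    if b then (some S, σ') else findSep ci why e l σ'

/-- The unordered pairs of distinct elements of `s`. -/
def unorderedPairs (s : Finset V) : Finset (Sym2 V) := s.sym2.filter fun e => ¬ e.IsDiag

/-- `ComputeMb` by total conditioning: `X` and `Y` are in each other's Markov boundary if and only
if they are dependent given all other variables. -/
def computeMb [Fintype V] (ci : CITest V → Bool) (sch : Schedule V) (σ : State V) : State V :=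
  (sch.pairs σ (unorderedPairs Finset.univ)).foldl (fun σ e =>
    let (b, σ') := performTest ci .computeMb (e, Finset.univ.filter (· ∉ e)) σ
    if b then σ'
    else { σ' with mb := fun v => σ'.mb v ∪ Finset.univ.filter (fun w => s(v, w) = e) }) σ

/-- `FindNeighbors` for `X`; returns the neighbours and the co-parents, and stores the separating
sets of the latter. -/
def findNeighbors (ci : CITest V → Bool) (sch : Schedule V) (X : V) (σ : State V) :
    (Finset V × Finset V) × State V :=
  (sch.vertices σ (σ.mb X)).foldl (fun acc Y =>
    let ((ne, cp), σ) := acc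
    match findSep ci (.findNeighbors X) s(X, Y)
        (sch.subsets σ ((σ.mb X).erase Y).ssubsets) σ with
    | (some S, σ') => ((ne, insert Y cp),
        { σ' with sepset := Function.update σ'.sepset X (Function.update (σ'.sepset X) Y S) })
    | (none, σ') => ((insert Y ne, cp), σ')) ((∅, ∅), σ)

/-- `FindVS` for `X`, with neighbours `ne` and co-parents `cp`; stores the result in `vs X`. -/
def findVS (ci : CITest V → Bool) (sch : Schedule V) (X : V) (ne cp : Finset V) (σ : State V) :
    State V :=
  let σ₀ := { σ with vs := Function.update σ.vs X ∅ }
  (sch.couples σ₀ (cp ×ˢ ne)).foldl (fun σ YZ =>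
    if YZ.2 ∈ σ.sepset X YZ.1 then σ
    else
      match findSep ci (.findVS X) s(YZ.1, YZ.2)
          (sch.subsets σ (insert X (σ.mb X) \ {YZ.1, YZ.2}).powerset) σ with
      | (some _, σ') => σ'
      | (none, σ') =>
        { σ' with vs := Function.update σ'.vs X (insert (YZ.2, YZ.1) (σ'.vs X)) }) σ₀

/-- The loop of `Condition1` for `X` over the listed pairs of neighbours of `X`. -/
def condition1Loop (ci : CITest V → Bool) (sch : Schedule V) (X : V) :
    List (Sym2 V) → State V → Bool × State V
  | [], σ => (true, σ)
  | e :: l, σ =>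
    match findSep ci (.condition1 X) e
        ((sch.subsets σ ((σ.mb X).filter (· ∉ e)).powerset).map (insert X)) σ with
    | (some _, σ') => (false, σ')
    | (none, σ') =>
      condition1Loop ci sch X l { σ' with skipCond1 := insert (X, e) σ'.skipCond1 }

/-- `Condition1` for `X` with neighbours `ne`. -/
def condition1 (ci : CITest V → Bool) (sch : Schedule V) (X : V) (ne : Finset V) (σ : State V) :
    Bool × State V :=
  condition1Loop ci sch X
    (sch.pairs σ ((unorderedPairs ne).filter fun e => (X, e) ∉ σ.skipCond1)) σ

/-- The loop of `Condition2` for `X` over the listed couples `(Y, Z)`. -/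
def condition2Loop (ci : CITest V → Bool) (sch : Schedule V) (X : V) :
    List (V × V) → State V → Bool × State V
  | [], σ => (true, σ)
  | YZ :: l, σ =>
    -- the set `Γ` of all `V ≠ Z` such that `X → V ← Y` is in `VS(X)`
    let Γ := (σ.mb X).filter fun v => v ≠ YZ.2 ∧ (v, YZ.1) ∈ σ.vs X
    match findSep ci (.condition2 X) s(YZ.1, YZ.2)
        ((sch.subsets σ
          ((σ.mb X \ {YZ.1, YZ.2}).powerset.filter fun S => (S ∩ Γ).Nonempty)).map (insert X)) σ with
    | (some _, σ') => (false, σ')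
    | (none, σ') =>
      condition2Loop ci sch X l { σ' with skipCond2 := insert (X, YZ) σ'.skipCond2 }

/-- `Condition2` for `X` with neighbours `ne` and co-parents `cp`. -/
def condition2 (ci : CITest V → Bool) (sch : Schedule V) (X : V) (ne cp : Finset V) (σ : State V) :
    Bool × State V :=
  condition2Loop ci sch X
    (sch.couples σ ((cp ×ˢ ne).filter fun YZ => (X, YZ) ∉ σ.skipCond2)) σ

/-- The neighbours and co-parents of `X` among the remaining variables: by `FindNeighbors` at the
first time (then the new edges are added to the learned graph), and read off the learned graph
afterwards. -/
def getNeighbors (ci : CITest V → Bool) (sch : Schedule V) (X : V) (σ : State V) :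
    (Finset V × Finset V) × State V :=
  if X ∉ σ.nbrsDone then
    let ((ne, cp), σ') := findNeighbors ci sch X σ
    ((ne, cp), { σ' with
      edges := σ'.edges ∪ ne.image (fun Y => s(X, Y)),
      nbrsDone := insert X σ'.nbrsDone })
  else
    let ne := σ.rem.filter fun Y => s(X, Y) ∈ σ.edges
    ((ne, σ.mb X \ ne), σ)

/-- Update `VS(X)`: by `FindVS` at the first time; afterwards only those v-structures are kept whose
variables remain. -/
def getVS (ci : CITest V → Bool) (sch : Schedule V) (X : V) (ne cp : Finset V) (σ : State V) :
    State V :=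
  if X ∉ σ.vsDone then
    let σ' := findVS ci sch X ne cp σ
    { σ' with vsDone := insert X σ'.vsDone }
  else
    let kept := (σ.vs X).filter fun ZY => ZY.1 ∈ σ.rem ∧ ZY.2 ∈ σ.rem
    { σ with vs := Function.update σ.vs X kept }

/-- `UpdateMb`, upon removal of `X` (already deleted from `rem`) with neighbours `ne`. A variable
whose Markov boundary changes gets its `SkipCheck_vec` reset to false. -/
def updateMb (ci : CITest V → Bool) (sch : Schedule V) (X : V) (ne : Finset V) (σ : State V) :
    State V :=
  let σ₀ : State V := { σ with
    mb := fun Y => if Y ∈ σ.mb X then (σ.mb Y).erase X else σ.mb Y,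
    skipVec := σ.skipVec \ σ.mb X }
  (sch.pairs σ₀ (unorderedPairs ne)).foldl (fun τ e =>
    let o := sch.orient τ e
    -- the end point with the smaller Markov boundary before the removal of `X` comes first
    let (Y, Z) := if (σ.mb o.1).card ≤ (σ.mb o.2).card then o else (o.2, o.1)
    let (b, τ') := performTest ci (.updateMb X) (e, τ.mb Y \ {Y, Z}) τ
    if b then
      { τ' with
        mb := fun v => if v = Y then (τ'.mb v).erase Z else if v = Z then (τ'.mb v).erase Y
          else τ'.mb v,
        skipVec := τ'.skipVec \ {Y, Z} }
    else τ') σ₀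

/-- Check the variables of the sorted list one after the other, until one is found removable;
remove that one. -/
def removeFirst (ci : CITest V → Bool) (sch : Schedule V) : List V → State V → State V
  | [], σ => σ
  | X :: l, σ =>
    let ((ne, cp), σ₁) := getNeighbors ci sch X σ
    let (b₁, σ₂) := condition1 ci sch X ne σ₁
    if b₁ then
      let (b₂, σ₃) := condition2 ci sch X ne cp (getVS ci sch X ne cp σ₂)
      if b₂ then updateMb ci sch X ne { σ₃ with rem := σ₃.rem.erase X }
      else removeFirst ci sch l { σ₃ with skipVec := insert X σ₃.skipVec }
    else removeFirst ci sch l { σ₂ with skipVec := insert X σ₂.skipVec }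

/-- One iteration of the outer loop: the remaining variables whose `SkipCheck_vec` is false are
sorted by the size of their Markov boundaries, with ties broken by the schedule. -/
def iteration (ci : CITest V → Bool) (sch : Schedule V) (σ : State V) : State V :=
  removeFirst ci sch
    ((sch.vertices σ (σ.rem \ σ.skipVec)).mergeSort
      fun X Y => decide ((σ.mb X).card ≤ (σ.mb Y).card)) σ

/-- The initial values of the variables of the program. -/
def initialState [Fintype V] : State V where
  rem := Finset.univ
  mb := fun _ => ∅
  edges := ∅
  skipVec := ∅
  skipCond1 := ∅
  skipCond2 := ∅
  nbrsDone := ∅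
  sepset := fun _ _ => ∅
  vsDone := ∅
  vs := fun _ => ∅
  log := []

/-- MARVEL: the final state of the run with test outcomes `ci` and schedule `sch`. -/
def run [Fintype V] (ci : CITest V → Bool) (sch : Schedule V) : State V :=
  (iteration ci sch)^[Fintype.card V - 1] (computeMb ci sch initialState)

/-- The undirected graph that MARVEL returns. -/
def output [Fintype V] (ci : CITest V → Bool) (sch : Schedule V) : SimpleGraph V :=
  SimpleGraph.fromEdgeSet ((run ci sch).edges : Set (Sym2 V))

/-- The number of CI tests performed, with repetitions. -/
def numTests [Fintype V] (ci : CITest V → Bool) (sch : Schedule V) : ℕ :=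
  (run ci sch).log.length

/-- The number of unique CI tests: tests that the same routine performs again for the same variable
are counted once. -/
def numUnique [Fintype V] (ci : CITest V → Bool) (sch : Schedule V) : ℕ :=
  (run ci sch).log.toFinset.card

/-- The number of duplicate CI tests: those that the same routine has already performed for the same
variable. -/
def numDuplicate [Fintype V] (ci : CITest V → Bool) (sch : Schedule V) : ℕ :=
  numTests ci sch - numUnique ci sch

/-- The number of distinct triples `(x, y, S)` tested, whatever the purpose of the test. -/
def numTriples [Fintype V] (ci : CITest V → Bool) (sch : Schedule V) : ℕ :=
  ((run ci sch).log.map Prod.snd).toFinset.card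

end Algorithm

/-- The bound on the number of unique CI tests. -/
noncomputable def uniqueBound (n Δ : ℕ) : ℝ :=
  n.choose 2 + n * Δ.choose 2 + n / 2 * Δ * (1 + 0.45 * Δ) * 2 ^ Δ

end Marvel

/-! The proof replaces d-separation by separation in the moral graph of the ancestral set (`Conn`,
`conn_iff_not_dSep`). By the Markov property and faithfulness the CI tests then decide `Conn`, and
the main invariant (`Oracle`) is that tests among the remaining variables `R` decide `Conn` in the
subgraph induced on `R`.

Correctness rests on two one-sided facts. First, passing both conditions forces `X` to be
`Removable` (`removable_of_conn`): for a child `Z` of `X`, conditioning on the parents of `Z` is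
among the tests, and the local Markov property rules out every bad configuration. Deleting such an
`X` preserves `Conn` among the others (`Removable.conn_iff`), because a last child of `X` in the
ancestral set takes over its role. Secondly, a sink of the induced subgraph never fails: its Markov
boundary consists of its parents, so each test of Condition1 conditions on a common child, and
Condition2 has no co-parents to range over. Hence every iteration removes a variable. No converse,
that all removable variables pass, is needed. Each variable has its incident edges recorded before
it is removed, and at most one variable is left at the end; so the output is the skeleton.

A sink has Markov boundary of size at most `Δ`, the maximum in-degree. Since variables are treated
by increasing size and a sink is always in the list, every treated variable has a boundary of size
at most `Δ`. Boundaries only shrink, so all tests for `X` other than those of UpdateMb lie in a set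
determined by the boundary at its first treatment. With `k` neighbours and `l` co-parents, `m = k +
l`, that set has at most `(m/2 + C(k,2)/4 + 3kl/4) 2^m` elements, and optimising over `k` and `l`
gives the constant `0.45` (`DAG.card_testSet_le`).

Only the two conditions can repeat a test, and only on a pair on which they failed before, since a
pair that passes is flagged. Each failed call fails on one pair, at a cost of at most `2^Δ / 4`
tests. An amortised count (`Count`) charges every duplicate to a failure, one such amount per
failure. There are at most `n` failures in each of the `n - 1` iterations, which gives `n (n - 1)
2^Δ / 4`. -/

set_option linter.unusedSectionVars false

namespace Marvel

/-! ### Moralization -/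

namespace DAG

open Relation

variable {V : Type*} (G : DAG V)

/-- `v` is an ancestor of an element of `S ∪ {x, y}`. -/
def Anc (x y : V) (S : Finset V) (v : V) : Prop :=
  ∃ t, (t ∈ S ∨ t = x ∨ t = y) ∧ G.IsAncestor v t

/-- Adjacency in the moral graph of the subgraph induced on `A`. -/
def Moral (A : V → Prop) (u v : V) : Prop :=
  G.edge u v ∨ G.edge v u ∨ ∃ c, A c ∧ G.edge u c ∧ G.edge v c

/-- `x` and `y` are connected, outside of `S`, in the moral graph of the ancestors of
`S ∪ {x, y}`. -/
def Conn (x y : V) (S : Finset V) : Prop :=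
  ReflTransGen (fun u v => G.Anc x y S v ∧ v ∉ S ∧ G.Moral (G.Anc x y S) u v) x y

/-- A walk `f 0, …, f n` inside `A` all of whose inner vertices in `S` are colliders. -/
structure OpenSeq (A : V → Prop) (S : Finset V) (f : ℕ → V) (n : ℕ) : Prop where
  adj : ∀ i < n, G.edge (f i) (f (i + 1)) ∨ G.edge (f (i + 1)) (f i)
  mem : ∀ i ≤ n, A (f i)
  coll : ∀ i, i + 2 ≤ n → f (i + 1) ∈ S → G.IsCollider (f i) (f (i + 1)) (f (i + 2))

variable {G}

theorem not_edge_self (v : V) : ¬ G.edge v v := fun h => G.acyclic v (.single h)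

theorem ne_of_edge {u v : V} (h : G.edge u v) : u ≠ v := by
  rintro rfl; exact not_edge_self _ h

theorem not_isAncestor_of_edge {u v : V} (h : G.edge u v) : ¬ G.IsAncestor v u :=
  fun h' => G.acyclic u (TransGen.head' h h')

theorem not_edge_of_edge {u v : V} (h : G.edge u v) : ¬ G.edge v u :=
  fun h' => not_isAncestor_of_edge h (.single h')

theorem anc_left (x y : V) (S : Finset V) : G.Anc x y S x := ⟨x, by simp, .refl⟩
theorem anc_right (x y : V) (S : Finset V) : G.Anc x y S y := ⟨y, by simp, .refl⟩
theorem anc_of_mem (x y : V) {S : Finset V} {v : V} (h : v ∈ S) : G.Anc x y S v :=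
  ⟨v, by simp [h], .refl⟩

theorem Anc.of_edge {x y : V} {S : Finset V} {u v : V} (h : G.Anc x y S v) (e : G.edge u v) :
    G.Anc x y S u :=
  let ⟨t, ht, hv⟩ := h; ⟨t, ht, .head e hv⟩

/-- Cutting out the loop between two visits of a vertex keeps the walk open: if that vertex is in
`S` and stays inner, it was a collider at both visits, so the edge entering it before the loop and
the one after the loop both point to it. Colliders outside `S` cost nothing, since openness only
asks them to lie in `A`. -/
theorem OpenSeq.shortcut {A : V → Prop} {S : Finset V} {f : ℕ → V} {n : ℕ}
    (h : G.OpenSeq A S f n) {i j : ℕ} (hij : i < j) (hj : j ≤ n) (e : f i = f j) :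
    ∃ (g : ℕ → V) (m : ℕ), m < n ∧ G.OpenSeq A S g m ∧ g 0 = f 0 ∧ g m = f n := by
  obtain ⟨g, lo, hi⟩ : ∃ g : ℕ → V, (∀ k, k ≤ i → g k = f k) ∧
      ∀ k, i ≤ k → g k = f (k + (j - i)) := by
    refine ⟨fun k => if k ≤ i then f k else f (k + (j - i)), fun k hk => if_pos hk, fun k hk => ?_⟩
    rcases hk.eq_or_lt with rfl | hk
    · simp only [le_refl, if_true]; rw [e]; congr 1; omega
    · simp only [if_neg (not_le.2 hk)]
  refine ⟨g, n - (j - i), by omega, ⟨?_, ?_, ?_⟩, lo 0 (by omega), ?_⟩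
  · intro k hk
    by_cases hki : k + 1 ≤ i
    · rw [lo k (by omega), lo _ hki]; exact h.adj k (by omega)
    · rw [hi k (by omega), hi (k + 1) (by omega)]
      have := h.adj (k + (j - i)) (by omega)
      rwa [show k + (j - i) + 1 = k + 1 + (j - i) by omega] at this
  · intro k hk
    by_cases hki : k ≤ i
    · rw [lo k hki]; exact h.mem k (by omega)
    · rw [hi k (by omega)]; exact h.mem _ (by omega)
  · intro k hk hS
    by_cases h1 : k + 2 ≤ i
    · rw [lo _ (by omega)] at hS
      rw [lo _ (by omega), lo _ (by omega), lo _ h1]; exact h.coll k (by omega) hS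
    by_cases h2 : i ≤ k
    · rw [hi _ (by omega)] at hS
      rw [hi _ (by omega), hi _ (by omega), hi _ (by omega)]
      have := h.coll (k + (j - i)) (by omega)
        (by rwa [show k + (j - i) + 1 = k + 1 + (j - i) by omega])
      rwa [show k + (j - i) + 1 = k + 1 + (j - i) by omega,
        show k + (j - i) + 2 = k + 2 + (j - i) by omega] at this
    · obtain rfl : i = k + 1 := by omega
      have hS' : f (k + 1) ∈ S := by rwa [lo _ (by omega)] at hS
      refine ⟨?_, ?_⟩
      · rw [lo _ (by omega), lo _ (by omega)]; exact (h.coll k (by omega) hS').1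
      · rw [hi (k + 2) (by omega), hi (k + 1) (by omega)]
        obtain ⟨j', rfl⟩ : ∃ j', j = j' + 1 := ⟨j - 1, by omega⟩
        have := (h.coll j' (by omega) (e ▸ hS')).2
        rwa [show k + 2 + (j' + 1 - (k + 1)) = j' + 2 by omega,
          show k + 1 + (j' + 1 - (k + 1)) = j' + 1 by omega]
  · rw [hi _ (by omega)]; congr 1; omega

/-- Between the end points of an open walk there is an open walk without repetitions. -/
theorem OpenSeq.exists_injOn {A : V → Prop} {S : Finset V} {f : ℕ → V} {n : ℕ}
    (h : G.OpenSeq A S f n) :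
    ∃ (g : ℕ → V) (m : ℕ), G.OpenSeq A S g m ∧ g 0 = f 0 ∧ g m = f n ∧
      Set.InjOn g {i | i ≤ m} := by
  induction n using Nat.strong_induction_on generalizing f with
  | _ n ih =>
    by_cases hf : Set.InjOn f {i | i ≤ n}
    · exact ⟨f, n, h, rfl, rfl, hf⟩
    · obtain ⟨i, j, hij, hj, e⟩ : ∃ i j, i < j ∧ j ≤ n ∧ f i = f j := by
        simp only [Set.InjOn, Set.mem_ofPred_eq, not_forall] at hf
        obtain ⟨i, hi, j, hj, e, hne⟩ := hf
        rcases lt_or_gt_of_ne hne with hlt | hlt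
        · exact ⟨i, j, hlt, hj, e⟩
        · exact ⟨j, i, hlt, hi, e.symm⟩
      obtain ⟨g, m, hm, hg, h0, hn⟩ := h.shortcut hij hj e
      obtain ⟨g', m', hg', h0', hn', inj⟩ := ih m hm hg
      exact ⟨g', m', hg', h0'.trans h0, hn'.trans hn, inj⟩

theorem exists_walk_getVert {H : SimpleGraph V} (n : ℕ) (f : ℕ → V)
    (h : ∀ i < n, H.Adj (f i) (f (i + 1))) :
    ∃ p : H.Walk (f 0) (f n), p.length = n ∧ ∀ i ≤ n, p.getVert i = f i := by
  induction n generalizing f with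
  | zero => exact ⟨.nil, rfl, fun i hi => by obtain rfl := Nat.le_zero.1 hi; rfl⟩
  | succ n ih =>
    obtain ⟨p, hp, hv⟩ := ih (fun i => f (i + 1)) (fun i hi => h (i + 1) (by omega))
    refine ⟨.cons (h 0 (by omega)) p, by simp [hp], fun i hi => ?_⟩
    cases i with
    | zero => simp
    | succ i => rw [SimpleGraph.Walk.getVert_cons_succ, hv i (by omega)]

theorem OpenSeq.snoc {A : V → Prop} {S : Finset V} {f : ℕ → V} {n : ℕ} {w : V}
    (h : G.OpenSeq A S f n) (hadj : G.edge (f n) w ∨ G.edge w (f n)) (hw : A w)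
    (hc : f n ∈ S → G.edge w (f n) ∧ ∀ i, i + 1 = n → G.edge (f i) (f n)) :
    G.OpenSeq A S (fun k => if k ≤ n then f k else w) (n + 1) := by
  refine ⟨fun i hi => ?_, fun i hi => ?_, fun i hi hS => ?_⟩
  · by_cases hin : i < n
    · simpa [hin.le, Nat.succ_le_of_lt hin] using h.adj i hin
    · obtain rfl : i = n := by omega
      simpa using hadj
  · by_cases hin : i ≤ n
    · simpa [hin] using h.mem i hin
    · simpa [hin] using hw
  · by_cases hin : i + 2 ≤ n
    · simp only [show i + 1 ≤ n by omega, if_true] at hS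
      simpa [hin, show i + 1 ≤ n by omega, show i ≤ n by omega] using h.coll i hin hS
    · obtain rfl : n = i + 1 := by omega
      simp only [le_refl, if_true] at hS
      simpa [IsCollider] using ⟨(hc hS).2 i rfl, (hc hS).1⟩

/-- A step between two parents of a common child `c` is expanded to `u → c ← w`. The inserted vertex
is a collider, so it may lie in `S`; all other vertices of the walk avoid `S`. -/
theorem Conn.exists_openSeq {x y : V} {S : Finset V} (hx : x ∉ S) (h : G.Conn x y S) :
    ∃ (f : ℕ → V) (n : ℕ), G.OpenSeq (G.Anc x y S) S f n ∧ f 0 = x ∧ f n = y := by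
  suffices H : ∀ v, ReflTransGen (fun u v => G.Anc x y S v ∧ v ∉ S ∧ G.Moral (G.Anc x y S) u v) x v →
      v ∉ S ∧ ∃ (f : ℕ → V) (n : ℕ), G.OpenSeq (G.Anc x y S) S f n ∧ f 0 = x ∧ f n = v from
    (H y h).2
  intro v hv
  induction hv with
  | refl =>
    exact ⟨hx, fun _ => x, 0, ⟨fun i hi => absurd hi (by omega), fun _ _ => anc_left x y S,
      fun i hi => absurd hi (by omega)⟩, rfl, rfl⟩
  | @tail u w _ hs ih =>
    obtain ⟨huS, f, n, hf, h0, rfl⟩ := ih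
    obtain ⟨hwA, hwS, hm⟩ := hs
    refine ⟨hwS, ?_⟩
    have direct : (G.edge (f n) w ∨ G.edge w (f n)) →
        ∃ (f : ℕ → V) (n : ℕ), G.OpenSeq (G.Anc x y S) S f n ∧ f 0 = x ∧ f n = w := fun hadj =>
      ⟨_, _, hf.snoc hadj hwA (fun h => absurd h huS), by simpa using h0, by simp⟩
    rcases hm with e | e | ⟨c, hcA, e1, e2⟩
    · exact direct (.inl e)
    · exact direct (.inr e)
    · have h1 := hf.snoc (w := c) (.inl e1) hcA (fun h => absurd h huS)
      refine ⟨_, _, h1.snoc (w := w) (.inr (by simpa using e2)) hwA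
        (fun _ => ⟨by simpa using e2, fun i hi => ?_⟩), by simpa using h0, by simp⟩
      obtain rfl : i = n := by omega
      simpa using e1

theorem Conn.not_dSep {x y : V} {S : Finset V} (hx : x ∉ S) (h : G.Conn x y S) :
    ¬ G.DSep x y S := by
  intro hd
  obtain ⟨f, n, hf, h0, hn⟩ := h.exists_openSeq hx
  obtain ⟨g, m, hg, h0', hn', inj⟩ := hf.exists_injOn
  obtain ⟨p, hp, hv⟩ := exists_walk_getVert (H := G.skeleton) m g hg.adj
  obtain rfl : g 0 = x := h0'.trans h0
  obtain rfl : g m = y := hn'.trans hn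
  have hpath : p.IsPath := by
    rw [← SimpleGraph.Walk.IsPath.getVert_injOn_iff, hp]
    intro i hi j hj e
    exact inj hi hj (by rwa [hv i hi, hv j hj] at e)
  obtain ⟨i, hi, hb⟩ := hd p hpath
  rw [hp] at hi
  rw [hv i (by omega), hv (i + 1) (by omega), hv (i + 2) hi] at hb
  rcases hb with ⟨-, hA⟩ | ⟨hc, hS⟩
  · obtain ⟨t, ht, ha⟩ := hg.mem (i + 1) (by omega)
    exact hA t ht ha
  · exact hc (hg.coll i hi hS)

/-- On an unblocked walk every vertex is an ancestor of `S ∪ {x, y}`: following arrows away from it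
ends at a collider, which is such an ancestor, or at an end point. The vertices in `S` are
colliders, and the moral graph joins their two neighbours, so they can be skipped. -/
theorem conn_of_not_dSep {x y : V} {S : Finset V} (hx : x ∉ S) (hy : y ∉ S)
    (h : ¬ G.DSep x y S) : G.Conn x y S := by
  simp only [DSep, not_forall] at h
  obtain ⟨p, -, hb⟩ := h
  simp only [Blocked, not_exists, not_and, not_or, not_forall, not_not] at hb
  have h0 : p.getVert 0 = x := p.getVert_zero
  have hl : p.getVert p.length = y := p.getVert_length
  have hadj : ∀ i < p.length, G.edge (p.getVert i) (p.getVert (i + 1)) ∨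
    G.edge (p.getVert (i + 1)) (p.getVert i) := fun i hi => p.adj_getVert_succ hi
  generalize p.length = n at hb hl hadj
  generalize p.getVert = f at hb h0 hl hadj
  subst h0 hl
  have hcoll : ∀ i, i + 2 ≤ n → G.IsCollider (f i) (f (i + 1)) (f (i + 2)) →
      G.Anc (f 0) (f n) S (f (i + 1)) := by
    intro i hi hc
    obtain ⟨t, ht, ha⟩ := (hb i hi).1 hc
    exact ⟨t, ht, ha⟩
  have hfwd : ∀ k i, i + k + 1 = n → G.edge (f i) (f (i + 1)) → G.Anc (f 0) (f n) S (f i) := by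
    intro k
    induction k with
    | zero => rintro i rfl e; exact (anc_right _ _ _).of_edge e
    | succ k ih =>
      intro i hi e
      refine Anc.of_edge ?_ e
      by_cases hc : G.edge (f (i + 2)) (f (i + 1))
      · exact hcoll i (by omega) ⟨e, hc⟩
      · exact ih (i + 1) (by omega) ((hadj (i + 1) (by omega)).resolve_right hc)
  have hbwd : ∀ i, i + 1 ≤ n → G.edge (f (i + 1)) (f i) → G.Anc (f 0) (f n) S (f (i + 1)) := by
    intro i
    induction i with
    | zero => intro _ e; exact (anc_left _ _ _).of_edge e
    | succ i ih =>
      intro hi e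
      refine Anc.of_edge ?_ e
      by_cases hc : G.edge (f i) (f (i + 1))
      · exact hcoll i (by omega) ⟨hc, e⟩
      · exact ih (by omega) ((hadj i (by omega)).resolve_left hc)
  have hA : ∀ i ≤ n, G.Anc (f 0) (f n) S (f i) := by
    intro i hi
    rcases hi.eq_or_lt with rfl | hi
    · exact anc_right _ _ _
    cases i with
    | zero => exact anc_left _ _ _
    | succ i =>
      rcases hadj (i + 1) hi with e | e
      · exact hfwd (n - (i + 2)) (i + 1) (by omega) e
      rcases hadj i (by omega) with e' | e'
      · exact hcoll i (by omega) ⟨e', e⟩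
      · exact hbwd i (by omega) e'
  suffices H : ∀ i ≤ n, f i ∉ S → ReflTransGen (fun u v => G.Anc (f 0) (f n) S v ∧ v ∉ S ∧
      G.Moral (G.Anc (f 0) (f n) S) u v) (f 0) (f i) from H n le_rfl hy
  intro i
  induction i using Nat.strong_induction_on with
  | _ i ih =>
    intro hi hS
    match i, ih, hi, hS with
    | 0, _, _, _ => exact .refl
    | i + 1, ih, hi, hS =>
      by_cases hiS : f i ∈ S
      · match i, ih, hi, hS, hiS with
        | 0, _, _, _, hiS => exact absurd hiS hx
        | i + 1, ih, hi, hS, hiS =>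
          have hc : G.IsCollider (f i) (f (i + 1)) (f (i + 2)) := by
            by_contra hc; exact (hb i (by omega)).2 hc hiS
          -- Two consecutive vertices of the walk cannot both be colliders, so skipping one vertex
          -- is enough to get out of `S`.
          have hi0 : f i ∉ S := by
            intro h
            match i, hc, hi, h with
            | 0, _, _, h => exact hx h
            | i + 1, hc, hi, h =>
              have : G.IsCollider (f i) (f (i + 1)) (f (i + 2)) := by
                by_contra hc'; exact (hb i (by omega)).2 hc' h
              exact not_edge_of_edge this.2 hc.1
          exact (ih i (by omega) (by omega) hi0).tail
            ⟨hA _ hi, hS, .inr (.inr ⟨f (i + 1), hA _ (by omega), hc.1, hc.2⟩)⟩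
      · refine (ih i (by omega) (by omega) hiS).tail ⟨hA _ hi, hS, ?_⟩
        rcases hadj i (by omega) with e | e
        · exact .inl e
        · exact .inr (.inl e)

/-- d-separation is separation in the moral graph of the ancestral set. -/
theorem conn_iff_not_dSep {x y : V} {S : Finset V} (hx : x ∉ S) (hy : y ∉ S) :
    G.Conn x y S ↔ ¬ G.DSep x y S :=
  ⟨Conn.not_dSep hx, conn_of_not_dSep hx hy⟩

/-! ### Markov boundaries, separating sets and removable vertices -/

variable (G)

/-- `x` and `y` are adjacent. -/
def Adj (x y : V) : Prop := G.edge x y ∨ G.edge y x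

/-- `y` is in the Markov boundary of `x`: it is a neighbour or a co-parent. -/
def InMb (x y : V) : Prop := x ≠ y ∧ (G.Adj x y ∨ ∃ c, G.edge x c ∧ G.edge y c)

/-- The subgraph induced on `R`; the other vertices become isolated. -/
def restrict (R : Finset V) : DAG V where
  edge u v := G.edge u v ∧ u ∈ R ∧ v ∈ R
  acyclic v h := G.acyclic v (TransGen.mono (fun _ _ h => And.left h) v v h)

/-- Every neighbour of `X` is adjacent to every child of `X`, and if `Y → Z` are children of `X`,
then the parents of `Y` are parents of `Z`. -/
structure Removable (X : V) : Prop where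
  adj : ∀ Z Y, G.edge X Z → G.Adj X Y → Y ≠ Z → G.Adj Y Z
  parents : ∀ Y Z, G.edge X Y → G.edge X Z → G.edge Y Z → ∀ T, G.edge T Y → G.edge T Z

variable {G}

theorem Adj.symm {x y : V} (h : G.Adj x y) : G.Adj y x := Or.symm h

theorem Adj.ne {x y : V} (h : G.Adj x y) : x ≠ y :=
  h.elim ne_of_edge fun e => (ne_of_edge e).symm

theorem InMb.symm {x y : V} (h : G.InMb x y) : G.InMb y x :=
  ⟨h.1.symm, h.2.imp Adj.symm fun ⟨c, h1, h2⟩ => ⟨c, h2, h1⟩⟩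

theorem conn_of_adj {x y : V} {S : Finset V} (hy : y ∉ S) (h : G.Adj x y) : G.Conn x y S :=
  .single ⟨anc_right _ _ _, hy, h.elim .inl fun h => .inr (.inl h)⟩

theorem conn_of_collider {x y c : V} {S : Finset V} (hy : y ∉ S) (hc : c ∈ S)
    (h1 : G.edge x c) (h2 : G.edge y c) : G.Conn x y S :=
  .single ⟨anc_right _ _ _, hy, .inr (.inr ⟨c, anc_of_mem _ _ hc, h1, h2⟩)⟩

/-- The common form of all separation proofs below: a connecting walk cannot leave `x` if all moral
neighbours of `x` in the ancestral set are in `S`. -/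
theorem not_conn_of_forall {x y : V} {S : Finset V} (hxy : x ≠ y)
    (h : ∀ v, G.Anc x y S v → v ∉ S → v ≠ x → ¬ G.Moral (G.Anc x y S) x v) :
    ¬ G.Conn x y S := by
  intro hc
  suffices H : ∀ w, ReflTransGen
      (fun u v => G.Anc x y S v ∧ v ∉ S ∧ G.Moral (G.Anc x y S) u v) x w → w = x from
    hxy (H y hc).symm
  intro w hw
  induction hw with
  | refl => rfl
  | tail _ hs ih =>
    subst ih
    by_contra hne
    exact h _ hs.1 hs.2.1 hne hs.2.2

theorem Moral.inMb {A : V → Prop} {x y : V} (hxy : x ≠ y) (h : G.Moral A x y) : G.InMb x y := by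
  rcases h with h | h | ⟨c, -, h1, h2⟩
  · exact ⟨hxy, .inl (.inl h)⟩
  · exact ⟨hxy, .inl (.inr h)⟩
  · exact ⟨hxy, .inr ⟨c, h1, h2⟩⟩

theorem not_conn_of_inMb_subset {x y : V} {S : Finset V} (hxy : x ≠ y)
    (h : ∀ v, G.InMb x v → v ∈ S) : ¬ G.Conn x y S :=
  not_conn_of_forall hxy fun _ _ hv hne hm => hv (h _ (hm.inMb hne.symm))

theorem inMb_of_conn {x y : V} {S : Finset V} (hxy : x ≠ y) (h : G.Conn x y S)
    (hS : ∀ v, G.InMb x v → v ≠ y → v ∈ S) : G.InMb x y := by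
  by_contra hy
  exact not_conn_of_inMb_subset hxy (fun v hv => hS v hv fun e => hy (e ▸ hv)) h

/-- The local Markov property. If `y` is not a descendant of `z`, no child of `z` is in the
ancestral set, so the only moral neighbours of `z` there are its parents. -/
theorem not_conn_parents {z y : V} {S : Finset V} (hzy : z ≠ y) (hS : ∀ u, u ∈ S ↔ G.edge u z)
    (hanc : ¬ G.IsAncestor z y) : ¬ G.Conn z y S := by
  refine not_conn_of_forall hzy fun v hv hvS _ hm => ?_
  have key : ∀ c, G.edge z c → ¬ G.Anc z y S c := by
    rintro c hc ⟨t, ht | rfl | rfl, hct⟩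
    · exact not_isAncestor_of_edge hc (hct.tail ((hS t).1 ht))
    · exact not_isAncestor_of_edge hc hct
    · exact hanc (.head hc hct)
  rcases hm with h | h | ⟨c, hc, h, -⟩
  · exact key v h hv
  · exact hvS ((hS v).2 h)
  · exact key c h hc

/-- Conditioning only on ancestors of `x` or `y` does not enlarge the ancestral set. It then
contains no common child of `x` and `y`, and the moral neighbours of `x` in it are all in `S`. -/
theorem not_conn_of_inMb_inter {x y : V} {S : Finset V} (hxy : x ≠ y) (hadj : ¬ G.Adj x y)
    (hS : ∀ v, v ∈ S ↔ G.InMb x v ∧ v ≠ y ∧ (G.IsAncestor v x ∨ G.IsAncestor v y)) :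
    ¬ G.Conn x y S := by
  have anc : ∀ v, G.Anc x y S v → G.IsAncestor v x ∨ G.IsAncestor v y := by
    rintro v ⟨t, ht | rfl | rfl, hvt⟩
    · exact ((hS t).1 ht).2.2.imp hvt.trans hvt.trans
    · exact .inl hvt
    · exact .inr hvt
  refine not_conn_of_forall hxy fun v hv hvS hne hm => ?_
  by_cases hvy : v = y
  · subst hvy
    rcases hm with h | h | ⟨c, hc, h1, h2⟩
    · exact hadj (.inl h)
    · exact hadj (.inr h)
    · exact (anc c hc).elim (not_isAncestor_of_edge h1) (not_isAncestor_of_edge h2)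
  · exact hvS ((hS v).2 ⟨hm.inMb hne.symm, hvy, anc v hv⟩)

theorem isAncestor_of_le {G' : DAG V} (hle : ∀ u v, G'.edge u v → G.edge u v) {u v : V}
    (h : G'.IsAncestor u v) : G.IsAncestor u v := ReflTransGen.mono hle _ _ h

theorem Conn.of_le {G' : DAG V} (hle : ∀ u v, G'.edge u v → G.edge u v) {x y : V} {S : Finset V}
    (h : G'.Conn x y S) : G.Conn x y S := by
  have anc : ∀ v, G'.Anc x y S v → G.Anc x y S v := fun v ⟨t, ht, h⟩ =>
    ⟨t, ht, isAncestor_of_le hle h⟩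
  refine ReflTransGen.mono (fun u v (h : G'.Anc x y S v ∧ v ∉ S ∧ G'.Moral (G'.Anc x y S) u v) =>
    ⟨anc v h.1, h.2.1, ?_⟩) _ _ h
  exact h.2.2.imp (hle _ _) (Or.imp (hle _ _) fun ⟨c, hc, h, h'⟩ => ⟨c, anc c hc, hle _ _ h, hle _ _ h'⟩)

theorem Removable.edge_of_edge_edge {X a b : V} (h : G.Removable X) (ha : G.edge a X)
    (hb : G.edge X b) : G.edge a b := by
  have hab : a ≠ b := by rintro rfl; exact not_edge_of_edge ha hb
  exact (h.adj b a hb (.inr ha) hab).resolve_right fun e =>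
    not_isAncestor_of_edge hb (.head e (.single ha))

/-- A directed path `a → X → b` is bypassed by the edge `a → b`, which `Removable.edge_of_edge_edge`
supplies. -/
theorem Removable.isAncestor {X : V} (h : G.Removable X) {G' : DAG V}
    (hG' : ∀ u v, G'.edge u v ↔ G.edge u v ∧ u ≠ X ∧ v ≠ X) {u t : V} (hu : u ≠ X) (ht : t ≠ X)
    (hut : G.IsAncestor u t) : G'.IsAncestor u t := by
  suffices H : (u ≠ X → G'.IsAncestor u t) ∧ (u = X → ∀ a, G.edge a X → G'.IsAncestor a t) from
    H.1 hu
  clear hu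
  induction hut using ReflTransGen.head_induction_on with
  | refl => exact ⟨fun _ => .refl, fun e => absurd e ht⟩
  | @head u w e _ ih =>
    refine ⟨fun hu => ?_, ?_⟩
    · by_cases hw : w = X
      · exact ih.2 hw u (hw ▸ e)
      · exact .head ((hG' u w).2 ⟨e, hu, hw⟩) (ih.1 hw)
    · rintro rfl a ha
      have hw : w ≠ u := (ne_of_edge e).symm
      exact .head ((hG' a w).2 ⟨h.edge_of_edge_edge ha e, ne_of_edge ha, hw⟩) (ih.1 hw)

/-- A nonempty set of vertices has an element without children in the set. -/
theorem exists_sink [Finite V] (p : V → Prop) (hp : ∃ v, p v) :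
    ∃ v, p v ∧ ∀ w, p w → ¬ G.edge v w := by
  have : Std.Irrefl (fun a b => TransGen G.edge b a) := ⟨fun a h => G.acyclic a h⟩
  have : IsTrans V (fun a b => TransGen G.edge b a) := ⟨fun a b c h1 h2 => h2.trans h1⟩
  have wf : WellFounded (fun a b => TransGen G.edge b a) := Finite.wellFounded_of_trans_of_irrefl _
  obtain ⟨v, hv, hmin⟩ := wf.has_min {v | p v} hp
  exact ⟨v, hv, fun w hw e => hmin w hw (.single e)⟩

/-- Deleting a vertex as in `Removable` does not change the d-separations among the others. -/
theorem Removable.conn_iff [Finite V] {X : V} (h : G.Removable X) {G' : DAG V}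
    (hG' : ∀ u v, G'.edge u v ↔ G.edge u v ∧ u ≠ X ∧ v ≠ X) {x y : V} {S : Finset V}
    (hx : x ≠ X) (hy : y ≠ X) (hS : X ∉ S) : G.Conn x y S ↔ G'.Conn x y S := by
  refine ⟨fun hc => ?_, Conn.of_le fun u v e => ((hG' u v).1 e).1⟩
  have anc : ∀ v, v ≠ X → G.Anc x y S v → G'.Anc x y S v := by
    rintro v hv ⟨t, ht, hvt⟩
    refine ⟨t, ht, h.isAncestor hG' hv ?_ hvt⟩
    rcases ht with ht | rfl | rfl
    · exact fun e => hS (e ▸ ht)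
    · exact hx
    · exact hy
  have last : G.Anc x y S X → ∃ Z, G.Anc x y S Z ∧ Z ≠ X ∧
      ∀ u, u ≠ X → G.Anc x y S u → G.Moral (G.Anc x y S) u X → u = Z ∨ G.edge u Z := by
    rintro ⟨t, ht, hXt⟩
    have htX : X ≠ t := by
      rintro rfl
      rcases ht with ht | rfl | rfl
      · exact hS ht
      · exact hx rfl
      · exact hy rfl
    obtain ⟨d, hd, hdt⟩ := (ReflTransGen.cases_head hXt).resolve_left htX
    obtain ⟨Z, ⟨hZA, hXZ⟩, hmax⟩ := exists_sink (G := G) (fun d => G.Anc x y S d ∧ G.edge X d)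
      ⟨d, ⟨t, ht, hdt⟩, hd⟩
    have child : ∀ u, G.Anc x y S u → G.edge X u → u = Z ∨ G.edge u Z := by
      intro u hu hXu
      by_cases huZ : u = Z
      · exact .inl huZ
      · exact .inr ((h.adj Z u hXZ (.inl hXu) huZ).resolve_right fun e => hmax u ⟨hu, hXu⟩ e)
    refine ⟨Z, hZA, (ne_of_edge hXZ).symm, fun u _ hu hm => ?_⟩
    rcases hm with e | e | ⟨c, hc, e1, e2⟩
    · exact .inr (h.edge_of_edge_edge e hXZ)
    · exact child u hu e
    · rcases child c hc e2 with rfl | e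
      · exact .inr e1
      · exact .inr (h.parents c Z e2 hXZ e u e1)
  let step := fun u v => G'.Anc x y S v ∧ v ∉ S ∧ G'.Moral (G'.Anc x y S) u v
  -- A visit of `X` has no counterpart in `G'`; the induction then remembers the vertex from which
  -- `X` was entered.
  suffices H : ∀ v, ReflTransGen
      (fun u v => G.Anc x y S v ∧ v ∉ S ∧ G.Moral (G.Anc x y S) u v) x v →
      G.Anc x y S v ∧ (v ≠ X → ReflTransGen step x v) ∧
      (v = X → ∃ u, u ≠ X ∧ ReflTransGen step x u ∧ G.Anc x y S u ∧
        G.Moral (G.Anc x y S) u X) from (H y hc).2.1 hy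
  intro v hv
  induction hv with
  | refl => exact ⟨anc_left _ _ _, fun _ => .refl, fun e => absurd e hx⟩
  | @tail u v _ hs ih =>
    obtain ⟨huA, hu1, hu2⟩ := ih
    obtain ⟨hvA, hvS, hm⟩ := hs
    refine ⟨hvA, fun hvX => ?_, ?_⟩
    · -- two neighbours of a common last child are adjacent
      have via : ∀ Z u, Z ≠ X → G.Anc x y S Z → u ≠ X → (u = Z ∨ G.edge u Z) →
          (v = Z ∨ G.edge v Z) → ReflTransGen step x u → ReflTransGen step x v := by
        intro Z u hZ hZA hu h1 h2 hr
        rcases h1 with rfl | h1 <;> rcases h2 with rfl | h2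
        · exact hr
        · exact hr.tail ⟨anc v hvX hvA, hvS, .inr (.inl ((hG' _ _).2 ⟨h2, hvX, hu⟩))⟩
        · exact hr.tail ⟨anc v hvX hvA, hvS, .inl ((hG' _ _).2 ⟨h1, hu, hvX⟩)⟩
        · exact hr.tail ⟨anc v hvX hvA, hvS, .inr (.inr ⟨Z, anc Z hZ hZA,
            (hG' _ _).2 ⟨h1, hu, hZ⟩, (hG' _ _).2 ⟨h2, hvX, hZ⟩⟩)⟩
      by_cases huX : u = X
      · obtain ⟨w, hwX, hw, hwA, hwm⟩ := hu2 huX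
        subst huX
        obtain ⟨Z, hZA, hZ, hl⟩ := last huA
        refine via Z w hZ hZA hwX (hl w hwX hwA hwm) (hl v hvX hvA ?_) hw
        rcases hm with e | e | ⟨c, hc, e1, e2⟩
        · exact .inr (.inl e)
        · exact .inl e
        · exact .inr (.inr ⟨c, hc, e2, e1⟩)
      · have hr := hu1 huX
        rcases hm with e | e | ⟨c, hc, e1, e2⟩
        · exact hr.tail ⟨anc v hvX hvA, hvS, .inl ((hG' _ _).2 ⟨e, huX, hvX⟩)⟩
        · exact hr.tail ⟨anc v hvX hvA, hvS, .inr (.inl ((hG' _ _).2 ⟨e, hvX, huX⟩))⟩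
        -- Two parents married only by `X` are both parents of `Z`.
        · by_cases hcX : c = X
          · subst hcX
            obtain ⟨Z, hZA, hZ, hl⟩ := last hc
            exact via Z u hZ hZA huX (hl u huX huA (.inl e1)) (hl v hvX hvA (.inl e2)) hr
          · exact hr.tail ⟨anc v hvX hvA, hvS, .inr (.inr ⟨c, anc c hcX hc,
              (hG' _ _).2 ⟨e1, huX, hcX⟩, (hG' _ _).2 ⟨e2, hvX, hcX⟩⟩)⟩
    · rintro rfl
      by_cases huX : u = v
      · exact hu2 huX
      · exact ⟨u, huX, hu1 huX, huA, hm⟩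

/-- The tests of the two conditions imply removability. -/
theorem removable_of_conn [DecidableEq V] [Fintype V] {X : V}
    (h1 : ∀ Y Z S, G.Adj X Y → G.Adj X Z → Y ≠ Z → (∀ v ∈ S, G.InMb X v) → Y ∉ S → Z ∉ S →
      G.Conn Y Z (insert X S))
    (h2 : ∀ Y Z S, G.InMb X Y → ¬ G.Adj X Y → G.Adj X Z → (∀ v ∈ S, G.InMb X v) → Y ∉ S → Z ∉ S →
      (∃ v ∈ S, v ≠ Z ∧ G.edge X v ∧ G.edge Y v) → G.Conn Z Y (insert X S)) :
    G.Removable X := by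
  classical
  let pa : V → Finset V := fun Z => Finset.univ.filter fun u => G.edge u Z
  have hpa : ∀ Z u, u ∈ pa Z ↔ G.edge u Z := by simp [pa]
  have ins : ∀ Z, G.edge X Z → insert X ((pa Z).erase X) = pa Z := fun Z e =>
    Finset.insert_erase ((hpa Z X).2 e)
  -- The other parents of a child `Z` share that child with `X`, so `S = pa Z \ {X}` is one of the
  -- tested sets, and `insert X S` is exactly `pa Z`.
  have sub : ∀ Z, G.edge X Z → ∀ v ∈ (pa Z).erase X, G.InMb X v := by
    intro Z e v hv
    rw [Finset.mem_erase, hpa] at hv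
    exact ⟨hv.1.symm, .inr ⟨Z, e, hv.2⟩⟩
  have hself : ∀ Z, Z ∉ (pa Z).erase X := fun Z h =>
    not_edge_self Z ((hpa Z Z).1 (Finset.mem_of_mem_erase h))
  have hadj : ∀ Z Y, G.edge X Z → G.Adj X Y → Y ≠ Z → G.Adj Y Z := by
    intro Z Y hXZ hXY hYZ
    by_contra hn
    have aux : ∀ Z Y, G.edge X Z → G.Adj X Y → Y ≠ Z → ¬ G.edge Y Z → G.IsAncestor Z Y := by
      intro Z Y hXZ hXY hYZ hn
      by_contra hanc
      have hY : Y ∉ (pa Z).erase X := fun h => hn ((hpa Z Y).1 (Finset.mem_of_mem_erase h))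
      have := h1 Z Y _ (.inl hXZ) hXY hYZ.symm (sub Z hXZ) (hself Z) hY
      rw [ins Z hXZ] at this
      exact not_conn_parents hYZ.symm (hpa Z) hanc this
    -- Non-adjacency makes `Z` an ancestor of `Y`. Then `Y` must be a child of `X`, so the argument
    -- also applies with the roles exchanged and produces a cycle.
    have hanc := aux Z Y hXZ hXY hYZ (fun e => hn (.inl e))
    have hXY' : G.edge X Y := hXY.resolve_right fun e =>
      not_isAncestor_of_edge hXZ (hanc.tail e)
    have hanc' := aux Y Z hXY' (.inl hXZ) hYZ.symm (fun e => hn (.inr e))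
    obtain ⟨w, hw, hwY⟩ := (ReflTransGen.cases_head hanc).resolve_left hYZ.symm
    exact not_isAncestor_of_edge hw (hwY.trans hanc')
  refine ⟨hadj, fun Y Z hXY hXZ hYZ T hTY => ?_⟩
  by_contra hTZ
  have hTX : T ≠ X := by rintro rfl; exact hTZ hXZ
  have hnot : ¬ G.edge Z T := fun e => not_isAncestor_of_edge hTY (.head hYZ (.single e))
  have hZT : Z ≠ T := by rintro rfl; exact not_edge_of_edge hYZ hTY
  have hTadj : ¬ G.Adj X T := fun h =>
    (hadj Z T hXZ h hZT.symm).elim hTZ hnot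
  -- The set meets the requirement of the second condition through `Y`, a common child of `X` and
  -- `T` that is a parent of `Z`.
  have := h2 T Z ((pa Z).erase X) ⟨hTX.symm, .inr ⟨Y, hXY, hTY⟩⟩ hTadj (.inl hXZ) (sub Z hXZ)
    (fun h => hTZ ((hpa Z T).1 (Finset.mem_of_mem_erase h))) (hself Z)
    ⟨Y, Finset.mem_erase.2 ⟨(ne_of_edge hXY).symm, (hpa Z Y).2 hYZ⟩, ne_of_edge hYZ, hXY, hTY⟩
  rw [ins Z hXZ] at this
  exact not_conn_parents hZT (hpa Z)
    (fun h => not_isAncestor_of_edge hTY (.head hYZ h)) this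

end DAG

/-! ### The oracle on the remaining variables -/

theorem mk_mem_unorderedPairs {V : Type*} [DecidableEq V] {s : Finset V} {x y : V} :
    s(x, y) ∈ unorderedPairs s ↔ x ∈ s ∧ y ∈ s ∧ x ≠ y := by
  simp [unorderedPairs, and_assoc]

theorem card_unorderedPairs {V : Type*} [DecidableEq V] (s : Finset V) :
    (unorderedPairs s).card = s.card.choose 2 := by
  have h := Finset.card_sym2 s
  have hd : (s.sym2.filter fun e => e.IsDiag).card = s.card := by
    rw [show (s.sym2.filter fun e => e.IsDiag) = s.image fun x => s(x, x) from ?_,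
      Finset.card_image_of_injective _ fun x y h => by simpa using h]
    ext e
    induction e with
    | _ x y =>
      simp only [Finset.mem_filter, Finset.mk_mem_sym2_iff, Sym2.mk_isDiag_iff, Finset.mem_image,
        Sym2.eq_iff]
      constructor
      · rintro ⟨⟨h, -⟩, rfl⟩; exact ⟨x, h, by simp⟩
      · rintro ⟨a, ha, ⟨rfl, rfl⟩ | ⟨rfl, rfl⟩⟩ <;> exact ⟨⟨ha, ha⟩, rfl⟩
  have := Finset.card_filter_add_card_filter_not (s := s.sym2) (fun e => e.IsDiag)
  rw [hd, h, Nat.choose_succ_succ' s.card 1, Nat.choose_one_right, one_add_one_eq_two] at this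
  rw [unorderedPairs]
  omega

namespace DAG

variable {V : Type*} [Fintype V] (G : DAG V)

open Classical in
/-- The Markov boundary of `v` in the subgraph induced on `R`. -/
noncomputable def mbSet (R : Finset V) (v : V) : Finset V :=
  Finset.univ.filter fun w => (G.restrict R).InMb v w

/-- The tests of variables in `R` answer connectivity in the subgraph induced on `R`. -/
def Oracle (ci : CITest V → Bool) (R : Finset V) : Prop :=
  ∀ x ∈ R, ∀ y ∈ R, ∀ S ⊆ R, x ≠ y → x ∉ S → y ∉ S →
    (ci (s(x, y), S) = false ↔ (G.restrict R).Conn x y S)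

/-- The first condition for `X` with Markov boundary `M`: all its tests yield dependence. -/
def Cond1 [DecidableEq V] (ci : CITest V → Bool) (X : V) (M : Finset V) : Prop :=
  ∀ Y ∈ M, ∀ Z ∈ M, G.Adj X Y → G.Adj X Z → Y ≠ Z → ∀ S ⊆ M, Y ∉ S → Z ∉ S →
    ci (s(Y, Z), insert X S) = false

/-- The second condition for `X` with Markov boundary `M`: all its tests yield dependence. -/
def Cond2 [DecidableEq V] (ci : CITest V → Bool) (X : V) (M : Finset V) : Prop :=
  ∀ Y ∈ M, ∀ Z ∈ M, ¬ G.Adj X Y → G.Adj X Z → ∀ S ⊆ M, Y ∉ S → Z ∉ S →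
    (∃ v ∈ S, v ≠ Z ∧ G.edge X v ∧ G.edge Y v) → ci (s(Y, Z), insert X S) = false

/-- `X` has no children in `R`. -/
def IsSink (R : Finset V) (X : V) : Prop := ∀ w ∈ R, ¬ G.edge X w

variable {G} {ci : CITest V → Bool} {R R' : Finset V}

theorem restrict_adj {x y : V} : (G.restrict R).Adj x y ↔ G.Adj x y ∧ x ∈ R ∧ y ∈ R := by
  simp only [Adj, restrict]; tauto

theorem mem_mbSet {v w : V} : w ∈ G.mbSet R v ↔ (G.restrict R).InMb v w := by simp [mbSet]

theorem mem_mbSet_iff {v w : V} : w ∈ G.mbSet R v ↔ v ≠ w ∧ v ∈ R ∧ w ∈ R ∧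
    (G.Adj v w ∨ ∃ c ∈ R, G.edge v c ∧ G.edge w c) := by
  simp only [mem_mbSet, InMb, restrict_adj]
  simp only [restrict]
  constructor
  · rintro ⟨h, ⟨h1, h2, h3⟩ | ⟨c, ⟨h1, h2, h3⟩, h4, h5, -⟩⟩
    · exact ⟨h, h2, h3, .inl h1⟩
    · exact ⟨h, h2, h5, .inr ⟨c, h3, h1, h4⟩⟩
  · rintro ⟨h, h1, h2, h3 | ⟨c, h3, h4, h5⟩⟩
    · exact ⟨h, .inl ⟨h3, h1, h2⟩⟩
    · exact ⟨h, .inr ⟨c, ⟨h4, h1, h3⟩, h5, h2, h3⟩⟩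

theorem mbSet_subset (v : V) : G.mbSet R v ⊆ R := fun _ h => (mem_mbSet_iff.1 h).2.2.1

theorem self_notMem_mbSet (v : V) : v ∉ G.mbSet R v := fun h => (mem_mbSet_iff.1 h).1 rfl

theorem mem_mbSet_comm {v w : V} : w ∈ G.mbSet R v ↔ v ∈ G.mbSet R w := by
  simp only [mem_mbSet]; exact ⟨InMb.symm, InMb.symm⟩

theorem mbSet_mono (h : R' ⊆ R) (v : V) : G.mbSet R' v ⊆ G.mbSet R v := by
  intro w hw
  rw [mem_mbSet_iff] at hw ⊢
  exact ⟨hw.1, h hw.2.1, h hw.2.2.1, hw.2.2.2.imp_right fun ⟨c, hc, h'⟩ => ⟨c, h hc, h'⟩⟩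

theorem mem_mbSet_of_adj {v w : V} (hv : v ∈ R) (hw : w ∈ R) (h : G.Adj v w) : w ∈ G.mbSet R v :=
  mem_mbSet_iff.2 ⟨h.ne, hv, hw, .inl h⟩

theorem restrict_univ : G.restrict Finset.univ = G := by
  cases G; simp [restrict]

variable [DecidableEq V]

theorem Oracle.erase (h : G.Oracle ci R) {X : V} (hX : (G.restrict R).Removable X) :
    G.Oracle ci (R.erase X) := by
  intro x hx y hy S hS hxy hxS hyS
  rw [Finset.mem_erase] at hx hy
  rw [h x hx.2 y hy.2 S (hS.trans (R.erase_subset X)) hxy hxS hyS]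
  refine hX.conn_iff (fun u v => ?_) hx.1 hy.1 fun hXS => by simpa using hS hXS
  simp only [restrict, Finset.mem_erase]
  tauto

theorem Oracle.of_adj (h : G.Oracle ci R) {x y : V} {S : Finset V} (hx : x ∈ R) (hy : y ∈ R)
    (hS : S ⊆ R) (hxS : x ∉ S) (hyS : y ∉ S) (hxy : G.Adj x y) : ci (s(x, y), S) = false :=
  (h x hx y hy S hS hxy.ne hxS hyS).2 (conn_of_adj hyS (restrict_adj.2 ⟨hxy, hx, hy⟩))

theorem Oracle.of_collider (h : G.Oracle ci R) {x y c : V} {S : Finset V} (hx : x ∈ R)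
    (hy : y ∈ R) (hxy : x ≠ y) (hS : S ⊆ R) (hxS : x ∉ S) (hyS : y ∉ S) (hc : c ∈ S)
    (h1 : G.edge x c) (h2 : G.edge y c) : ci (s(x, y), S) = false :=
  (h x hx y hy S hS hxy hxS hyS).2
    (conn_of_collider hyS hc ⟨h1, hx, hS hc⟩ ⟨h2, hy, hS hc⟩)

/-- Conditioning on the rest of the Markov boundary decides membership in it. -/
theorem Oracle.mb_test (h : G.Oracle ci R) {x y : V} {S : Finset V} (hx : x ∈ R) (hy : y ∈ R)
    (hxy : x ≠ y) (hS : S ⊆ R) (hxS : x ∉ S) (hyS : y ∉ S)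
    (hmb : ∀ v ∈ G.mbSet R x, v ≠ y → v ∈ S) :
    ci (s(x, y), S) = false ↔ y ∈ G.mbSet R x := by
  constructor
  · intro hc
    rw [h x hx y hy S hS hxy hxS hyS] at hc
    exact mem_mbSet.2 (inMb_of_conn hxy hc fun v hv => hmb v (mem_mbSet.2 hv))
  · intro hm
    rcases (mem_mbSet_iff.1 hm).2.2.2 with hadj | ⟨c, hc, h1, h2⟩
    · exact h.of_adj hx hy hS hxS hyS hadj
    · exact h.of_collider hx hy hxy hS hxS hyS
        (hmb c (mem_mbSet_of_adj hx hc (.inl h1)) (ne_of_edge h2).symm) h1 h2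

/-- A co-parent is separated by a proper subset of the rest of the Markov boundary. -/
theorem Oracle.exists_sepset (h : G.Oracle ci R) {x y : V} (hy : y ∈ G.mbSet R x)
    (hxy : ¬ G.Adj x y) : ∃ S ∈ ((G.mbSet R x).erase y).ssubsets, ci (s(x, y), S) = true := by
  classical
  obtain ⟨hne, hxR, hyR, hc⟩ := mem_mbSet_iff.1 hy
  obtain ⟨c, hc, h1, h2⟩ := hc.resolve_left hxy
  -- The subset is proper because it omits the common child `c`, which is an ancestor of neither `x`
  -- nor `y`.
  let S := (G.mbSet R x).filter fun v => v ≠ y ∧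
    ((G.restrict R).IsAncestor v x ∨ (G.restrict R).IsAncestor v y)
  have hS : ∀ v, v ∈ S ↔ (G.restrict R).InMb x v ∧ v ≠ y ∧
      ((G.restrict R).IsAncestor v x ∨ (G.restrict R).IsAncestor v y) := by
    simp [S, mem_mbSet]
  refine ⟨S, ?_, ?_⟩
  · rw [Finset.mem_ssubsets]
    refine ⟨fun v hv => ?_, fun hsub => ?_⟩
    · rw [Finset.mem_erase, mem_mbSet]; exact ⟨((hS v).1 hv).2.1, ((hS v).1 hv).1⟩
    · have : c ∈ S := hsub (Finset.mem_erase.2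
        ⟨(ne_of_edge h2).symm, mem_mbSet_of_adj hxR hc (.inl h1)⟩)
      exact ((hS c).1 this).2.2.elim
        (not_isAncestor_of_edge (G := G.restrict R) ⟨h1, hxR, hc⟩)
        (not_isAncestor_of_edge (G := G.restrict R) ⟨h2, hyR, hc⟩)
  · have hno := not_conn_of_inMb_inter (G := G.restrict R) hne
      (fun ha => hxy (restrict_adj.1 ha).1) hS
    rw [← h x hxR y hyR S (fun v hv => mbSet_subset x (mem_mbSet.2 ((hS v).1 hv).1)) hne
      (fun hx => ((hS x).1 hx).1.1 rfl) (fun hy => ((hS y).1 hy).2.1 rfl)] at hno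
    simpa using hno

theorem Oracle.removable (h : G.Oracle ci R) {X : V} (hX : X ∈ R)
    (h1 : G.Cond1 ci X (G.mbSet R X)) (h2 : G.Cond2 ci X (G.mbSet R X)) :
    (G.restrict R).Removable X := by
  have ins : ∀ S : Finset V, (∀ v ∈ S, (G.restrict R).InMb X v) → insert X S ⊆ R := fun S hS =>
    Finset.insert_subset hX fun v hv => mbSet_subset X (mem_mbSet.2 (hS v hv))
  refine removable_of_conn ?_ ?_
  · intro Y Z S hY hZ hYZ hS hYS hZS
    rw [restrict_adj] at hY hZ
    rw [← h Y hY.2.2 Z hZ.2.2 _ (ins S hS) hYZ (by simp [hYS, hY.1.ne.symm])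
      (by simp [hZS, hZ.1.ne.symm])]
    exact h1 Y (mem_mbSet_of_adj hX hY.2.2 hY.1) Z (mem_mbSet_of_adj hX hZ.2.2 hZ.1) hY.1 hZ.1 hYZ S
      (fun v hv => mem_mbSet.2 (hS v hv)) hYS hZS
  · rintro Y Z S hY hXY hZ hS hYS hZS ⟨v, hv, hvZ, ev, ev'⟩
    rw [← mem_mbSet] at hY
    have hYR := mbSet_subset X hY
    have hXY' : ¬ G.Adj X Y := fun ha => hXY (restrict_adj.2 ⟨ha, hX, hYR⟩)
    rw [restrict_adj] at hZ
    have hYZ : Y ≠ Z := by rintro rfl; exact hXY' hZ.1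
    rw [← h Z hZ.2.2 Y hYR _ (ins S hS) hYZ.symm (by simp [hZS, hZ.1.ne.symm])
      (by simp [hYS, (mem_mbSet_iff.1 hY).1.symm]), Sym2.eq_swap]
    exact h2 Y hY Z (mem_mbSet_of_adj hX hZ.2.2 hZ.1) hXY' hZ.1 S
      (fun v hv => mem_mbSet.2 (hS v hv)) hYS hZS ⟨v, hv, hvZ, ev.1, ev'.1⟩

/-! ### Sinks of the remaining graph -/

theorem exists_isSink (hR : R.Nonempty) : ∃ X ∈ R, G.IsSink R X :=
  exists_sink (· ∈ R) hR

theorem IsSink.edge {X Y : V} (h : G.IsSink R X) (hY : Y ∈ G.mbSet R X) : G.edge Y X := by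
  obtain ⟨-, -, hYR, (h1 | h1) | ⟨c, hc, h1, -⟩⟩ := mem_mbSet_iff.1 hY
  · exact absurd h1 (h Y hYR)
  · exact h1
  · exact absurd h1 (h c hc)

/-- The Markov boundary of a sink consists of parents. This is the only source of the in-degree in
all the bounds. -/
theorem IsSink.card_le {X : V} (h : G.IsSink R X) : (G.mbSet R X).card ≤ G.maxInDegree := by
  classical
  refine le_trans (Finset.card_le_card fun Y hY => ?_)
    (Finset.le_sup (f := fun v => (Finset.univ.filter fun u => G.edge u v).card)
      (Finset.mem_univ X))
  simpa using h.edge hY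

/-- `X` itself is a common child of `Y` and `Z` and is always conditioned on. -/
theorem IsSink.cond1 {X : V} (h : G.IsSink R X) (ho : G.Oracle ci R) (hX : X ∈ R) :
    G.Cond1 ci X (G.mbSet R X) := by
  intro Y hY Z hZ _ _ hYZ S hS hYS hZS
  exact ho.of_collider (mbSet_subset X hY) (mbSet_subset X hZ) hYZ
    (Finset.insert_subset hX (hS.trans (mbSet_subset X)))
    (by simp [hYS, (mem_mbSet_iff.1 hY).1.symm]) (by simp [hZS, (mem_mbSet_iff.1 hZ).1.symm])
    (Finset.mem_insert_self X S) (h.edge hY) (h.edge hZ)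

/-- Deleting `X` can only destroy co-parenthoods through `X`. This is why UpdateMb may confine
itself to pairs of neighbours of `X`. -/
theorem edges_of_notMem_mbSet_erase {X v w : V} (hw : w ∈ G.mbSet R v) (hvX : v ≠ X) (hwX : w ≠ X)
    (hn : w ∉ G.mbSet (R.erase X) v) : X ∈ R ∧ G.edge v X ∧ G.edge w X := by
  obtain ⟨hne, hv, hwR, h⟩ := mem_mbSet_iff.1 hw
  have key := fun h' => hn (mem_mbSet_iff.2
    ⟨hne, Finset.mem_erase.2 ⟨hvX, hv⟩, Finset.mem_erase.2 ⟨hwX, hwR⟩, h'⟩)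
  rcases h with h | ⟨c, hc, h1, h2⟩
  · exact absurd (.inl h) key
  · by_cases hcX : c = X
    · subst hcX; exact ⟨hc, h1, h2⟩
    · exact absurd (.inr ⟨c, Finset.mem_erase.2 ⟨hcX, hc⟩, h1, h2⟩) key

end DAG

section Counting

variable {V : Type*} [DecidableEq V]

/-! ### Searches and loops -/

/-- The invariant sees the processed prefix, and the step sees the whole decomposition of the list;
for a list without repetitions the current element is therefore known to be new. -/
theorem foldl_invariant {α β : Type*} {f : β → α → β} (P : List α → β → Prop) (l : List α) (b : β)
    (h0 : P [] b) (hs : ∀ D a r b, l = D ++ a :: r → P D b → P (D ++ [a]) (f b a)) :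
    P l (l.foldl f b) := by
  suffices H : ∀ r D b, l = D ++ r → P D b → P l (r.foldl f b) from H l [] b rfl h0
  intro r
  induction r with
  | nil => intro D b h hP; simpa [h] using hP
  | cons a r ih => intro D b h hP; exact ih (D ++ [a]) _ (by simp [h]) (hs D a r b h hP)

/-- Separates the result of a search from its cost. For counting it is enough that the tested sets
form a prefix of the candidates. -/
theorem findSep_eq (ci : CITest V → Bool) (why : Purpose V) (e : Sym2 V) (l : List (Finset V))
    (σ : State V) : ∃ l', l' <+: l ∧ findSep ci why e l σ =
      (l.find? fun S => ci (e, S),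
        { σ with log := σ.log ++ l'.map fun S => (why, (e, S)) }) := by
  induction l generalizing σ with
  | nil => exact ⟨[], by simp, by simp [findSep]⟩
  | cons S l ih =>
    by_cases h : ci (e, S) = true
    · exact ⟨[S], by simp, by simp [findSep, performTest, h]⟩
    · obtain ⟨l', hl', he⟩ := ih { σ with log := σ.log ++ [(why, (e, S))] }
      refine ⟨S :: l', by simpa using hl', ?_⟩
      simp [findSep, performTest, h, he]

namespace Schedule

variable (sch : Schedule V) (σ : State V)

theorem perm_toList {α : Type*} {l : List α} {s : Finset α} (h : (l : Multiset α) = s.val) :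
    l.Perm s.toList := by
  rw [← Multiset.coe_eq_coe, h, Finset.coe_toList]

theorem mem_vertices {s : Finset V} {x : V} : x ∈ sch.vertices σ s ↔ x ∈ s := by
  rw [(perm_toList (sch.vertices_spec σ s)).mem_iff, Finset.mem_toList]

theorem nodup_vertices (s : Finset V) : (sch.vertices σ s).Nodup :=
  (perm_toList (sch.vertices_spec σ s)).nodup_iff.2 s.nodup_toList

theorem mem_pairs {s : Finset (Sym2 V)} {x : Sym2 V} : x ∈ sch.pairs σ s ↔ x ∈ s := by
  rw [(perm_toList (sch.pairs_spec σ s)).mem_iff, Finset.mem_toList]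

theorem nodup_pairs (s : Finset (Sym2 V)) : (sch.pairs σ s).Nodup :=
  (perm_toList (sch.pairs_spec σ s)).nodup_iff.2 s.nodup_toList

theorem length_pairs (s : Finset (Sym2 V)) : (sch.pairs σ s).length = s.card := by
  rw [(perm_toList (sch.pairs_spec σ s)).length_eq, Finset.length_toList]

theorem mem_couples {s : Finset (V × V)} {x : V × V} : x ∈ sch.couples σ s ↔ x ∈ s := by
  rw [(perm_toList (sch.couples_spec σ s)).mem_iff, Finset.mem_toList]

theorem nodup_couples (s : Finset (V × V)) : (sch.couples σ s).Nodup :=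
  (perm_toList (sch.couples_spec σ s)).nodup_iff.2 s.nodup_toList

theorem mem_subsets {s : Finset (Finset V)} {x : Finset V} : x ∈ sch.subsets σ s ↔ x ∈ s := by
  rw [(perm_toList (sch.subsets_spec σ s)).mem_iff, Finset.mem_toList]

theorem nodup_subsets (s : Finset (Finset V)) : (sch.subsets σ s).Nodup :=
  (perm_toList (sch.subsets_spec σ s)).nodup_iff.2 s.nodup_toList

end Schedule

/-! ### Counting duplicates -/

/-- The routine is one of the two conditions. -/
def Purpose.IsCond (p : Purpose V) : Prop := ∃ X, p = .condition1 X ∨ p = .condition2 X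

/-- The duplicates in the log `L` are paid for by `k` failed conditions, each of which pays for
`B / 4` tests; a pair on which a condition has failed keeps this payment until it passes, and is
done. -/
def Count (B : ℕ) (L : List (Purpose V × CITest V)) (done : Purpose V → Sym2 V → Prop) (k : ℕ) :
    Prop :=
  ∃ P : Finset (Purpose V × Sym2 V),
    (∀ t ∈ L, t.1.IsCond → (t.1, t.2.1) ∈ P ∨ done t.1 t.2.1) ∧
    4 * L.length + P.card * B ≤ 4 * L.toFinset.card + k * B

variable {B k : ℕ} {L M : List (Purpose V × CITest V)} {done done' : Purpose V → Sym2 V → Prop}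

theorem card_toFinset_append (hM : M.Nodup) (hd : ∀ t ∈ M, t ∉ L) :
    (L ++ M).toFinset.card = L.toFinset.card + M.length := by
  rw [List.toFinset_append, Finset.card_union_of_disjoint, List.toFinset_card_of_nodup hM]
  rw [Finset.disjoint_left]
  intro t h1 h2
  exact hd t (List.mem_toFinset.1 h2) (List.mem_toFinset.1 h1)

theorem Count.succ (h : Count B L done k) : Count B L done (k + 1) :=
  let ⟨P, h1, h2⟩ := h; ⟨P, h1, by rw [add_mul]; omega⟩

theorem Count.append_fresh (h : Count B L done k) (hM : M.Nodup) (hd : ∀ t ∈ M, t ∉ L)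
    (hc : ∀ t ∈ M, ¬ t.1.IsCond) : Count B (L ++ M) done k := by
  obtain ⟨P, h1, h2⟩ := h
  refine ⟨P, fun t ht htc => ?_, ?_⟩
  · rcases List.mem_append.1 ht with ht | ht
    · exact h1 t ht htc
    · exact absurd htc (hc t ht)
  · rw [card_toFinset_append hM hd, List.length_append]; omega

/-- The amortisation. A first failure on a pair performs fresh tests and deposits its payment in
`P`; a further failure pays for its own tests; a pass after a failure spends the deposit, and a pass
without one consists of fresh tests. The two conclusions are the failing and the passing case. -/
theorem Count.append_block (h : Count B L done k) {p : Purpose V} {e : Sym2 V}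
    {l : List (Finset V)} (hl : l.Nodup) (hB : 4 * l.length ≤ B) (hp : p.IsCond)
    (hnd : ¬ done p e) :
    Count B (L ++ l.map fun S => (p, (e, S))) done (k + 1) ∧
    ∀ done', (∀ p e, done p e → done' p e) → done' p e →
      Count B (L ++ l.map fun S => (p, (e, S))) done' k := by
  obtain ⟨P, h1, h2⟩ := h
  have hM : (l.map fun S => ((p, (e, S)) : Purpose V × CITest V)).Nodup :=
    hl.map fun S T h => by simpa using h
  have hlen : (L ++ l.map fun S => ((p, (e, S)) : Purpose V × CITest V)).length =
    L.length + l.length := by simp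
  have hmono : L.toFinset.card ≤
      (L ++ l.map fun S => ((p, (e, S)) : Purpose V × CITest V)).toFinset.card :=
    Finset.card_le_card (by rw [List.toFinset_append]; exact Finset.subset_union_left)
  by_cases hpP : (p, e) ∈ P
  · constructor
    · refine ⟨P, fun t ht htc => ?_, ?_⟩
      · rcases List.mem_append.1 ht with ht | ht
        · exact h1 t ht htc
        · obtain ⟨S, -, rfl⟩ := List.mem_map.1 ht; exact .inl hpP
      · rw [hlen, add_mul]; omega
    · intro done' hdd hd
      refine ⟨P.erase (p, e), fun t ht htc => ?_, ?_⟩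
      · by_cases hte : (t.1, t.2.1) = (p, e)
        · rw [Prod.mk.injEq] at hte
          rw [hte.1, hte.2]; exact .inr hd
        rcases List.mem_append.1 ht with ht | ht
        · exact (h1 t ht htc).imp (fun h => Finset.mem_erase.2 ⟨hte, h⟩) (hdd _ _)
        · obtain ⟨S, -, rfl⟩ := List.mem_map.1 ht; exact absurd rfl hte
      · have hc : (P.erase (p, e)).card + 1 = P.card := Finset.card_erase_add_one hpP
        rw [hlen]
        rw [← hc, add_mul] at h2
        omega
  -- A pair that is neither in `P` nor done has no earlier test of this condition in the log.
  · have hfresh : ∀ t ∈ l.map fun S => ((p, (e, S)) : Purpose V × CITest V), t ∉ L := by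
      intro t ht htL
      obtain ⟨S, -, rfl⟩ := List.mem_map.1 ht
      exact (h1 _ htL hp).elim hpP hnd
    have hcard := card_toFinset_append hM hfresh
    rw [List.length_map] at hcard
    constructor
    · refine ⟨insert (p, e) P, fun t ht htc => ?_, ?_⟩
      · rcases List.mem_append.1 ht with ht | ht
        · exact (h1 t ht htc).imp_left (Finset.mem_insert_of_mem)
        · obtain ⟨S, -, rfl⟩ := List.mem_map.1 ht
          exact .inl (Finset.mem_insert_self _ _)
      · rw [Finset.card_insert_of_notMem hpP, hlen, hcard, add_mul, add_mul]; omega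
    · intro done' hdd hd
      refine ⟨P, fun t ht htc => ?_, ?_⟩
      · rcases List.mem_append.1 ht with ht | ht
        · exact (h1 t ht htc).imp_right (hdd _ _)
        · obtain ⟨S, -, rfl⟩ := List.mem_map.1 ht
          exact .inr hd
      · rw [hlen, hcard]; omega

/-! ### Counting unique tests -/

namespace DAG

variable (G : DAG V)

open Classical in
/-- The neighbours of `X` in `M`. -/
noncomputable def nbrs (X : V) (M : Finset V) : Finset V := M.filter fun Y => G.Adj X Y

open Classical in
/-- The elements of `M` that are not adjacent to `X`. -/
noncomputable def coparents (X : V) (M : Finset V) : Finset V := M.filter fun Y => ¬ G.Adj X Y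

/-- The tests by `FindNeighbors` for `X`, if its Markov boundary is in `M`. -/
def nbrTests (X : V) (M : Finset V) : Finset (Purpose V × CITest V) :=
  M.biUnion fun Y => (M.erase Y).powerset.image fun S => (.findNeighbors X, (s(X, Y), S))

/-- The tests by `Condition1` for `X`, if its Markov boundary is in `M`. -/
noncomputable def cond1Tests (X : V) (M : Finset V) : Finset (Purpose V × CITest V) :=
  (unorderedPairs (G.nbrs X M)).biUnion fun e =>
    (M.filter (· ∉ e)).powerset.image fun S => (.condition1 X, (e, insert X S))

/-- The tests by `FindVS` for `X`, if its Markov boundary is in `M`. -/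
noncomputable def vsTests (X : V) (M : Finset V) : Finset (Purpose V × CITest V) :=
  (G.coparents X M ×ˢ G.nbrs X M).biUnion fun YZ =>
    (insert X M \ {YZ.1, YZ.2}).powerset.image fun S => (.findVS X, (s(YZ.1, YZ.2), S))

/-- The tests by `Condition2` for `X`, if its Markov boundary is in `M`. -/
noncomputable def cond2Tests (X : V) (M : Finset V) : Finset (Purpose V × CITest V) :=
  (G.coparents X M ×ˢ G.nbrs X M).biUnion fun YZ =>
    (M \ {YZ.1, YZ.2}).powerset.image fun S => (.condition2 X, (s(YZ.1, YZ.2), insert X S))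

/-- The tests for `X` except those by `UpdateMb`, if its Markov boundary is in `M`. -/
noncomputable def testSet (X : V) (M : Finset V) : Finset (Purpose V × CITest V) :=
  nbrTests X M ∪ G.cond1Tests X M ∪ G.vsTests X M ∪ G.cond2Tests X M

variable {G} {X : V} {M M' : Finset V}

theorem mem_nbrs {Y : V} : Y ∈ G.nbrs X M ↔ Y ∈ M ∧ G.Adj X Y := by simp [nbrs]

theorem mem_coparents {Y : V} : Y ∈ G.coparents X M ↔ Y ∈ M ∧ ¬ G.Adj X Y := by simp [coparents]

theorem nbrs_mono (h : M ⊆ M') : G.nbrs X M ⊆ G.nbrs X M' := by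
  classical exact Finset.filter_subset_filter _ h

theorem coparents_mono (h : M ⊆ M') : G.coparents X M ⊆ G.coparents X M' := by
  classical exact Finset.filter_subset_filter _ h

theorem unorderedPairs_mono (h : M ⊆ M') : unorderedPairs M ⊆ unorderedPairs M' :=
  Finset.filter_subset_filter _ (Finset.sym2_mono h)

theorem testSet_mono (h : M ⊆ M') : G.testSet X M ⊆ G.testSet X M' := by
  have hN := G.nbrs_mono (X := X) h
  have hC := G.coparents_mono (X := X) h
  refine Finset.union_subset_union (Finset.union_subset_union (Finset.union_subset_union ?_ ?_) ?_)
    ?_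
  · exact (Finset.biUnion_subset_biUnion_of_subset_left _ h).trans (Finset.biUnion_mono fun Y _ =>
      Finset.image_subset_image (Finset.powerset_mono.2 (Finset.erase_subset_erase Y h)))
  · exact (Finset.biUnion_subset_biUnion_of_subset_left _ (unorderedPairs_mono hN)).trans
      (Finset.biUnion_mono fun Y _ =>
      Finset.image_subset_image (Finset.powerset_mono.2 (Finset.filter_subset_filter _ h)))
  · exact (Finset.biUnion_subset_biUnion_of_subset_left _ (Finset.product_subset_product hC hN)).trans
      (Finset.biUnion_mono fun Y _ =>
      Finset.image_subset_image (Finset.powerset_mono.2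
        (Finset.sdiff_subset_sdiff (Finset.insert_subset_insert X h) subset_rfl)))
  · exact (Finset.biUnion_subset_biUnion_of_subset_left _ (Finset.product_subset_product hC hN)).trans
      (Finset.biUnion_mono fun Y _ =>
      Finset.image_subset_image (Finset.powerset_mono.2 (Finset.sdiff_subset_sdiff h subset_rfl)))

/-- The factor `c` clears the denominators of `2^m / 2` and `2^m / 4`, which need not be integers
for small `m`. -/
theorem card_biUnion_image_le {α β : Type*} [DecidableEq β] {s : Finset α}
    {F : α → Finset (Finset V)} {g : α → Finset V → β} {c B : ℕ}
    (h : ∀ a ∈ s, c * (F a).card ≤ B) :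
    c * (s.biUnion fun a => (F a).image (g a)).card ≤ s.card * B := by
  refine (Nat.mul_le_mul_left c Finset.card_biUnion_le).trans ?_
  rw [Finset.mul_sum, ← smul_eq_mul, ← Finset.sum_const]
  exact Finset.sum_le_sum fun a ha =>
    (Nat.mul_le_mul_left c Finset.card_image_le).trans (h a ha)

theorem four_mul_two_pow_card_filter {e : Sym2 V} (he : e ∈ unorderedPairs M) :
    4 * 2 ^ (M.filter (· ∉ e)).card = 2 ^ M.card := by
  induction e with
  | _ x y =>
    rw [mk_mem_unorderedPairs] at he
    have h1 : M.filter (· ∉ s(x, y)) = (M.erase x).erase y := by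
      ext v; simp [and_assoc, and_comm]; tauto
    have h2 : y ∈ M.erase x := Finset.mem_erase.2 ⟨he.2.2.symm, he.2.1⟩
    have h3 := Finset.card_erase_add_one h2
    have h4 := Finset.card_erase_add_one he.1
    rw [h1, ← h4, ← h3, pow_add, pow_add]; ring

theorem four_mul_two_pow_card_sdiff {x y : V} (hx : x ∈ M) (hy : y ∈ M) (hxy : x ≠ y) :
    4 * 2 ^ (M \ {x, y}).card = 2 ^ M.card := by
  rw [← four_mul_two_pow_card_filter (mk_mem_unorderedPairs.2 ⟨hx, hy, hxy⟩)]
  congr 3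
  ext v; simp

/-- With `m`, `k`, `l` the sizes of `M` and of its neighbours and co-parents, the four routines
contribute at most `m 2^m / 2`, `C(k,2) 2^m / 4`, `kl 2^m / 2` and `kl 2^m / 4`. FindVS has twice as
many sets per pair as Condition2, because `X` is optional in its conditioning sets. -/
theorem eight_mul_card_testSet_le (hX : X ∉ M) :
    8 * (G.testSet X M).card ≤ (4 * M.card + 2 * (G.nbrs X M).card.choose 2 +
      6 * ((G.coparents X M).card * (G.nbrs X M).card)) * 2 ^ M.card := by
  have h1 : 2 * (nbrTests X M).card ≤ M.card * 2 ^ M.card := by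
    refine card_biUnion_image_le fun Y hY => ?_
    rw [Finset.card_powerset, ← Finset.card_erase_add_one hY, pow_succ]; omega
  have hN : G.nbrs X M ⊆ M := fun Y hY => (mem_nbrs.1 hY).1
  have h2 : 4 * (G.cond1Tests X M).card ≤ (G.nbrs X M).card.choose 2 * 2 ^ M.card := by
    rw [← card_unorderedPairs]
    unfold cond1Tests
    have := card_biUnion_image_le (s := unorderedPairs (G.nbrs X M)) (c := 4) (B := 2 ^ M.card)
      (F := fun e => (M.filter (· ∉ e)).powerset)
      (g := fun e S => ((.condition1 X, (e, insert X S)) : Purpose V × CITest V)) ?_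
    · exact this
    · intro e he
      rw [Finset.card_powerset,
        four_mul_two_pow_card_filter (unorderedPairs_mono hN he)]
  have mem : ∀ YZ ∈ G.coparents X M ×ˢ G.nbrs X M, YZ.1 ∈ M ∧ YZ.2 ∈ M ∧ YZ.1 ≠ YZ.2 := by
    intro YZ h
    rw [Finset.mem_product, mem_coparents, mem_nbrs] at h
    exact ⟨h.1.1, h.2.1, fun e => h.1.2 (e ▸ h.2.2)⟩
  have h3 : 2 * (G.vsTests X M).card ≤ (G.coparents X M ×ˢ G.nbrs X M).card * 2 ^ M.card := by
    refine card_biUnion_image_le fun YZ h => ?_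
    obtain ⟨hY, hZ, hne⟩ := mem YZ h
    have := four_mul_two_pow_card_sdiff (Finset.mem_insert_of_mem (b := X) hY)
      (Finset.mem_insert_of_mem hZ) hne
    rw [Finset.card_insert_of_notMem hX, pow_succ] at this
    rw [Finset.card_powerset]
    omega
  have h4 : 4 * (G.cond2Tests X M).card ≤ (G.coparents X M ×ˢ G.nbrs X M).card * 2 ^ M.card := by
    refine card_biUnion_image_le fun YZ h => ?_
    obtain ⟨hY, hZ, hne⟩ := mem YZ h
    rw [Finset.card_powerset, four_mul_two_pow_card_sdiff hY hZ hne]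
  rw [Finset.card_product] at h3 h4
  have h : (G.testSet X M).card ≤ (nbrTests X M).card + (G.cond1Tests X M).card +
      (G.vsTests X M).card + (G.cond2Tests X M).card :=
    (Finset.card_union_le _ _).trans (Nat.add_le_add_right ((Finset.card_union_le _ _).trans
      (Nat.add_le_add_right (Finset.card_union_le _ _) _)) _)
  rw [add_mul, add_mul]
  nlinarith

theorem card_testSet_le {Δ : ℕ} (hX : X ∉ M) (hM : M.card ≤ Δ) :
    ((G.testSet X M).card : ℝ) ≤ Δ / 2 * (1 + 0.45 * Δ) * 2 ^ Δ := by
  classical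
  have h := eight_mul_card_testSet_le (G := G) hX
  have hkl : (G.nbrs X M).card + (G.coparents X M).card = M.card :=
    Finset.card_filter_add_card_filter_not _
  generalize (G.nbrs X M).card = k at *
  generalize (G.coparents X M).card = l at *
  have h' : (8 : ℝ) * (G.testSet X M).card ≤
      (4 * M.card + 2 * (k.choose 2 : ℝ) + 6 * (l * k)) * 2 ^ M.card := by exact_mod_cast h
  rw [Nat.cast_choose_two] at h'
  have hm : (M.card : ℝ) = k + l := by exact_mod_cast hkl.symm
  have hle : (M.card : ℝ) ≤ Δ := by exact_mod_cast hM
  have hm0 : (0 : ℝ) ≤ M.card := by positivity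
  have hk0 : (0 : ℝ) ≤ k := by positivity
  have step : 4 * (M.card : ℝ) + 2 * (k * (k - 1) / 2) + 6 * (l * k) ≤
      4 * Δ * (1 + 0.45 * Δ) := by
    -- The difference of the two sides is `0.2 (2k - 3l)^2 + k`; the quadratic terms balance at `2k
    -- = 3l`, which determines `0.45`.
    calc _ ≤ 4 * (M.card : ℝ) * (1 + 0.45 * M.card) := by
          rw [hm]; nlinarith [sq_nonneg (2 * (k : ℝ) - 3 * l)]
      _ ≤ _ := by gcongr
  have hpow : (2 : ℝ) ^ M.card ≤ 2 ^ Δ := pow_le_pow_right₀ (by norm_num) hM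
  have : (8 : ℝ) * (G.testSet X M).card ≤ 4 * Δ * (1 + 0.45 * Δ) * 2 ^ Δ :=
    h'.trans (mul_le_mul step hpow (by positivity) (by positivity))
  linarith

end DAG

end Counting

variable {V : Type*} [DecidableEq V] [Fintype V]

/-! ### The invariants -/

/-- The pair of a test of one of the conditions is flagged to be skipped. -/
def doneKeys (G : DAG V) (s₁ : Finset (V × Sym2 V)) (s₂ : Finset (V × V × V)) :
    Purpose V → Sym2 V → Prop
  | .condition1 X, e => (X, e) ∈ s₁
  | .condition2 X, e => ∃ Y Z, e = s(Y, Z) ∧ ¬ G.Adj X Y ∧ G.Adj X Z ∧ (X, Y, Z) ∈ s₂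
  | _, _ => False

/-- What is known about the variables of the program other than the log. -/
structure Sound (G : DAG V) (ci : CITest V → Bool) (σ : State V) : Prop where
  oracle : G.Oracle ci σ.rem
  mb : ∀ v ∈ σ.rem, σ.mb v = G.mbSet σ.rem v
  adj_of_edges : ∀ x y, s(x, y) ∈ σ.edges → G.Adj x y
  edges_of_adj : ∀ x y, G.Adj x y → (x ∉ σ.rem ∨ x ∈ σ.nbrsDone) → s(x, y) ∈ σ.edges
  sepset : ∀ X Y Z, G.edge X Z → G.edge Y Z → ¬ G.Adj X Y → Z ∉ σ.sepset X Y
  vs : ∀ X ∈ σ.vsDone, X ∈ σ.rem → ∀ Y ∈ σ.rem, ∀ Z ∈ σ.rem, X ≠ Y → ¬ G.Adj X Y →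
    G.edge X Z → G.edge Y Z → (Z, Y) ∈ σ.vs X
  skip1 : ∀ X ∈ σ.rem, ∀ Y Z, (X, s(Y, Z)) ∈ σ.skipCond1 → ∀ S ⊆ σ.mb X, Y ∉ S → Z ∉ S →
    ci (s(Y, Z), insert X S) = false
  skip2 : ∀ X ∈ σ.rem, ∀ Y Z, (X, Y, Z) ∈ σ.skipCond2 → ∀ S ⊆ σ.mb X, Y ∉ S → Z ∉ S →
    (∃ v ∈ S, v ≠ Z ∧ G.edge X v ∧ G.edge Y v) → ci (s(Y, Z), insert X S) = false
  skipVec : ∀ X ∈ σ.rem, X ∈ σ.skipVec → ¬ G.IsSink σ.rem X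

/-- What is known about the log; `M X` is the Markov boundary of `X` at the time of
`FindNeighbors` for `X`, and `k` bounds the number of failed conditions. -/
structure LogInv (G : DAG V) (M : V → Finset V) (k : ℕ) (σ : State V) : Prop where
  card_le : ∀ X ∈ σ.nbrsDone, (M X).card ≤ G.maxInDegree
  self_notMem : ∀ X ∈ σ.nbrsDone, X ∉ M X
  mb_subset : ∀ X ∈ σ.nbrsDone, X ∈ σ.rem → σ.mb X ⊆ M X
  entries : ∀ t ∈ σ.log,
    t ∈ ((unorderedPairs Finset.univ).image fun e =>
      ((.computeMb, (e, Finset.univ.filter (· ∉ e))) : Purpose V × CITest V)) ∨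
    (∃ X ∈ σ.nbrsDone, t ∈ G.testSet X (M X)) ∨ ∃ X, X ∉ σ.rem ∧ t.1 = .updateMb X
  vs_entries : ∀ t ∈ σ.log, ∀ X, t.1 = .findVS X → X ∈ σ.vsDone
  update : ∀ X, (σ.log.filter fun t => t.1 = .updateMb X).length ≤ G.maxInDegree.choose 2
  count : Count (2 ^ G.maxInDegree) σ.log (doneKeys G σ.skipCond1 σ.skipCond2) k

/-- The invariant of the outer loop. -/
def Inv (G : DAG V) (ci : CITest V → Bool) (k : ℕ) (σ : State V) : Prop :=
  Sound G ci σ ∧ ∃ M, LogInv G M k σ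

variable {G : DAG V} {ci : CITest V → Bool} {k : ℕ} {σ : State V} {X : V} {M : V → Finset V}

/-- Used to tell log entries of different routines and variables apart when new tests are shown to
be fresh. -/
theorem DAG.fst_of_mem_testSet {M : Finset V} {t : Purpose V × CITest V} (h : t ∈ G.testSet X M) :
    t.1 = .findNeighbors X ∨ t.1 = .condition1 X ∨ t.1 = .findVS X ∨ t.1 = .condition2 X := by
  simp only [DAG.testSet, nbrTests, DAG.cond1Tests, DAG.vsTests, DAG.cond2Tests, Finset.mem_union,
    Finset.mem_biUnion, Finset.mem_image] at h
  rcases h with ((⟨_, _, _, _, rfl⟩ | ⟨_, _, _, _, rfl⟩) | ⟨_, _, _, _, rfl⟩) | ⟨_, _, _, _, rfl⟩ <;>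
    simp

theorem Sound.self_notMem_mb (h : Sound G ci σ) (hX : X ∈ σ.rem) : X ∉ σ.mb X := by
  rw [h.mb X hX]; exact DAG.self_notMem_mbSet X

theorem Sound.mb_subset_rem (h : Sound G ci σ) (hX : X ∈ σ.rem) : σ.mb X ⊆ σ.rem := by
  rw [h.mb X hX]; exact DAG.mbSet_subset X

theorem Sound.mem_mb_of_adj (h : Sound G ci σ) (hX : X ∈ σ.rem) {Y : V} (hY : Y ∈ σ.rem)
    (hXY : G.Adj X Y) : Y ∈ σ.mb X := by
  rw [h.mb X hX]; exact DAG.mem_mbSet_of_adj hX hY hXY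

/-- Carries the failing and passing cases of `Count.append_block` over to the whole log invariant.
-/
theorem LogInv.block (h : LogInv G M k σ) {p : Purpose V} {e : Sym2 V} {l : List (Finset V)}
    (hX : X ∈ σ.nbrsDone) (hl : l.Nodup) (hB : 4 * l.length ≤ 2 ^ G.maxInDegree) (hp : p.IsCond)
    (hnd : ¬ doneKeys G σ.skipCond1 σ.skipCond2 p e)
    (hmem : ∀ S ∈ l, (p, (e, S)) ∈ G.testSet X (M X)) :
    LogInv G M (k + 1) { σ with log := σ.log ++ l.map fun S => (p, (e, S)) } ∧
    ∀ s₁ s₂, σ.skipCond1 ⊆ s₁ → σ.skipCond2 ⊆ s₂ → doneKeys G s₁ s₂ p e →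
      LogInv G M k { σ with
        skipCond1 := s₁
        skipCond2 := s₂
        log := σ.log ++ l.map fun S => (p, (e, S)) } := by
  have hentries : ∀ t ∈ σ.log ++ l.map fun S => ((p, (e, S)) : Purpose V × CITest V),
      t ∈ ((unorderedPairs Finset.univ).image fun e =>
        ((.computeMb, (e, Finset.univ.filter (· ∉ e))) : Purpose V × CITest V)) ∨
      (∃ X ∈ σ.nbrsDone, t ∈ G.testSet X (M X)) ∨ ∃ X, X ∉ σ.rem ∧ t.1 = .updateMb X := by
    intro t ht
    rcases List.mem_append.1 ht with ht | ht
    · exact h.entries t ht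
    · obtain ⟨S, hS, rfl⟩ := List.mem_map.1 ht; exact .inr (.inl ⟨X, hX, hmem S hS⟩)
  have hvs : ∀ t ∈ σ.log ++ l.map fun S => ((p, (e, S)) : Purpose V × CITest V),
      ∀ X, t.1 = .findVS X → X ∈ σ.vsDone := by
    intro t ht X htX
    rcases List.mem_append.1 ht with ht | ht
    · exact h.vs_entries t ht X htX
    · obtain ⟨S, hS, rfl⟩ := List.mem_map.1 ht
      obtain ⟨X', rfl | rfl⟩ := hp <;> simp at htX
  have hupd : ∀ X, ((σ.log ++ l.map fun S => ((p, (e, S)) : Purpose V × CITest V)).filter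
      fun t => t.1 = .updateMb X).length ≤ G.maxInDegree.choose 2 := by
    intro X
    have : (l.map fun S => ((p, (e, S)) : Purpose V × CITest V)).filter
        (fun t => t.1 = .updateMb X) = [] := by
      rw [List.filter_eq_nil_iff]
      intro t ht
      obtain ⟨S, hS, rfl⟩ := List.mem_map.1 ht
      obtain ⟨X', rfl | rfl⟩ := hp <;> simp
    rw [List.filter_append, this, List.append_nil]
    exact h.update X
  obtain ⟨hc1, hc2⟩ := h.count.append_block hl hB hp hnd
  refine ⟨⟨h.card_le, h.self_notMem, h.mb_subset, hentries, hvs, hupd, hc1⟩, fun s₁ s₂ h1 h2 hd =>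
    ⟨h.card_le, h.self_notMem, h.mb_subset, hentries, hvs, hupd, hc2 _ ?_ hd⟩⟩
  rintro (_ | _ | _ | _ | _ | _) e
  · exact id
  · exact id
  · exact fun h => h1 h
  · exact id
  · rintro ⟨Y, Z, he, hY, hZ, hs⟩; exact ⟨Y, Z, he, hY, hZ, h2 hs⟩
  · exact id

theorem length_le_of_nodup {α : Type*} [DecidableEq α] {l : List α} (hl : l.Nodup) {s : Finset α}
    (h : ∀ a ∈ l, a ∈ s) : l.length ≤ s.card := by
  rw [← List.toFinset_card_of_nodup hl]
  exact Finset.card_le_card fun a ha => h a (List.mem_toFinset.1 ha)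

theorem nodup_map_insert {l : List (Finset V)} (hl : l.Nodup) (h : ∀ S ∈ l, X ∉ S) :
    (l.map (insert X)).Nodup :=
  List.Nodup.map_on (fun S hS T hT e => by
    rw [← Finset.erase_insert (h S hS), e, Finset.erase_insert (h T hT)]) hl

theorem Inv.cond1_block (h : Inv G ci k σ) (hX : X ∈ σ.rem) (hXd : X ∈ σ.nbrsDone) {e : Sym2 V}
    (he : e ∈ unorderedPairs (G.nbrs X (σ.mb X))) (hskip : (X, e) ∉ σ.skipCond1)
    {l : List (Finset V)} (hl : l.Nodup)
    (hls : ∀ T ∈ l, ∃ S ⊆ (σ.mb X).filter (· ∉ e), insert X S = T) :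
    Inv G ci (k + 1) { σ with log := σ.log ++ l.map fun S => (.condition1 X, (e, S)) } ∧
    ((∀ S ⊆ (σ.mb X).filter (· ∉ e), ci (e, insert X S) = false) →
      Inv G ci k { σ with
        skipCond1 := insert (X, e) σ.skipCond1
        log := σ.log ++ l.map fun S => (.condition1 X, (e, S)) }) := by
  obtain ⟨hs, M, hM⟩ := h
  have hN : G.nbrs X (σ.mb X) ⊆ σ.mb X := fun Y hY => (DAG.mem_nbrs.1 hY).1
  -- The conditioning sets vary over the subsets of a boundary of size at most `Δ` with two elements
  -- taken out.
  have hlen : 4 * l.length ≤ 2 ^ G.maxInDegree := by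
    have h1 : l.length ≤ (((σ.mb X).filter (· ∉ e)).powerset.image (insert X)).card :=
      length_le_of_nodup hl fun T hT => by
        obtain ⟨S, hS, rfl⟩ := hls T hT
        exact Finset.mem_image_of_mem _ (Finset.mem_powerset.2 hS)
    have h2 := Finset.card_image_le (s := ((σ.mb X).filter (· ∉ e)).powerset) (f := insert X)
    rw [Finset.card_powerset] at h2
    have h3 := DAG.four_mul_two_pow_card_filter (DAG.unorderedPairs_mono hN he)
    have h4 : 2 ^ (σ.mb X).card ≤ 2 ^ G.maxInDegree := Nat.pow_le_pow_right (by norm_num)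
      ((Finset.card_le_card (hM.mb_subset X hXd hX)).trans (hM.card_le X hXd))
    omega
  have hmem : ∀ S ∈ l, ((.condition1 X, (e, S)) : Purpose V × CITest V) ∈ G.testSet X (M X) := by
    intro T hT
    obtain ⟨S, hS, rfl⟩ := hls T hT
    refine DAG.testSet_mono (hM.mb_subset X hXd hX) ?_
    simp only [DAG.testSet, DAG.cond1Tests, Finset.mem_union, Finset.mem_biUnion]
    exact .inl (.inl (.inr ⟨e, he, Finset.mem_image_of_mem _ (Finset.mem_powerset.2 hS)⟩))
  obtain ⟨h1, h2⟩ := hM.block hXd hl hlen ⟨X, .inl rfl⟩ hskip hmem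
  refine ⟨⟨⟨hs.oracle, hs.mb, hs.adj_of_edges, hs.edges_of_adj, hs.sepset, hs.vs, hs.skip1, hs.skip2,
    hs.skipVec⟩, M, h1⟩, fun hci => ⟨⟨hs.oracle, hs.mb, hs.adj_of_edges, hs.edges_of_adj, hs.sepset,
    hs.vs, ?_, hs.skip2, hs.skipVec⟩, M, h2 _ _ (Finset.subset_insert _ _) subset_rfl
      (Finset.mem_insert_self _ _)⟩⟩
  intro X' hX' Y Z hYZ S hS hY hZ
  rcases Finset.mem_insert.1 hYZ with he | hYZ
  · rw [Prod.mk.injEq] at he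
    obtain ⟨rfl, rfl⟩ := he
    refine hci S fun v hv => Finset.mem_filter.2 ⟨hS hv, ?_⟩
    rw [Sym2.mem_iff]
    rintro (rfl | rfl)
    · exact hY hv
    · exact hZ hv
  · exact hs.skip1 X' hX' Y Z hYZ S hS hY hZ

theorem Inv.cond2_block (h : Inv G ci k σ) (hX : X ∈ σ.rem) (hXd : X ∈ σ.nbrsDone) {Y Z : V}
    (hY : Y ∈ G.coparents X (σ.mb X)) (hZ : Z ∈ G.nbrs X (σ.mb X))
    (hskip : (X, Y, Z) ∉ σ.skipCond2) {l : List (Finset V)} (hl : l.Nodup)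
    (hls : ∀ T ∈ l, ∃ S ⊆ σ.mb X \ {Y, Z}, insert X S = T) :
    Inv G ci (k + 1) { σ with log := σ.log ++ l.map fun S => (.condition2 X, (s(Y, Z), S)) } ∧
    ((∀ S ⊆ σ.mb X \ {Y, Z}, (∃ v ∈ S, v ≠ Z ∧ G.edge X v ∧ G.edge Y v) →
        ci (s(Y, Z), insert X S) = false) →
      Inv G ci k { σ with
        skipCond2 := insert (X, Y, Z) σ.skipCond2
        log := σ.log ++ l.map fun S => (.condition2 X, (s(Y, Z), S)) }) := by
  obtain ⟨hs, M, hM⟩ := h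
  have hY' := DAG.mem_coparents.1 hY
  have hZ' := DAG.mem_nbrs.1 hZ
  have hYZ : Y ≠ Z := by rintro rfl; exact hY'.2 hZ'.2
  have hlen : 4 * l.length ≤ 2 ^ G.maxInDegree := by
    have h1 : l.length ≤ ((σ.mb X \ {Y, Z}).powerset.image (insert X)).card :=
      length_le_of_nodup hl fun T hT => by
        obtain ⟨S, hS, rfl⟩ := hls T hT
        exact Finset.mem_image_of_mem _ (Finset.mem_powerset.2 hS)
    have h2 := Finset.card_image_le (s := (σ.mb X \ {Y, Z}).powerset) (f := insert X)
    rw [Finset.card_powerset] at h2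
    have h3 := DAG.four_mul_two_pow_card_sdiff hY'.1 hZ'.1 hYZ
    have h4 : 2 ^ (σ.mb X).card ≤ 2 ^ G.maxInDegree := Nat.pow_le_pow_right (by norm_num)
      ((Finset.card_le_card (hM.mb_subset X hXd hX)).trans (hM.card_le X hXd))
    omega
  have hmem : ∀ S ∈ l,
      ((.condition2 X, (s(Y, Z), S)) : Purpose V × CITest V) ∈ G.testSet X (M X) := by
    intro T hT
    obtain ⟨S, hS, rfl⟩ := hls T hT
    refine DAG.testSet_mono (hM.mb_subset X hXd hX) ?_
    simp only [DAG.testSet, DAG.cond2Tests, Finset.mem_union, Finset.mem_biUnion]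
    exact .inr ⟨(Y, Z), Finset.mk_mem_product hY hZ,
      Finset.mem_image_of_mem _ (Finset.mem_powerset.2 hS)⟩
  -- The log keeps unordered pairs, while the flags are ordered. The order is recovered from
  -- adjacency: `Z` is adjacent to `X` and `Y` is not.
  have hnd : ¬ doneKeys G σ.skipCond1 σ.skipCond2 (.condition2 X) s(Y, Z) := by
    rintro ⟨Y', Z', e, hXY', hXZ', hd⟩
    rcases Sym2.eq_iff.1 e with ⟨rfl, rfl⟩ | ⟨rfl, rfl⟩
    · exact hskip hd
    · exact hY'.2 hXZ'
  obtain ⟨h1, h2⟩ := hM.block hXd hl hlen ⟨X, .inr rfl⟩ hnd hmem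
  refine ⟨⟨⟨hs.oracle, hs.mb, hs.adj_of_edges, hs.edges_of_adj, hs.sepset, hs.vs, hs.skip1, hs.skip2,
    hs.skipVec⟩, M, h1⟩, fun hci => ⟨⟨hs.oracle, hs.mb, hs.adj_of_edges, hs.edges_of_adj, hs.sepset,
    hs.vs, hs.skip1, ?_, hs.skipVec⟩, M, h2 _ _ subset_rfl (Finset.subset_insert _ _)
      ⟨Y, Z, rfl, hY'.2, hZ'.2, Finset.mem_insert_self _ _⟩⟩⟩
  intro X' hX' Y' Z' hYZ' S hS hYS hZS hv
  rcases Finset.mem_insert.1 hYZ' with he | hYZ'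
  · simp only [Prod.mk.injEq] at he
    obtain ⟨rfl, rfl, rfl⟩ := he
    refine hci S (fun w hw => Finset.mem_sdiff.2 ⟨hS hw, ?_⟩) hv
    rw [Finset.mem_insert, Finset.mem_singleton]
    rintro (rfl | rfl)
    · exact hYS hw
    · exact hZS hw
  · exact hs.skip2 X' hX' Y' Z' hYZ' S hS hYS hZS hv

/-! ### The two conditions -/

/-- The loop stops at its first failure, so a call raises the failure count by at most one. Flags
set by a pass stay valid: test outcomes never change, and Markov boundaries only shrink. -/
theorem condition1Loop_spec (sch : Schedule V) (l : List (Sym2 V)) (h : Inv G ci k σ)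
    (hX : X ∈ σ.rem) (hXd : X ∈ σ.nbrsDone) (hl : l.Nodup)
    (hle : ∀ e ∈ l, e ∈ unorderedPairs (G.nbrs X (σ.mb X)) ∧ (X, e) ∉ σ.skipCond1) :
    ∃ s L, (condition1Loop ci sch X l σ).2 = { σ with skipCond1 := s, log := L } ∧
      ((condition1Loop ci sch X l σ).1 = true →
        Inv G ci k { σ with skipCond1 := s, log := L } ∧ σ.skipCond1 ⊆ s ∧ ∀ e ∈ l, (X, e) ∈ s) ∧
      ((condition1Loop ci sch X l σ).1 = false →
        Inv G ci (k + 1) { σ with skipCond1 := s, log := L } ∧ ¬ G.Cond1 ci X (σ.mb X)) := by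
  induction l generalizing σ with
  | nil =>
    exact ⟨σ.skipCond1, σ.log, rfl, fun _ => ⟨h, subset_rfl, by simp⟩, by simp [condition1Loop]⟩
  | cons e l ih =>
    obtain ⟨l', hl', heq⟩ := findSep_eq ci (.condition1 X) e
      ((sch.subsets σ ((σ.mb X).filter (· ∉ e)).powerset).map (insert X)) σ
    obtain ⟨he, hskip⟩ := hle e List.mem_cons_self
    have hXmb := h.1.self_notMem_mb hX
    have hsub : ∀ S ∈ sch.subsets σ ((σ.mb X).filter (· ∉ e)).powerset,
        S ⊆ (σ.mb X).filter (· ∉ e) := fun S hS =>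
      Finset.mem_powerset.1 ((sch.mem_subsets σ).1 hS)
    have hnd : l'.Nodup := List.Nodup.sublist hl'.sublist (nodup_map_insert (sch.nodup_subsets σ _)
      fun S hS hXS => hXmb (Finset.mem_filter.1 (hsub S hS hXS)).1)
    obtain ⟨hfail, hpass⟩ := h.cond1_block hX hXd he hskip hnd fun T hT => by
      obtain ⟨S, hS, rfl⟩ := List.mem_map.1 (hl'.subset hT)
      exact ⟨S, hsub S hS, rfl⟩
    rw [condition1Loop, heq]
    cases hf : ((sch.subsets σ ((σ.mb X).filter (· ∉ e)).powerset).map (insert X)).find?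
        fun S => ci (e, S) with
    | some S =>
      refine ⟨σ.skipCond1, _, rfl, by simp, fun _ => ⟨hfail, fun hc => ?_⟩⟩
      obtain ⟨S, hS, rfl⟩ := List.mem_map.1 (List.mem_of_find?_eq_some hf)
      have hci := List.find?_some hf
      replace hS := hsub S hS
      induction e with
      | _ Y Z =>
        rw [mk_mem_unorderedPairs, DAG.mem_nbrs, DAG.mem_nbrs] at he
        have := hc Y he.1.1 Z he.2.1.1 he.1.2 he.2.1.2 he.2.2 S
          (fun v hv => (Finset.mem_filter.1 (hS hv)).1)
          (fun hY => (Finset.mem_filter.1 (hS hY)).2 (Sym2.mem_mk_left _ _))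
          (fun hZ => (Finset.mem_filter.1 (hS hZ)).2 (Sym2.mem_mk_right _ _))
        simp [this] at hci
    | none =>
      rw [List.find?_eq_none] at hf
      have hci : ∀ S ⊆ (σ.mb X).filter (· ∉ e), ci (e, insert X S) = false := by
        intro S hS
        simpa using hf _ (List.mem_map_of_mem ((sch.mem_subsets σ).2 (Finset.mem_powerset.2 hS)))
      have hndl := List.nodup_cons.1 hl
      obtain ⟨s, L, h1, h2, h3⟩ := ih (hpass hci) hX hXd hndl.2 fun e' he' =>
        ⟨(hle e' (List.mem_cons_of_mem _ he')).1, by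
          rw [Finset.mem_insert, not_or]
          refine ⟨fun h => hndl.1 ?_, (hle e' (List.mem_cons_of_mem _ he')).2⟩
          rw [Prod.mk.injEq] at h
          exact h.2 ▸ he'⟩
      refine ⟨s, L, h1, fun hb => ?_, h3⟩
      obtain ⟨hI, hss, hall⟩ := h2 hb
      refine ⟨hI, (Finset.subset_insert _ _).trans hss, fun e' he' => ?_⟩
      rcases List.mem_cons.1 he' with rfl | he'
      · exact hss (Finset.mem_insert_self _ _)
      · exact hall e' he'

theorem condition1_spec (sch : Schedule V) (h : Inv G ci k σ) (hX : X ∈ σ.rem)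
    (hXd : X ∈ σ.nbrsDone) :
    ∃ s L, (condition1 ci sch X (G.nbrs X (σ.mb X)) σ).2 = { σ with skipCond1 := s, log := L } ∧
      ((condition1 ci sch X (G.nbrs X (σ.mb X)) σ).1 = true →
        Inv G ci k { σ with skipCond1 := s, log := L } ∧ G.Cond1 ci X (σ.mb X)) ∧
      ((condition1 ci sch X (G.nbrs X (σ.mb X)) σ).1 = false →
        Inv G ci (k + 1) { σ with skipCond1 := s, log := L } ∧ ¬ G.Cond1 ci X (σ.mb X)) := by
  obtain ⟨s, L, h1, h2, h3⟩ := condition1Loop_spec sch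
    (sch.pairs σ ((unorderedPairs (G.nbrs X (σ.mb X))).filter fun e => (X, e) ∉ σ.skipCond1)) h hX hXd
    (sch.nodup_pairs σ _) (fun e he => by
      rwa [sch.mem_pairs, Finset.mem_filter] at he)
  refine ⟨s, L, h1, fun hb => ?_, h3⟩
  obtain ⟨hI, hss, hall⟩ := h2 hb
  refine ⟨hI, fun Y hY Z hZ hXY hXZ hYZ S hS hYS hZS => ?_⟩
  refine hI.1.skip1 X hX Y Z ?_ S hS hYS hZS
  by_cases hd : (X, s(Y, Z)) ∈ σ.skipCond1
  · exact hss hd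
  · refine hall _ ?_
    rw [sch.mem_pairs, Finset.mem_filter, mk_mem_unorderedPairs, DAG.mem_nbrs, DAG.mem_nbrs]
    exact ⟨⟨⟨hY, hXY⟩, ⟨hZ, hXZ⟩, hYZ⟩, hd⟩

/-- Only the completeness of the recorded v-structures enters: it puts every set containing a true
common child into the search. Spurious ones merely add tests, and a failure caused by them is
harmless, because a co-parent of `X` already shows that `X` is not a sink. -/
theorem condition2Loop_spec (sch : Schedule V) (l : List (V × V)) (h : Inv G ci k σ)
    (hX : X ∈ σ.rem) (hXd : X ∈ σ.nbrsDone) (hXvs : X ∈ σ.vsDone) (hl : l.Nodup)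
    (hle : ∀ YZ ∈ l, YZ ∈ G.coparents X (σ.mb X) ×ˢ G.nbrs X (σ.mb X) ∧ (X, YZ) ∉ σ.skipCond2) :
    ∃ s L, (condition2Loop ci sch X l σ).2 = { σ with skipCond2 := s, log := L } ∧
      ((condition2Loop ci sch X l σ).1 = true →
        Inv G ci k { σ with skipCond2 := s, log := L } ∧ σ.skipCond2 ⊆ s ∧
          ∀ YZ ∈ l, (X, YZ) ∈ s) ∧
      ((condition2Loop ci sch X l σ).1 = false →
        Inv G ci (k + 1) { σ with skipCond2 := s, log := L } ∧ ¬ G.IsSink σ.rem X) := by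
  induction l generalizing σ with
  | nil =>
    exact ⟨σ.skipCond2, σ.log, rfl, fun _ => ⟨h, subset_rfl, by simp⟩, by simp [condition2Loop]⟩
  | cons YZ l ih =>
    obtain ⟨Y, Z⟩ := YZ
    set Γ := (σ.mb X).filter fun v => v ≠ Z ∧ (v, Y) ∈ σ.vs X with hΓ
    set F := (σ.mb X \ {Y, Z}).powerset.filter fun S => (S ∩ Γ).Nonempty with hF
    obtain ⟨l', hl', heq⟩ := findSep_eq ci (.condition2 X) s(Y, Z)
      ((sch.subsets σ F).map (insert X)) σ
    obtain ⟨he, hskip⟩ := hle (Y, Z) List.mem_cons_self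
    obtain ⟨hY, hZ⟩ := Finset.mem_product.1 he
    have hXmb := h.1.self_notMem_mb hX
    have hsub : ∀ S ∈ sch.subsets σ F, S ⊆ σ.mb X \ {Y, Z} := fun S hS =>
      Finset.mem_powerset.1 (Finset.mem_filter.1 ((sch.mem_subsets σ).1 hS)).1
    have hnd : l'.Nodup := List.Nodup.sublist hl'.sublist (nodup_map_insert (sch.nodup_subsets σ _)
      fun S hS hXS => hXmb (Finset.mem_sdiff.1 (hsub S hS hXS)).1)
    obtain ⟨hfail, hpass⟩ := h.cond2_block hX hXd hY hZ hskip hnd fun T hT => by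
      obtain ⟨S, hS, rfl⟩ := List.mem_map.1 (hl'.subset hT)
      exact ⟨S, hsub S hS, rfl⟩
    have hnosink : ¬ G.IsSink σ.rem X := fun hsink => by
      rw [DAG.mem_coparents, h.1.mb X hX] at hY
      exact hY.2 (.inr (hsink.edge hY.1))
    rw [condition2Loop]
    simp only [← hΓ, ← hF, heq]
    cases hf : ((sch.subsets σ F).map (insert X)).find? fun S => ci (s(Y, Z), S) with
    | some S => exact ⟨σ.skipCond2, _, rfl, by simp, fun _ => ⟨hfail, hnosink⟩⟩
    | none =>
      rw [List.find?_eq_none] at hf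
      have hci : ∀ S ⊆ σ.mb X \ {Y, Z}, (∃ v ∈ S, v ≠ Z ∧ G.edge X v ∧ G.edge Y v) →
          ci (s(Y, Z), insert X S) = false := by
        rintro S hS ⟨v, hv, hvZ, hXv, hYv⟩
        have hSF : S ∈ F := by
          rw [DAG.mem_coparents] at hY
          have hvmb := (Finset.mem_sdiff.1 (hS hv)).1
          have hsubr := h.1.mb_subset_rem hX
          exact Finset.mem_filter.2 ⟨Finset.mem_powerset.2 hS, v, Finset.mem_inter.2 ⟨hv,
            Finset.mem_filter.2 ⟨hvmb, hvZ, h.1.vs X hXvs hX Y (hsubr hY.1) v (hsubr hvmb)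
              (fun e => hXmb (e ▸ hY.1)) hY.2 hXv hYv⟩⟩⟩
        simpa using hf _ (List.mem_map_of_mem ((sch.mem_subsets σ).2 hSF))
      have hndl := List.nodup_cons.1 hl
      obtain ⟨s, L, h1, h2, h3⟩ := ih (hpass hci) hX hXd hXvs hndl.2 fun e' he' =>
        ⟨(hle e' (List.mem_cons_of_mem _ he')).1, by
          rw [Finset.mem_insert, not_or]
          refine ⟨fun h => hndl.1 ?_, (hle e' (List.mem_cons_of_mem _ he')).2⟩
          rw [Prod.mk.injEq] at h
          exact h.2 ▸ he'⟩
      refine ⟨s, L, h1, fun hb => ?_, h3⟩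
      obtain ⟨hI, hss, hall⟩ := h2 hb
      refine ⟨hI, (Finset.subset_insert _ _).trans hss, fun e' he' => ?_⟩
      rcases List.mem_cons.1 he' with rfl | he'
      · exact hss (Finset.mem_insert_self _ _)
      · exact hall e' he'

theorem condition2_spec (sch : Schedule V) (h : Inv G ci k σ) (hX : X ∈ σ.rem)
    (hXd : X ∈ σ.nbrsDone) (hXvs : X ∈ σ.vsDone) :
    ∃ s L, (condition2 ci sch X (G.nbrs X (σ.mb X)) (G.coparents X (σ.mb X)) σ).2 =
        { σ with skipCond2 := s, log := L } ∧
      ((condition2 ci sch X (G.nbrs X (σ.mb X)) (G.coparents X (σ.mb X)) σ).1 = true →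
        Inv G ci k { σ with skipCond2 := s, log := L } ∧ G.Cond2 ci X (σ.mb X)) ∧
      ((condition2 ci sch X (G.nbrs X (σ.mb X)) (G.coparents X (σ.mb X)) σ).1 = false →
        Inv G ci (k + 1) { σ with skipCond2 := s, log := L } ∧ ¬ G.IsSink σ.rem X) := by
  obtain ⟨s, L, h1, h2, h3⟩ := condition2Loop_spec sch
    (sch.couples σ ((G.coparents X (σ.mb X) ×ˢ G.nbrs X (σ.mb X)).filter
      fun YZ => (X, YZ) ∉ σ.skipCond2)) h hX hXd hXvs
    (sch.nodup_couples σ _) (fun e he => by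
      rwa [sch.mem_couples, Finset.mem_filter] at he)
  refine ⟨s, L, h1, fun hb => ?_, h3⟩
  obtain ⟨hI, hss, hall⟩ := h2 hb
  refine ⟨hI, fun Y hY Z hZ hXY hXZ S hS hYS hZS hv => ?_⟩
  refine hI.1.skip2 X hX Y Z ?_ S hS hYS hZS hv
  by_cases hd : (X, Y, Z) ∈ σ.skipCond2
  · exact hss hd
  · refine hall _ ?_
    rw [sch.mem_couples, Finset.mem_filter, Finset.mem_product, DAG.mem_nbrs, DAG.mem_coparents]
    exact ⟨⟨⟨hY, hXY⟩, ⟨hZ, hXZ⟩⟩, hd⟩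

/-! ### Neighbours and v-structures -/

/-- Adjacent variables are never separated, and `Oracle.exists_sepset` provides a set for each
co-parent, so the classification is exact. A separating set contains no common child, which would
make the test dependent; hence FindVS discards no true v-structure on account of it. -/
theorem findNeighbors_spec (sch : Schedule V) (hs : Sound G ci σ) (hX : X ∈ σ.rem) :
    ∃ f L, findNeighbors ci sch X σ = ((G.nbrs X (σ.mb X), G.coparents X (σ.mb X)),
        { σ with sepset := f, log := σ.log ++ L }) ∧
      (∀ X Y Z, G.edge X Z → G.edge Y Z → ¬ G.Adj X Y → Z ∉ f X Y) ∧ L.Nodup ∧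
      ∀ t ∈ L, t ∈ DAG.nbrTests X (σ.mb X) := by
  have hmbX := hs.mb X hX
  have hsubr := hs.mb_subset_rem hX
  have hXmb := hs.self_notMem_mb hX
  unfold findNeighbors
  have key := foldl_invariant (f := fun acc Y =>
    let ((ne, cp), σ) := acc
    match findSep ci (.findNeighbors X) s(X, Y)
        (sch.subsets σ ((σ.mb X).erase Y).ssubsets) σ with
    | (some S, σ') => ((ne, insert Y cp),
        { σ' with sepset := Function.update σ'.sepset X (Function.update (σ'.sepset X) Y S) })
    | (none, σ') => ((insert Y ne, cp), σ'))
    (fun D (b : (Finset V × Finset V) × State V) =>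
      (∀ Y, Y ∈ b.1.1 ↔ Y ∈ D ∧ G.Adj X Y) ∧ (∀ Y, Y ∈ b.1.2 ↔ Y ∈ D ∧ ¬ G.Adj X Y) ∧
      ∃ f L, b.2 = { σ with sepset := f, log := σ.log ++ L } ∧
        (∀ X Y Z, G.edge X Z → G.edge Y Z → ¬ G.Adj X Y → Z ∉ f X Y) ∧ L.Nodup ∧
        ∀ t ∈ L, ∃ Y ∈ D, ∃ S ⊆ (σ.mb X).erase Y, t = (.findNeighbors X, (s(X, Y), S)))
    (sch.vertices σ (σ.mb X)) ((∅, ∅), σ) ?_ ?_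
  · obtain ⟨h1, h2, f, L, h3, h4, h5, h6⟩ := key
    refine ⟨f, L, Prod.ext (Prod.ext ?_ ?_) h3, h4, h5, fun t ht => ?_⟩
    · ext Y; exact (h1 Y).trans (by rw [sch.mem_vertices, DAG.mem_nbrs])
    · ext Y; exact (h2 Y).trans (by rw [sch.mem_vertices, DAG.mem_coparents])
    · obtain ⟨Y, hY, S, hS, rfl⟩ := h6 t ht
      rw [sch.mem_vertices] at hY
      exact Finset.mem_biUnion.2 ⟨Y, hY, Finset.mem_image_of_mem _ (Finset.mem_powerset.2 hS)⟩
  · exact ⟨by simp, by simp, σ.sepset, [], by simp, hs.sepset, List.nodup_nil, by simp⟩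
  · rintro D Y r ⟨⟨ne, cp⟩, τ⟩ hl ⟨hne, hcp, f, L, rfl, hf, hL, hLm⟩
    have hnd := sch.nodup_vertices σ (σ.mb X)
    have hY : Y ∈ σ.mb X := by rw [← sch.mem_vertices σ, hl]; simp
    rw [hl] at hnd
    have hYD : Y ∉ D := fun h =>
      (List.nodup_append.1 hnd).2.2 Y h Y List.mem_cons_self rfl
    have hXY : X ≠ Y := fun e => hXmb (e ▸ hY)
    obtain ⟨l', hl', heq⟩ := findSep_eq ci (.findNeighbors X) s(X, Y)
      (sch.subsets { σ with sepset := f, log := σ.log ++ L } ((σ.mb X).erase Y).ssubsets)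
      { σ with sepset := f, log := σ.log ++ L }
    have hsub : ∀ S ∈ sch.subsets { σ with sepset := f, log := σ.log ++ L }
        ((σ.mb X).erase Y).ssubsets, S ⊆ (σ.mb X).erase Y := fun S hS =>
      (Finset.mem_ssubsets.1 ((sch.mem_subsets _).1 hS)).1
    have hLnew : (L ++ l'.map fun S =>
        ((.findNeighbors X, (s(X, Y), S)) : Purpose V × CITest V)).Nodup := by
      refine List.nodup_append.2 ⟨hL, ?_, ?_⟩
      · exact (List.Nodup.sublist hl'.sublist (sch.nodup_subsets _ _)).map fun S T h => by
          simpa using h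
      · rintro t ht _ ht' rfl
        obtain ⟨S, -, rfl⟩ := List.mem_map.1 ht'
        obtain ⟨Y', hY', S', -, e⟩ := hLm _ ht
        simp only [Prod.mk.injEq, Sym2.congr_right] at e
        exact hYD (e.2.1 ▸ hY')
    have hLmnew : ∀ t ∈ L ++ l'.map fun S =>
        ((.findNeighbors X, (s(X, Y), S)) : Purpose V × CITest V),
        ∃ Y' ∈ D ++ [Y], ∃ S ⊆ (σ.mb X).erase Y', t = (.findNeighbors X, (s(X, Y'), S)) := by
      intro t ht
      rcases List.mem_append.1 ht with ht | ht
      · obtain ⟨Y', hY', h⟩ := hLm t ht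
        exact ⟨Y', List.mem_append_left _ hY', h⟩
      · obtain ⟨S, hS, rfl⟩ := List.mem_map.1 ht
        exact ⟨Y, by simp, S, hsub S (hl'.subset hS), rfl⟩
    have ciadj : G.Adj X Y → ∀ S ⊆ (σ.mb X).erase Y, ci (s(X, Y), S) = false := fun ha S hS =>
      hs.oracle.of_adj hX (hsubr hY) (hS.trans ((Finset.erase_subset _ _).trans hsubr))
        (fun h => hXmb (Finset.mem_of_mem_erase (hS h))) (fun h => by simpa using hS h) ha
    simp only [heq]
    cases hfd : (sch.subsets { σ with sepset := f, log := σ.log ++ L }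
        ((σ.mb X).erase Y).ssubsets).find? fun S => ci (s(X, Y), S) with
    | none =>
      rw [List.find?_eq_none] at hfd
      have hadj : G.Adj X Y := by
        by_contra hn
        have hY' := hY
        rw [hmbX] at hY'
        obtain ⟨S, hS, hc⟩ := hs.oracle.exists_sepset hY' hn
        rw [← hmbX] at hS
        exact hfd S ((sch.mem_subsets _).2 hS) hc
      refine ⟨fun Y' => ?_, fun Y' => ?_, f, _, ?_, hf, hLnew, hLmnew⟩
      · by_cases e : Y' = Y
        · subst e; simp [hadj]
        · simp [hne, e]
      · by_cases e : Y' = Y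
        · subst e; simp [hadj, hcp]
        · simp [hcp, e]
      · simp
    | some S =>
      have hSm := hsub S (List.mem_of_find?_eq_some hfd)
      have hSc := List.find?_some hfd
      have hadj : ¬ G.Adj X Y := fun ha => by simp [ciadj ha S hSm] at hSc
      refine ⟨fun Y' => ?_, fun Y' => ?_,
        Function.update f X (Function.update (f X) Y S), _, ?_, ?_, hLnew, hLmnew⟩
      · by_cases e : Y' = Y
        · subst e; simp [hadj, hne]
        · simp [hne, e]
      · by_cases e : Y' = Y
        · subst e; simp [hadj]
        · simp [hcp, e]
      · simp
      · intro X' Y' Z hXZ hYZ hn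
        by_cases eX : X' = X
        · subst eX
          by_cases eY : Y' = Y
          · subst eY
            simp only [Function.update_self]
            intro hZ
            have := hs.oracle.of_collider hX (hsubr hY) hXY
              (hSm.trans ((Finset.erase_subset _ _).trans hsubr))
              (fun h => hXmb (Finset.mem_of_mem_erase (hSm h))) (fun h => by simpa using hSm h)
              hZ hXZ hYZ
            simp [this] at hSc
          · simpa [Function.update_of_ne eY] using hf X' Y' Z hXZ hYZ hn
        · simpa [Function.update_of_ne eX] using hf X' Y' Z hXZ hYZ hn

theorem getNeighbors_spec (sch : Schedule V) (h : Inv G ci k σ) (hX : X ∈ σ.rem)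
    (hcard : (σ.mb X).card ≤ G.maxInDegree) :
    ∃ f L E N, getNeighbors ci sch X σ = ((G.nbrs X (σ.mb X), G.coparents X (σ.mb X)),
        { σ with sepset := f, log := L, edges := E, nbrsDone := N }) ∧ X ∈ N ∧
      Inv G ci k { σ with sepset := f, log := L, edges := E, nbrsDone := N } := by
  obtain ⟨hs, M, hM⟩ := h
  have hsubr := hs.mb_subset_rem hX
  unfold getNeighbors
  by_cases hd : X ∈ σ.nbrsDone
  · refine ⟨σ.sepset, σ.log, σ.edges, σ.nbrsDone, ?_, hd, hs, M, hM⟩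
    have hne : (σ.rem.filter fun Y => s(X, Y) ∈ σ.edges) = G.nbrs X (σ.mb X) := by
      ext Y
      rw [Finset.mem_filter, DAG.mem_nbrs]
      constructor
      · rintro ⟨hY, he⟩
        have ha := hs.adj_of_edges X Y he
        exact ⟨hs.mem_mb_of_adj hX hY ha, ha⟩
      · rintro ⟨hY, ha⟩
        exact ⟨hsubr hY, hs.edges_of_adj X Y ha (.inr hd)⟩
    rw [if_neg (not_not.2 hd)]
    simp only [hne]
    refine Prod.ext (Prod.ext rfl ?_) rfl
    ext Y
    simp only [Finset.mem_sdiff, DAG.mem_nbrs, DAG.mem_coparents]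
    tauto
  · obtain ⟨f, L, heq, hf, hL, hLm⟩ := findNeighbors_spec sch hs hX
    rw [if_pos hd, heq]
    -- Here `M X` is fixed once and for all as the current boundary, whose size is bounded by
    -- `hcard`.
    refine ⟨f, _, _, _, rfl, Finset.mem_insert_self _ _, ?_, Function.update M X (σ.mb X), ?_⟩
    · refine ⟨hs.oracle, hs.mb, fun x y he => ?_, fun x y ha hx => ?_, hf, hs.vs, hs.skip1, hs.skip2,
        hs.skipVec⟩
      · rcases Finset.mem_union.1 he with he | he
        · exact hs.adj_of_edges x y he
        · obtain ⟨Y, hY, e⟩ := Finset.mem_image.1 he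
          rcases Sym2.eq_iff.1 e with ⟨rfl, rfl⟩ | ⟨rfl, rfl⟩
          · exact (DAG.mem_nbrs.1 hY).2
          · exact (DAG.mem_nbrs.1 hY).2.symm
      · rw [Finset.mem_union]
        rcases hx with hx | hx
        · exact .inl (hs.edges_of_adj x y ha (.inl hx))
        rcases Finset.mem_insert.1 hx with rfl | hx
        · by_cases hy : y ∈ σ.rem
          · exact .inr (Finset.mem_image_of_mem _ (DAG.mem_nbrs.2 ⟨hs.mem_mb_of_adj hX hy ha, ha⟩))
          -- An edge to a variable that has been removed was recorded before.
          · left; rw [Sym2.eq_swap]; exact hs.edges_of_adj y x ha.symm (.inl hy)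
        · exact .inl (hs.edges_of_adj x y ha (.inr hx))
    · have hLt : ∀ t ∈ L, t.1 = .findNeighbors X := by
        intro t ht
        have := hLm t ht
        simp only [DAG.nbrTests, Finset.mem_biUnion, Finset.mem_image] at this
        obtain ⟨_, _, _, _, rfl⟩ := this
        rfl
      have hupd : ∀ X' ∈ σ.nbrsDone, Function.update M X (σ.mb X) X' = M X' := fun X' h =>
        Function.update_of_ne (by rintro rfl; exact hd h) _ _
      have hfresh : ∀ t ∈ L, t ∉ σ.log := by
        intro t ht htL
        have h1 := hLt t ht
        rcases hM.entries t htL with h | ⟨X', hX', h⟩ | ⟨X', -, h⟩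
        · obtain ⟨e, -, rfl⟩ := Finset.mem_image.1 h
          simp at h1
        · have := DAG.fst_of_mem_testSet h
          rw [h1] at this
          simp only [Purpose.findNeighbors.injEq, reduceCtorEq, or_false] at this
          exact hd (this ▸ hX')
        · rw [h1] at h; simp at h
      refine ⟨fun X' hX' => ?_, fun X' hX' => ?_, fun X' hX' hr => ?_, fun t ht => ?_,
        fun t ht X' htX => ?_, fun X' => ?_, ?_⟩
      · rcases Finset.mem_insert.1 hX' with rfl | hX'
        · simpa using hcard
        · rw [hupd X' hX']; exact hM.card_le X' hX'
      · rcases Finset.mem_insert.1 hX' with rfl | hX'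
        · simpa using hs.self_notMem_mb hX
        · rw [hupd X' hX']; exact hM.self_notMem X' hX'
      · rcases Finset.mem_insert.1 hX' with rfl | hX'
        · simp
        · rw [hupd X' hX']; exact hM.mb_subset X' hX' hr
      · rcases List.mem_append.1 ht with ht | ht
        · refine (hM.entries t ht).imp_right (Or.imp_left ?_)
          rintro ⟨X', hX', h⟩
          exact ⟨X', Finset.mem_insert_of_mem hX', by rwa [hupd X' hX']⟩
        · refine .inr (.inl ⟨X, Finset.mem_insert_self _ _, ?_⟩)
          rw [Function.update_self]
          simp only [DAG.testSet, Finset.mem_union]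
          exact .inl (.inl (.inl (hLm t ht)))
      · rcases List.mem_append.1 ht with ht | ht
        · exact hM.vs_entries t ht X' htX
        · rw [hLt t ht] at htX; simp at htX
      · have : L.filter (fun t => t.1 = .updateMb X') = [] := by
          rw [List.filter_eq_nil_iff]
          intro t ht
          simp [hLt t ht]
        simp only [List.filter_append, this, List.append_nil]
        exact hM.update X'
      · refine hM.count.append_fresh hL hfresh fun t ht => ?_
        rw [hLt t ht]
        rintro ⟨_, h | h⟩ <;> simp at h

/-- A true v-structure survives both filters: its middle vertex is not in the separating set, and no
search separates the adjacent `Y` and `Z`. -/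
theorem findVS_spec (sch : Schedule V) (hs : Sound G ci σ) (hX : X ∈ σ.rem) :
    ∃ W L, findVS ci sch X (G.nbrs X (σ.mb X)) (G.coparents X (σ.mb X)) σ =
        { σ with vs := Function.update σ.vs X W, log := σ.log ++ L } ∧
      (∀ Y ∈ G.coparents X (σ.mb X), ∀ Z ∈ G.nbrs X (σ.mb X), G.edge X Z → G.edge Y Z →
        (Z, Y) ∈ W) ∧ L.Nodup ∧ ∀ t ∈ L, t ∈ G.vsTests X (σ.mb X) := by
  have hsubr := hs.mb_subset_rem hX
  unfold findVS
  have key := foldl_invariant (f := fun (σ : State V) (YZ : V × V) =>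
    if YZ.2 ∈ σ.sepset X YZ.1 then σ
    else
      match findSep ci (.findVS X) s(YZ.1, YZ.2)
          (sch.subsets σ (insert X (σ.mb X) \ {YZ.1, YZ.2}).powerset) σ with
      | (some _, σ') => σ'
      | (none, σ') =>
        { σ' with vs := Function.update σ'.vs X (insert (YZ.2, YZ.1) (σ'.vs X)) })
    (fun D τ => ∃ W L, τ = { σ with vs := Function.update σ.vs X W, log := σ.log ++ L } ∧
      (∀ YZ ∈ D, G.edge X YZ.2 → G.edge YZ.1 YZ.2 → (YZ.2, YZ.1) ∈ W) ∧ L.Nodup ∧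
      ∀ t ∈ L, ∃ YZ ∈ D, ∃ S ⊆ insert X (σ.mb X) \ {YZ.1, YZ.2},
        t = (.findVS X, (s(YZ.1, YZ.2), S)))
    (sch.couples { σ with vs := Function.update σ.vs X ∅ }
      (G.coparents X (σ.mb X) ×ˢ G.nbrs X (σ.mb X)))
    { σ with vs := Function.update σ.vs X ∅ } ?_ ?_
  · obtain ⟨W, L, h1, h2, h3, h4⟩ := key
    refine ⟨W, L, h1, fun Y hY Z hZ hXZ hYZ =>
      h2 (Y, Z) ((sch.mem_couples _).2 (Finset.mk_mem_product hY hZ)) hXZ hYZ, h3, fun t ht => ?_⟩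
    obtain ⟨YZ, hYZ, S, hS, rfl⟩ := h4 t ht
    rw [sch.mem_couples] at hYZ
    exact Finset.mem_biUnion.2 ⟨YZ, hYZ, Finset.mem_image_of_mem _ (Finset.mem_powerset.2 hS)⟩
  · exact ⟨∅, [], by simp, by simp, List.nodup_nil, by simp⟩
  · rintro D ⟨Y, Z⟩ r τ hl ⟨W, L, rfl, hW, hL, hLm⟩
    have hmem : ∀ YZ ∈ D ++ (Y, Z) :: r, YZ.1 ∈ G.coparents X (σ.mb X) ∧
        YZ.2 ∈ G.nbrs X (σ.mb X) := by
      intro YZ h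
      rw [← hl, sch.mem_couples, Finset.mem_product] at h
      exact h
    have hnd := sch.nodup_couples { σ with vs := Function.update σ.vs X ∅ }
      (G.coparents X (σ.mb X) ×ˢ G.nbrs X (σ.mb X))
    rw [hl] at hnd
    have hD : (Y, Z) ∉ D := fun h =>
      (List.nodup_append.1 hnd).2.2 _ h _ List.mem_cons_self rfl
    obtain ⟨hY, hZ⟩ := hmem (Y, Z) (by simp)
    rw [DAG.mem_coparents] at hY
    rw [DAG.mem_nbrs] at hZ
    have hYZ : Y ≠ Z := by rintro rfl; exact hY.2 hZ.2
    by_cases hsep : Z ∈ σ.sepset X Y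
    · refine ⟨W, L, by simp [hsep], fun YZ h hXZ hYZ => ?_, hL, fun t ht => ?_⟩
      · rcases List.mem_append.1 h with h | h
        · exact hW YZ h hXZ hYZ
        · rw [List.mem_singleton] at h
          subst h
          exact absurd hsep (hs.sepset X Y Z hXZ hYZ hY.2)
      · obtain ⟨YZ, h, h'⟩ := hLm t ht
        exact ⟨YZ, List.mem_append_left _ h, h'⟩
    · obtain ⟨l', hl', heq⟩ := findSep_eq ci (.findVS X) s(Y, Z)
        (sch.subsets { σ with vs := Function.update σ.vs X W, log := σ.log ++ L }
          (insert X (σ.mb X) \ {Y, Z}).powerset)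
        { σ with vs := Function.update σ.vs X W, log := σ.log ++ L }
      have hsub : ∀ S ∈ sch.subsets { σ with vs := Function.update σ.vs X W, log := σ.log ++ L }
          (insert X (σ.mb X) \ {Y, Z}).powerset, S ⊆ insert X (σ.mb X) \ {Y, Z} := fun S hS =>
        Finset.mem_powerset.1 ((sch.mem_subsets _).1 hS)
      have hLnew : (L ++ l'.map fun S =>
          ((.findVS X, (s(Y, Z), S)) : Purpose V × CITest V)).Nodup := by
        refine List.nodup_append.2 ⟨hL, ?_, ?_⟩
        · exact (List.Nodup.sublist hl'.sublist (sch.nodup_subsets _ _)).map fun S T h => by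
            simpa using h
        · rintro t ht _ ht' rfl
          obtain ⟨S, -, rfl⟩ := List.mem_map.1 ht'
          obtain ⟨⟨Y', Z'⟩, hYZ', S', -, e⟩ := hLm _ ht
          simp only [Prod.mk.injEq, Sym2.eq_iff] at e
          rcases e.2.1 with ⟨rfl, rfl⟩ | ⟨rfl, rfl⟩
          · exact hD hYZ'
          -- The same pair cannot occur in both orders, as one of its elements is a neighbour of `X`
          -- and the other is not.
          · exact hY.2 (DAG.mem_nbrs.1 (hmem _ (List.mem_append_left _ hYZ')).2).2
      have hLmnew : ∀ t ∈ L ++ l'.map fun S =>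
          ((.findVS X, (s(Y, Z), S)) : Purpose V × CITest V),
          ∃ YZ ∈ D ++ [(Y, Z)], ∃ S ⊆ insert X (σ.mb X) \ {YZ.1, YZ.2},
            t = (.findVS X, (s(YZ.1, YZ.2), S)) := by
        intro t ht
        rcases List.mem_append.1 ht with ht | ht
        · obtain ⟨YZ, h, h'⟩ := hLm t ht
          exact ⟨YZ, List.mem_append_left _ h, h'⟩
        · obtain ⟨S, hS, rfl⟩ := List.mem_map.1 ht
          exact ⟨(Y, Z), by simp, S, hsub S (hl'.subset hS), rfl⟩
      simp only [if_neg hsep, heq]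
      cases hfd : (sch.subsets { σ with vs := Function.update σ.vs X W, log := σ.log ++ L }
          (insert X (σ.mb X) \ {Y, Z}).powerset).find? fun S => ci (s(Y, Z), S) with
      | none =>
        refine ⟨insert (Z, Y) W, _, ?_, fun YZ h hXZ hYZ => ?_, hLnew, hLmnew⟩
        · simp
        · rcases List.mem_append.1 h with h | h
          · exact Finset.mem_insert_of_mem (hW YZ h hXZ hYZ)
          · rw [List.mem_singleton] at h
            subst h
            exact Finset.mem_insert_self _ _
      | some S =>
        refine ⟨W, _, ?_, fun YZ h hXZ hYZ' => ?_, hLnew, hLmnew⟩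
        · simp
        · rcases List.mem_append.1 h with h | h
          · exact hW YZ h hXZ hYZ'
          · rw [List.mem_singleton] at h
            subst h
            have hS := hsub S (List.mem_of_find?_eq_some hfd)
            have hSc := List.find?_some hfd
            have := hs.oracle.of_adj (S := S) (hsubr hY.1) (hsubr hZ.1)
              (hS.trans (Finset.sdiff_subset.trans (Finset.insert_subset hX hsubr)))
              (fun h => by simpa using hS h) (fun h => by simpa using hS h) (.inl hYZ')
            simp [this] at hSc

theorem getVS_spec (sch : Schedule V) (h : Inv G ci k σ) (hX : X ∈ σ.rem) (hXd : X ∈ σ.nbrsDone) :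
    ∃ W L N, getVS ci sch X (G.nbrs X (σ.mb X)) (G.coparents X (σ.mb X)) σ =
        { σ with vs := W, log := L, vsDone := N } ∧ X ∈ N ∧
      Inv G ci k { σ with vs := W, log := L, vsDone := N } := by
  obtain ⟨hs, M, hM⟩ := h
  unfold getVS
  by_cases hd : X ∈ σ.vsDone
  · refine ⟨_, _, _, if_neg (not_not.2 hd), hd, ?_, M, ⟨hM.card_le, hM.self_notMem, hM.mb_subset,
      hM.entries, hM.vs_entries, hM.update, hM.count⟩⟩
    refine ⟨hs.oracle, hs.mb, hs.adj_of_edges, hs.edges_of_adj, hs.sepset, ?_, hs.skip1, hs.skip2,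
      hs.skipVec⟩
    intro X' hX' hr Y hY Z hZ hne hn e1 e2
    have := hs.vs X' hX' hr Y hY Z hZ hne hn e1 e2
    by_cases e : X' = X
    · subst e
      simpa using ⟨this, hZ, hY⟩
    · simpa [Function.update_of_ne e] using this
  · obtain ⟨W, L, heq, hW, hL, hLm⟩ := findVS_spec sch hs hX
    rw [if_pos hd, heq]
    refine ⟨_, _, _, rfl, Finset.mem_insert_self _ _, ?_, M, ?_⟩
    · refine ⟨hs.oracle, hs.mb, hs.adj_of_edges, hs.edges_of_adj, hs.sepset, ?_, hs.skip1, hs.skip2,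
        hs.skipVec⟩
      intro X' hX' hr Y hY Z hZ hne hn e1 e2
      by_cases e : X' = X
      · subst e
        simp only [Function.update_self]
        refine hW Y (DAG.mem_coparents.2 ⟨?_, hn⟩) Z
          (DAG.mem_nbrs.2 ⟨hs.mem_mb_of_adj hX hZ (.inl e1), .inl e1⟩) e1 e2
        rw [hs.mb X' hX]
        exact DAG.mem_mbSet_iff.2 ⟨hne, hX, hY, .inr ⟨Z, hZ, e1, e2⟩⟩
      · simp only [Function.update_of_ne e]
        exact hs.vs X' ((Finset.mem_insert.1 hX').resolve_left e) hr Y hY Z hZ hne hn e1 e2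
    · have hLt : ∀ t ∈ L, t.1 = .findVS X := by
        intro t ht
        have := hLm t ht
        simp only [DAG.vsTests, Finset.mem_biUnion, Finset.mem_image] at this
        obtain ⟨_, _, _, _, rfl⟩ := this
        rfl
      refine ⟨hM.card_le, hM.self_notMem, hM.mb_subset, fun t ht => ?_, fun t ht X' htX => ?_,
        fun X' => ?_, ?_⟩
      · rcases List.mem_append.1 ht with ht | ht
        · exact hM.entries t ht
        · refine .inr (.inl ⟨X, hXd, DAG.testSet_mono (hM.mb_subset X hXd hX) ?_⟩)
          simp only [DAG.testSet, Finset.mem_union]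
          exact .inl (.inr (hLm t ht))
      · rcases List.mem_append.1 ht with ht | ht
        · exact Finset.mem_insert_of_mem (hM.vs_entries t ht X' htX)
        · rw [hLt t ht, Purpose.findVS.injEq] at htX
          exact htX ▸ Finset.mem_insert_self _ _
      · have : L.filter (fun t => t.1 = .updateMb X') = [] := by
          rw [List.filter_eq_nil_iff]
          intro t ht
          simp [hLt t ht]
        simp only [List.filter_append, this, List.append_nil]
        exact hM.update X'
      · refine hM.count.append_fresh hL (fun t ht htL => hd (hM.vs_entries t htL X (hLt t ht)))
          fun t ht => ?_
        rw [hLt t ht]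
        rintro ⟨_, h | h⟩ <;> simp at h

/-! ### Updates of the Markov boundaries -/

/-- During the loop each recorded boundary lies between the true new one and the old one without
`X`, and it is correct on the pairs already processed. -/
theorem updateMb_loop (sch : Schedule V) (hs : Sound G ci σ) (hX : X ∈ σ.rem)
    (ho : G.Oracle ci (σ.rem.erase X)) :
    ∃ m sv L, updateMb ci sch X (G.nbrs X (σ.mb X)) { σ with rem := σ.rem.erase X } =
        { σ with rem := σ.rem.erase X, mb := m, skipVec := sv, log := σ.log ++ L } ∧
      (∀ v ∈ σ.rem.erase X, G.mbSet (σ.rem.erase X) v ⊆ m v ∧ m v ⊆ (σ.mb v).erase X) ∧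
      (∀ a ∈ σ.rem.erase X, ∀ b ∈ σ.rem.erase X, s(a, b) ∈ unorderedPairs (G.nbrs X (σ.mb X)) →
        b ∈ m a → b ∈ G.mbSet (σ.rem.erase X) a) ∧
      sv ⊆ σ.skipVec \ σ.mb X ∧ L.Nodup ∧ (∀ t ∈ L, t.1 = .updateMb X) ∧
      L.length = (unorderedPairs (G.nbrs X (σ.mb X))).card := by
  have hsubr := hs.mb_subset_rem hX
  have hXmb := hs.self_notMem_mb hX
  set R := σ.rem.erase X with hR
  set pr := unorderedPairs (G.nbrs X (σ.mb X)) with hpr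
  let σ₀ : State V := { σ with
    rem := R
    mb := fun Y => if Y ∈ σ.mb X then (σ.mb Y).erase X else σ.mb Y
    skipVec := σ.skipVec \ σ.mb X }
  have key := foldl_invariant (f := fun (τ : State V) (e : Sym2 V) =>
    let o := sch.orient τ e
    let (Y, Z) := if (σ.mb o.1).card ≤ (σ.mb o.2).card then o else (o.2, o.1)
    let (b, τ') := performTest ci (.updateMb X) (e, τ.mb Y \ {Y, Z}) τ
    if b then
      { τ' with
        mb := fun v => if v = Y then (τ'.mb v).erase Z else if v = Z then (τ'.mb v).erase Y
          else τ'.mb v,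
        skipVec := τ'.skipVec \ {Y, Z} }
    else τ')
    (fun D τ => ∃ m sv L, τ = { σ with rem := R, mb := m, skipVec := sv, log := σ.log ++ L } ∧
      (∀ v ∈ R, G.mbSet R v ⊆ m v ∧ m v ⊆ (σ.mb v).erase X) ∧
      (∀ a ∈ R, ∀ b ∈ R, s(a, b) ∈ D → b ∈ m a → b ∈ G.mbSet R a) ∧
      sv ⊆ σ.skipVec \ σ.mb X ∧ L.Nodup ∧ (∀ t ∈ L, t.1 = .updateMb X ∧ t.2.1 ∈ D) ∧
      L.length = D.length)
    (sch.pairs σ₀ pr) σ₀ ?_ ?_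
  · obtain ⟨m, sv, L, h1, h2, h3, h4, h5, h6, h7⟩ := key
    exact ⟨m, sv, L, h1, h2, fun a ha b hb hab => h3 a ha b hb ((sch.mem_pairs _).2 hab), h4, h5,
      fun t ht => (h6 t ht).1, h7.trans (sch.length_pairs _ _)⟩
  · refine ⟨σ₀.mb, _, [], ?_, ?_, ?_, subset_rfl, List.nodup_nil, by simp, rfl⟩
    · simp only [σ₀, List.append_nil]
    · intro v hv
      have hv' := Finset.mem_erase.1 hv
      have hmbv := hs.mb v hv'.2
      have hXv : X ∉ G.mbSet R v := fun h => by
        simpa [hR] using DAG.mbSet_subset v h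
      have hsub : G.mbSet R v ⊆ (σ.mb v).erase X := fun w hw => by
        rw [hmbv]
        exact Finset.mem_erase.2 ⟨fun e => hXv (e ▸ hw), DAG.mbSet_mono (Finset.erase_subset _ _) v hw⟩
      by_cases h : v ∈ σ.mb X
      · simp only [σ₀, h, if_true]; exact ⟨hsub, subset_rfl⟩
      · simp only [σ₀, h, if_false]
        refine ⟨hsub.trans (Finset.erase_subset _ _), ?_⟩
        rw [Finset.erase_eq_of_notMem]
        rw [hmbv, DAG.mem_mbSet_comm, ← hs.mb X hX]
        exact h
    · simp
  · rintro D e r τ hl ⟨m, sv, L, rfl, hm, hD, hsv, hL, hLm, hlen⟩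
    have hnd := sch.nodup_pairs σ₀ pr
    have he : e ∈ pr := by rw [← sch.mem_pairs σ₀, hl]; simp
    rw [hl] at hnd
    have heD : e ∉ D := fun h => (List.nodup_append.1 hnd).2.2 _ h _ List.mem_cons_self rfl
    dsimp only
    have hoe := sch.orient_spec { σ with rem := R, mb := m, skipVec := sv, log := σ.log ++ L } e
    generalize sch.orient { σ with rem := R, mb := m, skipVec := sv, log := σ.log ++ L } e = o at *
    obtain ⟨Y, Z, hYZ, hYZe⟩ : ∃ Y Z,
        (if (σ.mb o.1).card ≤ (σ.mb o.2).card then o else (o.2, o.1)) = (Y, Z) ∧ s(Y, Z) = e := by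
      split_ifs
      · exact ⟨o.1, o.2, rfl, hoe⟩
      · exact ⟨o.2, o.1, rfl, by rw [Sym2.eq_swap, hoe]⟩
    subst hYZe
    simp only [hYZ, performTest]
    rw [hpr, mk_mem_unorderedPairs, DAG.mem_nbrs, DAG.mem_nbrs] at he
    obtain ⟨⟨hY, -⟩, ⟨hZ, -⟩, hne⟩ := he
    have hYR : Y ∈ R := Finset.mem_erase.2 ⟨fun e => hXmb (e ▸ hY), hsubr hY⟩
    have hZR : Z ∈ R := Finset.mem_erase.2 ⟨fun e => hXmb (e ▸ hZ), hsubr hZ⟩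
    have hmR : m Y ⊆ R := fun w hw => by
      have hw' := Finset.mem_erase.1 ((hm Y hYR).2 hw)
      exact Finset.mem_erase.2 ⟨hw'.1, hs.mb_subset_rem (Finset.mem_erase.1 hYR).2 hw'.2⟩
    -- The test is exact for any conditioning set containing the rest of the true boundary of `Y`;
    -- so neither the incomplete update nor the choice of the smaller boundary affects the outcome.
    have htest := ho.mb_test (S := m Y \ {Y, Z}) hYR hZR hne (Finset.sdiff_subset.trans hmR)
      (by simp) (by simp) fun v hv hvZ => Finset.mem_sdiff.2 ⟨(hm Y hYR).1 hv, by
        simp only [Finset.mem_insert, Finset.mem_singleton, not_or]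
        exact ⟨fun e => DAG.self_notMem_mbSet Y (e ▸ hv), hvZ⟩⟩
    have hLnew : (L ++ [((.updateMb X, (s(Y, Z), m Y \ {Y, Z})) : Purpose V × CITest V)]).Nodup := by
      refine List.nodup_append.2 ⟨hL, by simp, ?_⟩
      rintro t ht t' ht' rfl
      rw [List.mem_singleton] at ht'
      subst ht'
      exact heD (hLm _ ht).2
    have hLmnew : ∀ t ∈ L ++ [((.updateMb X, (s(Y, Z), m Y \ {Y, Z})) : Purpose V × CITest V)],
        t.1 = .updateMb X ∧ t.2.1 ∈ D ++ [s(Y, Z)] := by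
      intro t ht
      rcases List.mem_append.1 ht with ht | ht
      · exact ⟨(hLm t ht).1, List.mem_append_left _ (hLm t ht).2⟩
      · rw [List.mem_singleton] at ht; subst ht; simp
    have hlennew : (L ++ [((.updateMb X, (s(Y, Z), m Y \ {Y, Z})) : Purpose V × CITest V)]).length =
        (D ++ [s(Y, Z)]).length := by simp [hlen]
    by_cases hc : ci (s(Y, Z), m Y \ {Y, Z}) = true
    · have hZY : Z ∉ G.mbSet R Y := fun h => by simp [htest.2 h] at hc
      have hYZ' : Y ∉ G.mbSet R Z := fun h => hZY (DAG.mem_mbSet_comm.1 h)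
      rw [if_pos hc]
      refine ⟨fun v => if v = Y then (m v).erase Z else if v = Z then (m v).erase Y else m v,
        sv \ {Y, Z}, _, by simp, fun v hv => ?_, fun a ha b hb hab hbm => ?_,
        Finset.sdiff_subset.trans hsv, hLnew, hLmnew, hlennew⟩
      · dsimp only
        split_ifs with h1 h2
        · subst h1
          exact ⟨fun w hw => Finset.mem_erase.2 ⟨fun e => hZY (e ▸ hw), (hm v hv).1 hw⟩,
            (Finset.erase_subset _ _).trans (hm v hv).2⟩
        · subst h2
          exact ⟨fun w hw => Finset.mem_erase.2 ⟨fun e => hYZ' (e ▸ hw), (hm v hv).1 hw⟩,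
            (Finset.erase_subset _ _).trans (hm v hv).2⟩
        · exact hm v hv
      · rcases List.mem_append.1 hab with hab | hab
        · refine hD a ha b hb hab ?_
          dsimp only at hbm
          split_ifs at hbm
          · exact Finset.mem_of_mem_erase hbm
          · exact Finset.mem_of_mem_erase hbm
          · exact hbm
        · rw [List.mem_singleton, Sym2.eq_iff] at hab
          rcases hab with ⟨rfl, rfl⟩ | ⟨rfl, rfl⟩
          · simp at hbm
          · simp [hne.symm] at hbm
    · rw [if_neg hc]
      refine ⟨m, sv, _, by simp, hm, fun a ha b hb hab hbm => ?_, hsv, hLnew, hLmnew, hlennew⟩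
      rcases List.mem_append.1 hab with hab | hab
      · exact hD a ha b hb hab hbm
      · have hZY := htest.1 (by simpa using hc)
        rw [List.mem_singleton, Sym2.eq_iff] at hab
        rcases hab with ⟨rfl, rfl⟩ | ⟨rfl, rfl⟩
        · exact hZY
        · exact DAG.mem_mbSet_comm.1 hZY

theorem updateMb_spec (sch : Schedule V) (h : Inv G ci k σ) (hX : X ∈ σ.rem) (hXd : X ∈ σ.nbrsDone)
    (hrem : (G.restrict σ.rem).Removable X) :
    Inv G ci k (updateMb ci sch X (G.nbrs X (σ.mb X)) { σ with rem := σ.rem.erase X }) ∧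
    (updateMb ci sch X (G.nbrs X (σ.mb X)) { σ with rem := σ.rem.erase X }).rem =
      σ.rem.erase X := by
  obtain ⟨hs, M, hM⟩ := h
  have ho := hs.oracle.erase hrem
  obtain ⟨m, sv, L, heq, hm, hpr, hsv, hL, hLt, hlen⟩ := updateMb_loop sch hs hX ho
  rw [heq]
  refine ⟨⟨?_, M, ?_⟩, rfl⟩
  · have hsubm : ∀ v ∈ σ.rem.erase X, m v ⊆ σ.mb v := fun v hv =>
      (hm v hv).2.trans (Finset.erase_subset _ _)
    refine ⟨ho, fun v hv => ?_, hs.adj_of_edges, fun x y ha hx => ?_, hs.sepset, ?_, ?_, ?_, ?_⟩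
    · refine Finset.Subset.antisymm (fun w hw => ?_) (hm v hv).1
      by_contra hn
      have hw' := Finset.mem_erase.1 ((hm v hv).2 hw)
      have hv' := Finset.mem_erase.1 hv
      have hwv := hw'.2
      rw [hs.mb v hv'.2] at hwv
      obtain ⟨-, e1, e2⟩ := DAG.edges_of_notMem_mbSet_erase hwv hv'.1 hw'.1 hn
      have hwR := DAG.mbSet_subset v hwv
      refine hn (hpr v hv w (Finset.mem_erase.2 ⟨hw'.1, hwR⟩) ?_ hw)
      rw [mk_mem_unorderedPairs, DAG.mem_nbrs, DAG.mem_nbrs]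
      exact ⟨⟨hs.mem_mb_of_adj hX hv'.2 (.inr e1), .inr e1⟩,
        ⟨hs.mem_mb_of_adj hX hwR (.inr e2), .inr e2⟩, (DAG.mem_mbSet_iff.1 hwv).1⟩
    · refine hs.edges_of_adj x y ha ?_
      rcases hx with hx | hx
      · by_cases e : x = X
        · subst e; exact .inr hXd
        · exact .inl fun h => hx (Finset.mem_erase.2 ⟨e, h⟩)
      · exact .inr hx
    · intro X' hX' hr Y hY Z hZ
      exact hs.vs X' hX' (Finset.mem_of_mem_erase hr) Y (Finset.mem_of_mem_erase hY) Z
        (Finset.mem_of_mem_erase hZ)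
    · intro X' hX' Y Z hYZ S hS
      exact hs.skip1 X' (Finset.mem_of_mem_erase hX') Y Z hYZ S (hS.trans (hsubm X' hX'))
    · intro X' hX' Y Z hYZ S hS
      exact hs.skip2 X' (Finset.mem_of_mem_erase hX') Y Z hYZ S (hS.trans (hsubm X' hX'))
    · intro X' hX' hskip hsink
      have hX'' := Finset.mem_erase.1 hX'
      have hsk := Finset.mem_sdiff.1 (hsv hskip)
      refine hs.skipVec X' hX''.2 hsk.1 fun w hw e => ?_
      -- A variable that becomes a sink by the removal was a parent of `X`, hence in its boundary,
      -- so its flag has been reset.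
      by_cases hwX : w = X
      · subst hwX
        exact hsk.2 (hs.mem_mb_of_adj hX hX''.2 (.inr e))
      · exact hsink w (Finset.mem_erase.2 ⟨hwX, hw⟩) e
  · have hfresh : ∀ t ∈ σ.log, t.1 ≠ .updateMb X := by
      intro t ht h1
      rcases hM.entries t ht with h | ⟨X', hX', h⟩ | ⟨X', hX', h⟩
      · obtain ⟨e, -, rfl⟩ := Finset.mem_image.1 h
        simp at h1
      · have := DAG.fst_of_mem_testSet h
        rw [h1] at this
        simp at this
      · rw [h1, Purpose.updateMb.injEq] at h
        exact hX' (h ▸ hX)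
    refine ⟨hM.card_le, hM.self_notMem, fun X' hX' hr => ?_, fun t ht => ?_, fun t ht X' htX => ?_,
      fun X' => ?_, ?_⟩
    · exact ((hm X' hr).2.trans (Finset.erase_subset _ _)).trans
        (hM.mb_subset X' hX' (Finset.mem_of_mem_erase hr))
    · rcases List.mem_append.1 ht with ht | ht
      · refine (hM.entries t ht).imp_right (Or.imp_right ?_)
        rintro ⟨X', hX', h⟩
        exact ⟨X', fun h => hX' (Finset.mem_of_mem_erase h), h⟩
      · exact .inr (.inr ⟨X, by simp, hLt t ht⟩)
    · rcases List.mem_append.1 ht with ht | ht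
      · exact hM.vs_entries t ht X' htX
      · rw [hLt t ht] at htX; simp at htX
    · simp only [List.filter_append, List.length_append]
      by_cases e : X' = X
      · subst e
        have : σ.log.filter (fun t => t.1 = .updateMb X') = [] := by
          rw [List.filter_eq_nil_iff]
          intro t ht
          simpa using hfresh t ht
        rw [this, List.length_nil, zero_add]
        refine (List.length_filter_le _ _).trans ?_
        rw [hlen, card_unorderedPairs]
        refine Nat.choose_le_choose 2 ((Finset.card_le_card fun Y hY => ?_).trans
          (hM.card_le X' hXd))
        exact hM.mb_subset X' hXd hX (DAG.mem_nbrs.1 hY).1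
      · have : L.filter (fun t => t.1 = .updateMb X') = [] := by
          rw [List.filter_eq_nil_iff]
          intro t ht
          simpa [hLt t ht] using Ne.symm e
        rw [this, List.length_nil, add_zero]
        exact hM.update X'
    · refine hM.count.append_fresh hL (fun t ht htL => hfresh t htL (hLt t ht)) fun t ht => ?_
      rw [hLt t ht]
      rintro ⟨_, h | h⟩ <;> simp at h

theorem computeMb_spec (sch : Schedule V) (ho : G.Oracle ci Finset.univ) :
    Inv G ci 0 (computeMb ci sch initialState) ∧
      (computeMb ci sch initialState).rem = Finset.univ := by
  let T : Sym2 V → Purpose V × CITest V := fun e =>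
    (.computeMb, (e, Finset.univ.filter (· ∉ e)))
  have key := foldl_invariant (f := fun (σ : State V) (e : Sym2 V) =>
    let (b, σ') := performTest ci .computeMb (e, Finset.univ.filter (· ∉ e)) σ
    if b then σ'
    else { σ' with mb := fun v => σ'.mb v ∪ Finset.univ.filter (fun w => s(v, w) = e) })
    (fun D τ => ∃ m, τ = { (initialState : State V) with mb := m, log := D.map T } ∧
      ∀ v w, w ∈ m v ↔ s(v, w) ∈ D ∧ ci (T s(v, w)).2 = false)
    (sch.pairs initialState (unorderedPairs Finset.univ)) initialState ?_ ?_
  · obtain ⟨m, h1, h2⟩ := key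
    rw [show computeMb ci sch initialState = _ from h1]
    refine ⟨⟨⟨ho, fun v _ => ?_, ?_, ?_, ?_, ?_, ?_, ?_, ?_⟩, fun _ => ∅, ⟨?_, ?_, ?_, ?_, ?_, ?_, ?_⟩⟩,
      rfl⟩
    · ext w
      rw [h2, sch.mem_pairs, mk_mem_unorderedPairs]
      have test : v ≠ w → (ci (T s(v, w)).2 = false ↔ w ∈ G.mbSet Finset.univ v) := fun hvw =>
        ho.mb_test (Finset.mem_univ _) (Finset.mem_univ _) hvw (Finset.subset_univ _) (by simp)
          (by simp) fun u hu huw => by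
            simpa [huw] using fun e : u = v => DAG.self_notMem_mbSet v (e ▸ hu)
      constructor
      · rintro ⟨⟨-, -, hvw⟩, h⟩; exact (test hvw).1 h
      · intro h
        have hvw := (DAG.mem_mbSet_iff.1 h).1
        exact ⟨⟨Finset.mem_univ _, Finset.mem_univ _, hvw⟩, (test hvw).2 h⟩
    · intro x y h; simp [initialState] at h
    · intro x y _ h; simp [initialState] at h
    · intro X Y Z _ _ _; simp [initialState]
    · intro X h; simp [initialState] at h
    · intro X _ Y Z h; simp [initialState] at h
    · intro X _ Y Z h; simp [initialState] at h
    · intro X _ h; simp [initialState] at h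
    · intro X h; simp [initialState] at h
    · intro X h; simp [initialState] at h
    · intro X h; simp [initialState] at h
    · intro t ht
      obtain ⟨e, he, rfl⟩ := List.mem_map.1 ht
      exact .inl (Finset.mem_image_of_mem _ ((sch.mem_pairs _).1 he))
    · intro t ht X h
      obtain ⟨e, he, rfl⟩ := List.mem_map.1 ht
      simp [T] at h
    · intro X
      have : ((sch.pairs initialState (unorderedPairs Finset.univ)).map T).filter
          (fun t => t.1 = .updateMb X) = [] := by
        rw [List.filter_eq_nil_iff]
        intro t ht
        obtain ⟨e, he, rfl⟩ := List.mem_map.1 ht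
        simp [T]
      simp only [this, List.length_nil, Nat.zero_le]
    · refine ⟨∅, fun t ht hc => ?_, ?_⟩
      · obtain ⟨e, he, rfl⟩ := List.mem_map.1 ht
        obtain ⟨_, h | h⟩ := hc <;> simp [T] at h
      · have : ((sch.pairs initialState (unorderedPairs Finset.univ)).map T).Nodup :=
          (sch.nodup_pairs _ _).map fun e e' h => by
            simp only [T, Prod.mk.injEq] at h; exact h.2.1
        rw [List.toFinset_card_of_nodup this]
        simp
  · exact ⟨_, by simp; rfl, by simp⟩
  · rintro D e r τ hl ⟨m, rfl, hm⟩
    by_cases hc : ci (e, Finset.univ.filter (· ∉ e)) = true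
    · refine ⟨m, by simp [performTest, hc, T], fun v w => ?_⟩
      rw [hm, List.mem_append, List.mem_singleton]
      constructor
      · rintro ⟨h1, h2⟩; exact ⟨.inl h1, h2⟩
      · rintro ⟨h1 | rfl, h2⟩
        · exact ⟨h1, h2⟩
        · exact absurd (hc.symm.trans h2) (by simp)
    · refine ⟨fun v => m v ∪ Finset.univ.filter (fun w => s(v, w) = e),
        by simp [performTest, hc, T], fun v w => ?_⟩
      simp only [Finset.mem_union, hm, Finset.mem_filter, Finset.mem_univ, true_and, List.mem_append,
        List.mem_singleton]
      constructor
      · rintro (⟨h1, h2⟩ | rfl)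
        · exact ⟨.inl h1, h2⟩
        · exact ⟨.inr rfl, by simpa [T] using hc⟩
      · rintro ⟨h1 | h1, h2⟩
        · exact .inl ⟨h1, h2⟩
        · exact .inr h1

/-! ### The main loop -/

theorem Inv.mono {k' : ℕ} (h : Inv G ci k σ) (hk : k ≤ k') : Inv G ci k' σ := by
  obtain ⟨hs, M, hM⟩ := h
  refine ⟨hs, M, hM.card_le, hM.self_notMem, hM.mb_subset, hM.entries, hM.vs_entries, hM.update, ?_⟩
  have := hM.count
  induction hk with
  | refl => exact this
  | step _ ih => exact ih.succ

theorem Inv.skip (h : Inv G ci k σ) (hX : ¬ G.IsSink σ.rem X) :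
    Inv G ci k { σ with skipVec := insert X σ.skipVec } := by
  obtain ⟨hs, M, hM⟩ := h
  refine ⟨⟨hs.oracle, hs.mb, hs.adj_of_edges, hs.edges_of_adj, hs.sepset, hs.vs, hs.skip1, hs.skip2,
    fun X' hX' h => ?_⟩, M, hM.card_le, hM.self_notMem, hM.mb_subset, hM.entries, hM.vs_entries,
    hM.update, hM.count⟩
  rcases Finset.mem_insert.1 h with rfl | h
  · exact hX
  · exact hs.skipVec X' hX' h

/-- A variable on which a condition fails is not a sink, so the sink `s` stays ahead in the list and
the loop cannot run out. Each list element accounts for at most one failure. -/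
theorem removeFirst_spec (sch : Schedule V) (l : List V) (h : Inv G ci k σ)
    (hl : ∀ X ∈ l, X ∈ σ.rem) {s : V} (hs : s ∈ l) (hsink : G.IsSink σ.rem s)
    (hsort : l.Pairwise fun X Y => (σ.mb X).card ≤ (σ.mb Y).card) :
    Inv G ci (k + l.length) (removeFirst ci sch l σ) ∧
      ∃ X ∈ σ.rem, (removeFirst ci sch l σ).rem = σ.rem.erase X := by
  induction l generalizing σ k with
  | nil => simp at hs
  | cons X l ih =>
    have hX := hl X List.mem_cons_self
    have hsort' := List.pairwise_cons.1 hsort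
    -- The head of the sorted list has a boundary no larger than that of the sink.
    have hcard : (σ.mb X).card ≤ G.maxInDegree := by
      have hs1 : (σ.mb s).card ≤ G.maxInDegree := by
        rw [h.1.mb s (hl s hs)]; exact hsink.card_le
      rcases List.mem_cons.1 hs with rfl | hs
      · exact hs1
      · exact (hsort'.1 s hs).trans hs1
    obtain ⟨f, L₁, E, N, h1, hXd, hI1⟩ := getNeighbors_spec sch h hX hcard
    obtain ⟨s₁, L₂, h2, h2t, h2f⟩ := condition1_spec sch hI1 hX hXd
    -- the failure of a condition moves on to the next variable
    have next : ∀ τ : State V, τ.rem = σ.rem → τ.mb = σ.mb → ¬ G.IsSink σ.rem X →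
        Inv G ci (k + 1) τ →
        Inv G ci (k + (X :: l).length)
          (removeFirst ci sch l { τ with skipVec := insert X τ.skipVec }) ∧
        ∃ Y ∈ σ.rem, (removeFirst ci sch l { τ with skipVec := insert X τ.skipVec }).rem =
          σ.rem.erase Y := by
      intro τ hr hm hns hI
      have hs' : s ∈ l := (List.mem_cons.1 hs).resolve_left fun e => hns (e ▸ hsink)
      have := ih (σ := { τ with skipVec := insert X τ.skipVec }) (k := k + 1)
        (hI.skip (by rwa [hr])) (fun Y hY => by simpa [hr] using hl Y (List.mem_cons_of_mem _ hY))
        hs' (by simpa [hr] using hsink) (by simpa [hm] using hsort'.2)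
      rw [show k + (X :: l).length = k + 1 + l.length by simp; omega]
      simpa only [hr] using this
    rw [removeFirst]
    simp only [h1]
    dsimp only at h2 h2t h2f
    cases hb1 : (condition1 ci sch X (G.nbrs X (σ.mb X))
      { σ with sepset := f, log := L₁, edges := E, nbrsDone := N }).1 with
    | false =>
      obtain ⟨hI2, hnc⟩ := h2f hb1
      simp only [Bool.false_eq_true, if_false, h2]
      refine next { σ with
        sepset := f
        log := L₂
        edges := E
        nbrsDone := N
        skipCond1 := s₁ } rfl rfl (fun hsk => hnc ?_) hI2
      rw [h.1.mb X hX]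
      exact hsk.cond1 h.1.oracle hX
    | true =>
      obtain ⟨hI2, hc1⟩ := h2t hb1
      obtain ⟨W, L₃, N', h3, hXv, hI3⟩ := getVS_spec sch hI2 hX hXd
      obtain ⟨s₂, L₄, h4, h4t, h4f⟩ := condition2_spec sch hI3 hX hXd hXv
      dsimp only at h3 h4 h4t h4f
      simp only [if_true, h2, h3]
      cases hb2 : (condition2 ci sch X (G.nbrs X (σ.mb X)) (G.coparents X (σ.mb X))
        { σ with
          sepset := f
          log := L₃
          edges := E
          nbrsDone := N
          skipCond1 := s₁
          vs := W
          vsDone := N' }).1 with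
      | false =>
        obtain ⟨hI4, hns⟩ := h4f hb2
        simp only [Bool.false_eq_true, if_false, h4]
        exact next { σ with
          sepset := f
          log := L₄
          edges := E
          nbrsDone := N
          skipCond1 := s₁
          vs := W
          vsDone := N'
          skipCond2 := s₂ } rfl rfl hns hI4
      | true =>
        obtain ⟨hI4, hc2⟩ := h4t hb2
        simp only [if_true, h4]
        have hrem : (G.restrict σ.rem).Removable X := by
          rw [h.1.mb X hX] at hc1 hc2
          exact h.1.oracle.removable hX hc1 hc2
        obtain ⟨hI5, hr⟩ := updateMb_spec sch hI4 hX hXd hrem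
        exact ⟨hI5.mono (Nat.le_add_right _ _), X, hX, hr⟩

/-- The remaining graph has a sink, and no sink is flagged, so the list meets the requirement of
`removeFirst_spec`. -/
theorem iteration_spec (sch : Schedule V) (h : Inv G ci k σ) (hne : σ.rem.Nonempty) :
    Inv G ci (k + Fintype.card V) (iteration ci sch σ) ∧
      (iteration ci sch σ).rem.card + 1 = σ.rem.card := by
  obtain ⟨s, hs, hsink⟩ := DAG.exists_isSink (G := G) hne
  unfold iteration
  set l := (sch.vertices σ (σ.rem \ σ.skipVec)).mergeSort
      fun X Y => decide ((σ.mb X).card ≤ (σ.mb Y).card) with hl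
  have hperm : l.Perm (sch.vertices σ (σ.rem \ σ.skipVec)) := List.mergeSort_perm _ _
  have hmem : ∀ X, X ∈ l ↔ X ∈ σ.rem \ σ.skipVec := fun X => by
    rw [hperm.mem_iff, sch.mem_vertices]
  have hsort : l.Pairwise fun X Y => (σ.mb X).card ≤ (σ.mb Y).card := by
    have := List.pairwise_mergeSort (le := fun X Y => decide ((σ.mb X).card ≤ (σ.mb Y).card))
      (fun a b c => by simpa using fun h1 h2 => le_trans h1 h2)
      (fun a b => by simpa using le_total _ _) (sch.vertices σ (σ.rem \ σ.skipVec))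
    simpa using this
  obtain ⟨h1, X, hX, h2⟩ := removeFirst_spec sch l h
    (fun X hX => (Finset.mem_sdiff.1 ((hmem X).1 hX)).1)
    ((hmem s).2 (Finset.mem_sdiff.2 ⟨hs, fun hsk => h.1.skipVec s hs hsk hsink⟩)) hsink hsort
  refine ⟨h1.mono (Nat.add_le_add_left ?_ k), by rw [h2]; exact Finset.card_erase_add_one hX⟩
  exact length_le_of_nodup (s := Finset.univ) (hperm.nodup_iff.2 (sch.nodup_vertices _ _))
    fun _ _ => Finset.mem_univ _

theorem run_spec (sch : Schedule V) (ho : G.Oracle ci Finset.univ) :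
    Inv G ci ((Fintype.card V - 1) * Fintype.card V) (run ci sch) ∧ (run ci sch).rem.card ≤ 1 := by
  suffices H : ∀ i ≤ Fintype.card V - 1,
      Inv G ci (i * Fintype.card V) ((iteration ci sch)^[i] (computeMb ci sch initialState)) ∧
      ((iteration ci sch)^[i] (computeMb ci sch initialState)).rem.card + i = Fintype.card V by
    obtain ⟨h1, h2⟩ := H _ le_rfl
    exact ⟨h1, by unfold run; omega⟩
  obtain ⟨hI, hr⟩ := computeMb_spec sch ho
  intro i
  induction i with
  | zero => intro _; exact ⟨by simpa using hI, by simp [hr, Finset.card_univ]⟩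
  | succ i ih =>
    intro hi
    obtain ⟨h1, h2⟩ := ih (by omega)
    rw [Function.iterate_succ_apply']
    obtain ⟨h3, h4⟩ := iteration_spec sch h1 (Finset.card_pos.1 (by omega))
    exact ⟨by rwa [add_mul, one_mul], by omega⟩

/-! ### Completeness and complexity -/

theorem output_eq_skeleton (sch : Schedule V) (ho : G.Oracle ci Finset.univ) :
    output ci sch = G.skeleton := by
  obtain ⟨⟨hs, -⟩, hcard⟩ := run_spec sch ho
  ext x y
  rw [output, SimpleGraph.fromEdgeSet_adj, Finset.mem_coe]
  constructor
  · rintro ⟨h, -⟩; exact hs.adj_of_edges x y h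
  · intro h
    have ha : G.Adj x y := h
    refine ⟨?_, ha.ne⟩
    -- At most one variable remains, so at least one end point of the edge was removed, and its
    -- edges are recorded.
    by_cases hx : x ∈ (run ci sch).rem
    · have hy : y ∉ (run ci sch).rem := fun hy => ha.ne (Finset.card_le_one.1 hcard x hx y hy)
      rw [Sym2.eq_swap]
      exact hs.edges_of_adj y x ha.symm (.inl hy)
    · exact hs.edges_of_adj x y ha (.inl hx)

theorem numUnique_le (sch : Schedule V) (ho : G.Oracle ci Finset.univ) :
    (numUnique ci sch : ℝ) ≤ uniqueBound (Fintype.card V) G.maxInDegree := by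
  classical
  obtain ⟨⟨-, M, hM⟩, -⟩ := run_spec sch ho
  unfold numUnique
  generalize run ci sch = σ at hM
  set Δ := G.maxInDegree
  let T₀ : Finset (Purpose V × CITest V) := (unorderedPairs Finset.univ).image fun e =>
    (.computeMb, (e, Finset.univ.filter (· ∉ e)))
  let T₁ : V → Finset (Purpose V × CITest V) := fun X => (σ.log.filter fun t =>
    t.1 = .updateMb X).toFinset
  have hsub : σ.log.toFinset ⊆ T₀ ∪ Finset.univ.biUnion T₁ ∪
      σ.nbrsDone.biUnion fun X => G.testSet X (M X) := by
    intro t ht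
    rw [List.mem_toFinset] at ht
    simp only [Finset.mem_union, Finset.mem_biUnion]
    rcases hM.entries t ht with h | h | ⟨X, -, h⟩
    · exact .inl (.inl h)
    · exact .inr h
    · exact .inl (.inr ⟨X, Finset.mem_univ X, by simpa [T₁] using ⟨ht, h⟩⟩)
  have h0 : T₀.card ≤ (Fintype.card V).choose 2 := by
    refine Finset.card_image_le.trans ?_
    rw [card_unorderedPairs, Finset.card_univ]
  have h1 : (Finset.univ.biUnion T₁).card ≤ Fintype.card V * Δ.choose 2 :=
    Finset.card_biUnion_le_card_mul _ _ _ fun X _ => (List.toFinset_card_le _).trans (hM.update X)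
  have h2 : ((σ.nbrsDone.biUnion fun X => G.testSet X (M X)).card : ℝ) ≤
      Fintype.card V * (Δ / 2 * (1 + 0.45 * Δ) * 2 ^ Δ) := by
    calc ((σ.nbrsDone.biUnion fun X => G.testSet X (M X)).card : ℝ)
        ≤ ∑ X ∈ σ.nbrsDone, ((G.testSet X (M X)).card : ℝ) := by
          exact_mod_cast Finset.card_biUnion_le
      _ ≤ ∑ X ∈ σ.nbrsDone, ((Δ : ℝ) / 2 * (1 + 0.45 * Δ) * 2 ^ Δ) :=
          Finset.sum_le_sum fun X hX =>
            DAG.card_testSet_le (hM.self_notMem X hX) (hM.card_le X hX)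
      _ ≤ _ := by
          rw [Finset.sum_const, nsmul_eq_mul]
          gcongr
          exact Finset.card_le_univ _
  have h3 : σ.log.toFinset.card ≤ T₀.card + (Finset.univ.biUnion T₁).card +
      (σ.nbrsDone.biUnion fun X => G.testSet X (M X)).card :=
    (Finset.card_le_card hsub).trans ((Finset.card_union_le _ _).trans
      (Nat.add_le_add_right (Finset.card_union_le _ _) _))
  have h3' : (σ.log.toFinset.card : ℝ) ≤ T₀.card + (Finset.univ.biUnion T₁).card +
      (σ.nbrsDone.biUnion fun X => G.testSet X (M X)).card := by exact_mod_cast h3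
  have h0' : (T₀.card : ℝ) ≤ (Fintype.card V).choose 2 := by exact_mod_cast h0
  have h1' : ((Finset.univ.biUnion T₁).card : ℝ) ≤ Fintype.card V * Δ.choose 2 := by
    exact_mod_cast h1
  unfold uniqueBound
  linarith

theorem numTriples_le_numUnique (sch : Schedule V) : numTriples ci sch ≤ numUnique ci sch := by
  unfold numTriples numUnique
  rw [show ((run ci sch).log.map Prod.snd).toFinset = (run ci sch).log.toFinset.image Prod.snd by
    ext; simp]
  exact Finset.card_image_le

theorem numDuplicate_le (sch : Schedule V) (ho : G.Oracle ci Finset.univ) :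
    (numDuplicate ci sch : ℝ) ≤
      (Fintype.card V).choose 2 * (2 : ℝ) ^ ((G.maxInDegree : ℤ) - 1) := by
  obtain ⟨⟨-, M, hM⟩, -⟩ := run_spec sch ho
  obtain ⟨P, -, hP⟩ := hM.count
  have h : 4 * numDuplicate ci sch ≤
      (Fintype.card V - 1) * Fintype.card V * 2 ^ G.maxInDegree := by
    unfold numDuplicate numTests numUnique
    omega
  -- The exponent `Δ - 1` is an integer, not a natural number, so that `Δ = 0` gives the factor
  -- `1/2`.
  rw [zpow_sub₀ (by norm_num), zpow_natCast, zpow_one, Nat.cast_choose_two]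
  have h' : (4 : ℝ) * numDuplicate ci sch ≤
      ((Fintype.card V - 1 : ℕ) : ℝ) * Fintype.card V * 2 ^ G.maxInDegree := by exact_mod_cast h
  rcases Nat.eq_zero_or_pos (Fintype.card V) with h0 | h0
  · rw [h0] at h' ⊢
    simp only [CharP.cast_eq_zero, mul_zero, zero_mul, zero_div] at h' ⊢
    linarith
  · rw [Nat.cast_sub h0, Nat.cast_one] at h'
    linarith

theorem uniqueBound_isBigO : (fun p : ℕ × ℕ => uniqueBound p.1 p.2) =O[⊤]
    (fun p : ℕ × ℕ => (p.1 : ℝ) ^ 2 + p.1 * (p.2 : ℝ) ^ 2 * 2 ^ p.2) := by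
  -- The filter `⊤` asks for the bound at every pair. The last two terms of `uniqueBound` are each
  -- at most `n d^2 2^d`, whence the constant `2`.
  refine Asymptotics.IsBigO.of_bound 2 (Filter.eventually_top.2 ?_)
  rintro ⟨n, d⟩
  dsimp only [uniqueBound]
  have hc : ∀ m : ℕ, (m.choose 2 : ℝ) ≤ (m : ℝ) ^ 2 := fun m => by
    exact_mod_cast Nat.choose_le_pow m 2
  have hd : (d : ℝ) ≤ (d : ℝ) ^ 2 := by exact_mod_cast Nat.le_self_pow two_ne_zero d
  have hp : (1 : ℝ) ≤ 2 ^ d := one_le_pow₀ (by norm_num)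
  have h1 : (n : ℝ) * d.choose 2 ≤ n * (d : ℝ) ^ 2 * 2 ^ d := by
    calc (n : ℝ) * d.choose 2 ≤ n * (d : ℝ) ^ 2 * 1 := by rw [mul_one]; gcongr; exact hc d
      _ ≤ _ := by gcongr
  have h2 : (n : ℝ) / 2 * d * (1 + 0.45 * d) * 2 ^ d ≤ n * (d : ℝ) ^ 2 * 2 ^ d := by
    have : (n : ℝ) / 2 * d * (1 + 0.45 * d) ≤ n * (d : ℝ) ^ 2 := by
      have : (d : ℝ) * (1 + 0.45 * d) ≤ 2 * (d : ℝ) ^ 2 := by nlinarith [sq_nonneg (d : ℝ)]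
      have hn : (0 : ℝ) ≤ n / 2 := by positivity
      nlinarith [mul_le_mul_of_nonneg_left this hn]
    gcongr
  rw [Real.norm_of_nonneg (by positivity), Real.norm_of_nonneg (by positivity)]
  have := hc n
  nlinarith [sq_nonneg (n : ℝ)]

theorem oracle_univ {E : V → Type*} [∀ v, MeasurableSpace (E v)]
    [∀ v, StandardBorelSpace (E v)] (P : Measure (∀ v, E v)) [IsProbabilityMeasure P]
    (hMarkov : IsMarkov P G) (hFaithful : IsFaithful P G)
    (hci : ∀ (x y : V) (S : Finset V), x ≠ y → x ∉ S → y ∉ S →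
      (ci (s(x, y), S) = true ↔ CondIndependent P x y S)) :
    G.Oracle ci Finset.univ := by
  intro x _ y _ S _ hxy hx hy
  rw [DAG.restrict_univ, DAG.conn_iff_not_dSep hx hy, ← Bool.not_eq_true, hci x y S hxy hx hy]
  exact not_congr ⟨hFaithful x y S hxy hx hy, hMarkov x y S hxy hx hy⟩

end Marvel

theorem mainTheorem10 :
    (∀ {V : Type*} [Fintype V] [DecidableEq V]
      {E : V → Type*} [∀ v, MeasurableSpace (E v)] [∀ v, StandardBorelSpace (E v)]
      (G : Marvel.DAG V)
      (P : MeasureTheory.Measure (∀ v, E v)) [MeasureTheory.IsProbabilityMeasure P]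
      (_hMarkov : Marvel.IsMarkov P G) (_hFaithful : Marvel.IsFaithful P G)
      (ci : Marvel.CITest V → Bool)
      (_hci : ∀ (x y : V) (S : Finset V), x ≠ y → x ∉ S → y ∉ S →
        (ci (s(x, y), S) = true ↔ Marvel.CondIndependent P x y S))
      (sch : Marvel.Schedule V),
      Marvel.output ci sch = G.skeleton ∧
      (Marvel.numUnique ci sch : ℝ) ≤ Marvel.uniqueBound (Fintype.card V) G.maxInDegree ∧
      (Marvel.numTriples ci sch : ℝ) ≤ Marvel.uniqueBound (Fintype.card V) G.maxInDegree ∧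
      (Marvel.numDuplicate ci sch : ℝ) ≤
        (Fintype.card V).choose 2 * (2 : ℝ) ^ ((G.maxInDegree : ℤ) - 1)) ∧
    (fun p : ℕ × ℕ => Marvel.uniqueBound p.1 p.2) =O[⊤]
      (fun p : ℕ × ℕ => (p.1 : ℝ) ^ 2 + p.1 * (p.2 : ℝ) ^ 2 * 2 ^ p.2) := by
  refine ⟨fun {V} _ _ {E} _ _ G P _ hMarkov hFaithful ci hci sch => ?_, Marvel.uniqueBound_isBigO⟩
  have ho := Marvel.oracle_univ P hMarkov hFaithful hci
  have hu := Marvel.numUnique_le sch ho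
  exact ⟨Marvel.output_eq_skeleton sch ho, hu,
    le_trans (by exact_mod_cast Marvel.numTriples_le_numUnique sch) hu,
    Marvel.numDuplicate_le sch ho⟩
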